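/- **Setting.** Let $N>1$, let $(e_i)_{1\le i\le N}$ be the canonical basis of $\mathbb R^N$, $J_i=\mathbb R_+e_i$ and $\mathcal G=\bigcup_{i=1}^N J_i$ (a junction with vertex $0$). Let $T>0$ and $p>1$. For $1\le i\le N$ let $g_i\in C_b(\mathbb R_+)$ and let $\ell_i\in C(\mathbb R_+\times\mathbb R\times[0,T])$ be real-valued, such that $\ell_i(\cdot,\cdot,s)$ is differentiable for every $s\in[0,T]$ and $\partial_y\ell_i,\partial_a\ell_i$ are continuous in $(y,a,s)$; let $\ell_*\in C([0,T])$ and $g_*\in\mathbb R$. Assume: * [H1] there are $C_0>0$ and $c_0\in\mathbb R$ such that $\ell_i(y,a,s)\ge C_0|a|^p+c_0$ and $\ell_*(s)\ge c_0$ for all $i$, $y\ge0$, $a\in\mathbb R$, $s\in[0,T]$; * [H2] for every $r>0$ there is a modulus of continuity $\omega_r$ such that $|\ell_i(y,a,t_1)-\ell_i(y,a,t_2)|\le(1+|a|^p)\,\omega_r(|t_1-t_2|)$ for all $i$, $y\in[0,r]$, $a\in\mathbb R$, $t_1,t_2\in[0,T]$; * [H3] for every $r>0$ there is $\tilde c(r)\ge0$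 such that $|\partial_y\ell_i(y,a,s)|\le\tilde c(r)(|a|^p+1)$ and $|\partial_a\ell_i(y,a,s)|\le\tilde c(r)(|a|^{p-1}+1)$ for all $i$, $y\in[0,r]$, $a\in\mathbb R$, $s\in[0,T]$; * [H4] $a\mapsto\ell_i(y,a,s)$ is strictly convex for all $i$, $y\ge 0$, $s\in[0,T]$; * [H5] $g_i\in C^1(\mathbb R_+)$ for all $i$. For $x\in\mathcal G$ and $t\in[0,T]$ let $\Gamma_t[x]$ be the set of $y\in C([t,T];\mathcal G)\cap W^{1,p}(t,T;\mathbb R^N)$ with $y(t)=x$. Set $\ell_0(\tau)=\min\{\ell_*(\tau),\min_i\ell_i(0,0,\tau)\}$, and let $L(y,v,\tau)=\ell_i(|y|,v\cdot e_i,\tau)$ if $y\in J_i\setminus\{0\}$, $L(0,v,\tau)=\ell_0(\tau)$; let $g(y)=g_i(|y|)$ if $y\in J_i\setminus\{0\}$ and $g(0)=\min\{g_*,\min_ig_i(0)\}$. Let $$J_t(x;y)=\int_t^TL(y(\tau),y'(\tau),\tau)\,d\tau+g(y(T)),\qquad u(x,t)=\inf_{y\in\Gamma_t[x]}J_t(x;y),$$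 and let $\Gamma_t^{\rm opt}[x]=\{y\in\Gamma_t[x]: J_t(x;y)=u(x,t)\}$ be the set of optimal trajectories. For $t\in[0,T)$ and $x\in J_i\setminus\{0\}$ let $$\mathcal A(x,t)=\{z'(t)\cdot e_i: z\in\Gamma_t^{\rm opt}[x]\},$$ where $z'(t)$ is the right derivative at $t$; let $D_xu(x,t)$ be the derivative of $r\mapsto u(re_i,t)$ at $r=|x|$. Let $H_i(x,q,t)=\sup_{\zeta\in\mathbb R}\{-q\zeta-\ell_i(x,\zeta,t)\}$ for $x\ge0$, $q\in\mathbb R$. **Statement.** Let $t\in[0,T)$, $x=\bar xe_i$ with $\bar x>0$, $y\in\Gamma_t^{\rm opt}[x]$, and let $t_*=T\wedge\min\{\tau\in[t,T]:y(\tau)=0\}$ (so $t_*=T$ if $y$ does not reach $0$). For $s\in[t,t_*)$ one has $y(s)=\bar y(s)e_i$ with $\bar y(s)=|y(s)|>0$, and every $z\in\Gamma_s^{\rm opt}[y(s)]$ is such that $z\cdot e_i$ has a right derivative at $s$. Moreover: 1. for every $s\in(t,t_*)$, $\mathcal A(y(s),s)$ is a singleton; 2. $D_xu(x,t)$ exists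 if and only if $\mathcal A(x,t)$ is a singleton; in this case $\partial_pH_i(\bar x,\cdot,t)$ (the derivative in the second variable) exists at $D_xu(x,t)$ and $$\mathcal A(x,t)=\{a\in\mathbb R:\partial_a\ell_i(\bar x,a,t)=-D_xu(x,t)\}=\{-\partial_pH_i(\bar x,D_xu(x,t),t)\};$$ 3. for every $s\in(t,t_*)$, $\bar y$ is differentiable at $s$, $u(\cdot,s)$ is differentiable at $y(s)$ (along $J_i$), and $D_xu(y(s),s)=-\partial_a\ell_i(\bar y(s),\bar y'(s),s)$. -/

import Mathlib

open Set Filter MeasureTheory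
open scoped Topology

noncomputable section

namespace JunctionControl

/-- The point `r e_i` of `ℝ^N`. -/
def point {N : ℕ} (i : Fin N) (r : ℝ) : EuclideanSpace ℝ (Fin N) :=
  r • EuclideanSpace.single i (1 : ℝ)

/-- The edge `J_i = ℝ_+ e_i`. -/
def edge {N : ℕ} (i : Fin N) : Set (EuclideanSpace ℝ (Fin N)) :=
  point i '' Ici 0

/-- The junction, i.e. the union of the `N` edges; its vertex is `0`. -/
def junction (N : ℕ) : Set (EuclideanSpace ℝ (Fin N)) :=
  ⋃ i : Fin N, edge i

/-- The continuous representatives of the functions in `W^{1,p}(a, b; E)`: the functions which are,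
on `[a, b]`, the primitive of some function of `L^p(a, b; E)` (in particular they are
continuous on `[a, b]`, and their weak derivative is their a.e. derivative).
Values outside `[a, b]` are irrelevant. -/
def MemW1p {E : Type*} [NormedAddCommGroup E] [NormedSpace ℝ E]
    (p a b : ℝ) (y : ℝ → E) : Prop :=
  ∃ α : ℝ → E, MemLp α (ENNReal.ofReal p) (volume.restrict (Icc a b)) ∧
    ∀ s ∈ Icc a b, y s = y a + ∫ τ in a..s, α τ

/-- A modulus of continuity. -/
def IsModulus (ω : ℝ → ℝ) : Prop :=
  ω 0 = 0 ∧ MonotoneOn ω (Ici 0) ∧ Tendsto ω (𝓝[≥] 0) (𝓝 0)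

/-- The data of an optimal control problem on the junction with `N` edges: horizon `T`, growth
exponent `p`, running costs `ℓ i y a s` for `y ≥ 0`, `a ∈ ℝ`, `s ∈ [0, T]`, and terminal costs
`g i y` for `y ≥ 0`, together with the specific costs `ℓStar`, `gStar` at the vertex. -/
structure Problem (N : ℕ) where
  T : ℝ
  p : ℝ
  ℓ : Fin N → ℝ → ℝ → ℝ → ℝ
  ℓStar : ℝ → ℝ
  g : Fin N → ℝ → ℝ
  gStar : ℝ

namespace Problem

variable {N : ℕ} (P : Problem N)

/-- `∂_y ℓ_i(y, a, s)`, one-sided at `y = 0`. -/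
def partialY (i : Fin N) (y a s : ℝ) : ℝ := derivWithin (fun z => P.ℓ i z a s) (Ici 0) y

/-- `∂_a ℓ_i(y, a, s)`. -/
def partialA (i : Fin N) (y a s : ℝ) : ℝ := deriv (fun b => P.ℓ i y b s) a

/-- Basic conditions on the data: `T > 0`, `p > 1`, `g_i ∈ C_b(ℝ_+)`, `ℓ_* ∈ C([0,T])`,
`ℓ_i ∈ C(ℝ_+ × ℝ × [0,T])` is differentiable in its first two variables, with partial derivatives
continuous in all the variables. -/
structure Regular : Prop where
  T_pos : 0 < P.T
  one_lt_p : 1 < P.p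
  g_continuous : ∀ i, ContinuousOn (P.g i) (Ici 0)
  g_bounded : ∀ i, ∃ C : ℝ, ∀ r ∈ Ici (0 : ℝ), |P.g i r| ≤ C
  ℓStar_continuous : ContinuousOn P.ℓStar (Icc 0 P.T)
  ℓ_continuous : ∀ i, ContinuousOn (fun q : ℝ × ℝ × ℝ => P.ℓ i q.1 q.2.1 q.2.2)
    (Ici 0 ×ˢ univ ×ˢ Icc 0 P.T)
  ℓ_differentiable : ∀ i, ∀ s ∈ Icc 0 P.T,
    DifferentiableOn ℝ (fun q : ℝ × ℝ => P.ℓ i q.1 q.2 s) (Ici 0 ×ˢ univ)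
  partialY_continuous : ∀ i, ContinuousOn (fun q : ℝ × ℝ × ℝ => P.partialY i q.1 q.2.1 q.2.2)
    (Ici 0 ×ˢ univ ×ˢ Icc 0 P.T)
  partialA_continuous : ∀ i, ContinuousOn (fun q : ℝ × ℝ × ℝ => P.partialA i q.1 q.2.1 q.2.2)
    (Ici 0 ×ˢ univ ×ˢ Icc 0 P.T)

/-- Coercivity of the running costs. -/
def H1 : Prop :=
  ∃ C₀ c₀ : ℝ, 0 < C₀ ∧
    (∀ i, ∀ y ∈ Ici (0 : ℝ), ∀ a : ℝ, ∀ s ∈ Icc 0 P.T, C₀ * |a| ^ P.p + c₀ ≤ P.ℓ i y a s) ∧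
    (∀ s ∈ Icc 0 P.T, c₀ ≤ P.ℓStar s)

/-- Equicontinuity in time of the running costs. -/
def H2 : Prop :=
  ∀ r : ℝ, 0 < r → ∃ ω : ℝ → ℝ, IsModulus ω ∧
    ∀ i, ∀ y ∈ Icc 0 r, ∀ a : ℝ, ∀ t₁ ∈ Icc 0 P.T, ∀ t₂ ∈ Icc 0 P.T,
      |P.ℓ i y a t₁ - P.ℓ i y a t₂| ≤ (1 + |a| ^ P.p) * ω |t₁ - t₂|

/-- Growth of the partial derivatives of the running costs. -/
def H3 : Prop :=
  ∀ r : ℝ, 0 < r → ∃ c : ℝ, 0 ≤ c ∧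
    ∀ i, ∀ y ∈ Icc 0 r, ∀ a : ℝ, ∀ s ∈ Icc 0 P.T,
      |P.partialY i y a s| ≤ c * (|a| ^ P.p + 1) ∧
      |P.partialA i y a s| ≤ c * (|a| ^ (P.p - 1) + 1)

/-- Strict convexity in the velocity of the running costs. -/
def H4 : Prop :=
  ∀ i, ∀ y ∈ Ici (0 : ℝ), ∀ s ∈ Icc 0 P.T, StrictConvexOn ℝ univ (fun a => P.ℓ i y a s)

/-- The terminal costs are `C^1` on `[0, ∞)`. -/
def H5 : Prop := ∀ i, ContDiffOn ℝ 1 (P.g i) (Ici 0)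

/-- The cost `ℓ_0` for staying at the vertex. -/
def vertexCost (τ : ℝ) : ℝ := min (P.ℓStar τ) (⨅ i, P.ℓ i 0 0 τ)

/-- The running cost `L(y, v, τ)`; on `J_i \ {0}` the velocity `v` enters through its component
along `e_i`. -/
def runningCost (y v : EuclideanSpace ℝ (Fin N)) (τ : ℝ) : ℝ :=
  (∑ i, (edge i \ {0}).indicator (fun _ => P.ℓ i ‖y‖ (v i) τ) y) +
    ({0} : Set (EuclideanSpace ℝ (Fin N))).indicator (fun _ => P.vertexCost τ) y

/-- The terminal cost `g` on the junction. -/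
def terminalCost (y : EuclideanSpace ℝ (Fin N)) : ℝ :=
  (∑ i, (edge i \ {0}).indicator (fun _ => P.g i ‖y‖) y) +
    ({0} : Set (EuclideanSpace ℝ (Fin N))).indicator (fun _ => min P.gStar (⨅ i, P.g i 0)) y

/-- `Γ_t[x]`: the admissible trajectories starting from `x` at time `t`. -/
def admissible (t : ℝ) (x : EuclideanSpace ℝ (Fin N)) : Set (ℝ → EuclideanSpace ℝ (Fin N)) :=
  {y | MemW1p P.p t P.T y ∧ (∀ s ∈ Icc t P.T, y s ∈ junction N) ∧ y t = x}

/-- The cost `J_t(x; y)` of a trajectory; it depends on `x` only through `y t = x`. -/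
def cost (t : ℝ) (y : ℝ → EuclideanSpace ℝ (Fin N)) : ℝ :=
  (∫ τ in t..P.T, P.runningCost (y τ) (deriv y τ) τ) + P.terminalCost (y P.T)

/-- The value function `u(x, t)`. -/
def value (x : EuclideanSpace ℝ (Fin N)) (t : ℝ) : ℝ := sInf (P.cost t '' P.admissible t x)

/-- `Γ_t^opt[x]`: the optimal trajectories starting from `x` at time `t`. -/
def optimal (t : ℝ) (x : EuclideanSpace ℝ (Fin N)) : Set (ℝ → EuclideanSpace ℝ (Fin N)) :=
  {y | y ∈ P.admissible t x ∧ P.cost t y = P.value x t}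

/-- `𝒜(x, t) = {z'(t) · e_i : z ∈ Γ_t^opt[x]}` for `x ∈ J_i \ {0}`; since trajectories live on
`[t, T]`, `z'(t)` is a right derivative. -/
def initialVelocities (i : Fin N) (x : EuclideanSpace ℝ (Fin N)) (t : ℝ) : Set ℝ :=
  {a | ∃ z ∈ P.optimal t x, HasDerivWithinAt (fun s => z s i) a (Icc t P.T) t}

/-- The Hamiltonian `H_i(x, q, t) = sup_ζ (- q ζ - ℓ_i(x, ζ, t))`. -/
def hamiltonian (i : Fin N) (x q t : ℝ) : ℝ := ⨆ ζ : ℝ, (-q * ζ - P.ℓ i x ζ t)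

/-- `t_* = T ∧ min {τ ∈ [t, T] : y(τ) = 0}`, which is `T` if `y` does not reach the vertex. -/
def hittingTime (t : ℝ) (y : ℝ → EuclideanSpace ℝ (Fin N)) : ℝ :=
  sInf (insert P.T {τ | τ ∈ Icc t P.T ∧ y τ = 0})

end Problem

end JunctionControl

end

noncomputable section
namespace JunctionControl

/-! Inside an edge an optimal trajectory minimises a scalar problem of the calculus of variations
whose Lagrangian is strictly convex and superlinear in the velocity. Variations with fixed ends and
the lemma of du Bois-Reymond show that the momentum `∂_a ℓ_i(c, v, s)` is a.e. a constant plus the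
primitive of `∂_y ℓ_i(c, v, s)`. Since `∂_a ℓ_i` is an increasing bijection of `ℝ` in the velocity,
the velocity has a continuous representative and the Euler-Lagrange equation holds classically
(`exists_deriv_of_optimal`); in particular the right derivatives exist.

Moving one end of an optimal curve along an affine weight leaves, by Euler-Lagrange, only a boundary
term in the first variation. At the initial point this yields a smooth function touching `u` from
above with slope `-∂_a ℓ_i` (`exists_upper_touch`), at later points one touching from below
(`exists_lower_touch`). If `u` is differentiable at the initial point, every optimal initial
velocity therefore solves `∂_a ℓ_i = -D_x u`, which has only one solution. At an intermediate time
both functions are available with the same slope, so `u` is differentiable; uniqueness of the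
velocity there follows because an optimal curve continued by another optimal one is optimal, hence
`C^1` across the gluing time (`interior_time`).

The hard direction is that a single initial velocity `a` forces differentiability at the initial
time (`hasDerivAt_value_of_singleton`). Touching from above gives one half. For the other, suppose
that the expansion from below fails along points `x + h`, and take nearly optimal trajectories from
these points. Coercivity bounds their energy, so a subsequence converges uniformly to a trajectory
from `x`, which is optimal by lower semicontinuity (`exists_subseq_optimal`) and thus starts with
velocity `a`. Convergence of the costs near the initial time makes the integrated Bregman gap of the
strictly convex costs vanish, so that a subsequence of velocities converges a.e. under a dominating
function (`exists_subseq_velocity`). The nearly optimal trajectories can then be shifted back to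
start at `x`, and the derivative of the cost in this direction passes to the limit `-∂_a ℓ_i(x, a,
t)` (`exists_subseq_shift`), which contradicts the failure.

The formula with the Hamiltonian is Legendre duality (`Regular.hasDerivAt_hamiltonian`). -/

/-! ### Inequalities for real powers -/

lemma rpow_add_abs_le {p : ℝ} (hp : 1 < p) (x y : ℝ) :
    |x + y| ^ p ≤ 2 ^ p * (|x| ^ p + |y| ^ p) := by
  have hp0 : 0 ≤ p := by linarith
  have h1 : |x + y| ≤ 2 * max |x| |y| := by
    have := abs_add_le x y
    have := le_max_left |x| |y|
    have := le_max_right |x| |y|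
    linarith
  calc |x + y| ^ p ≤ (2 * max |x| |y|) ^ p := Real.rpow_le_rpow (abs_nonneg _) h1 hp0
    _ = 2 ^ p * (max |x| |y|) ^ p := Real.mul_rpow (by norm_num) (by positivity)
    _ ≤ _ := by
      gcongr
      have hx : 0 ≤ |x| ^ p := by positivity
      have hy : 0 ≤ |y| ^ p := by positivity
      rcases max_cases |x| |y| with h | h <;> rw [h.1] <;> linarith

lemma rpow_sub_one_le {p : ℝ} (hp : 1 < p) {x : ℝ} (hx : 0 ≤ x) : x ^ (p - 1) ≤ x ^ p + 1 := by
  rcases le_total x 1 with h | h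
  · have := Real.rpow_le_one hx h (by linarith : 0 ≤ p - 1)
    have : 0 ≤ x ^ p := by positivity
    linarith
  · have := Real.rpow_le_rpow_of_exponent_le h (by linarith : p - 1 ≤ p)
    linarith

lemma le_rpow_add_one {p : ℝ} (hp : 1 < p) {x : ℝ} (hx : 0 ≤ x) : x ≤ x ^ p + 1 := by
  rcases le_total x 1 with h | h
  · have : 0 ≤ x ^ p := by positivity
    linarith
  · have := Real.rpow_le_rpow_of_exponent_le h hp.le
    rw [Real.rpow_one] at this
    linarith

lemma rpow_sub_one_mul_self {p : ℝ} (hp : 1 < p) {x : ℝ} (hx : 0 ≤ x) :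
    x ^ (p - 1) * x = x ^ p := by
  rcases hx.eq_or_lt with rfl | h
  · rw [mul_zero, Real.zero_rpow (by linarith)]
  · rw [← Real.rpow_add_one h.ne']; congr 1; ring

/-- Young's inequality in a form that gives equi-integrability of bounded sets of `L^p`. -/
lemma exists_le_mul_rpow_add {p : ℝ} (hp : 1 < p) {lam : ℝ} (hl : 0 < lam) :
    ∃ C : ℝ, 0 ≤ C ∧ ∀ x : ℝ, |x| ≤ lam * |x| ^ p + C := by
  -- The threshold at which `lam * M ^ (p - 1) = 1`: above it the power dominates, below it the
  -- constant does.
  set M := (lam⁻¹) ^ ((p - 1)⁻¹) with hM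
  have hM0 : 0 < M := by positivity
  refine ⟨M, hM0.le, fun x => ?_⟩
  rcases le_total |x| M with h | h
  · have : 0 ≤ lam * |x| ^ p := by positivity
    linarith
  · have h1 : M ^ (p - 1) ≤ |x| ^ (p - 1) := Real.rpow_le_rpow hM0.le h (by linarith)
    have h2 : M ^ (p - 1) = lam⁻¹ := by
      rw [hM, ← Real.rpow_mul (by positivity), inv_mul_cancel₀ (by linarith), Real.rpow_one]
    have h3 : 1 ≤ lam * |x| ^ (p - 1) := by
      rw [h2] at h1
      have := mul_le_mul_of_nonneg_left h1 hl.le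
      rwa [mul_inv_cancel₀ hl.ne'] at this
    have h4 := mul_le_mul_of_nonneg_right h3 (abs_nonneg x)
    rw [one_mul, mul_assoc, rpow_sub_one_mul_self hp (abs_nonneg x)] at h4
    linarith

/-! ### Partial derivatives of the running costs -/

namespace Problem

variable {N : ℕ} {P : Problem N}

lemma Regular.hasDerivAt_partialA (hP : P.Regular) (i : Fin N) {y s : ℝ} (hy : 0 ≤ y)
    (hs : s ∈ Icc 0 P.T) (a : ℝ) :
    HasDerivAt (fun b => P.ℓ i y b s) (P.partialA i y a s) a := by
  have h := hP.ℓ_differentiable i s hs (y, a) ⟨hy, mem_univ _⟩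
  have h2 : DifferentiableWithinAt ℝ (fun b : ℝ => (y, b)) univ a := by fun_prop
  have h3 : DifferentiableWithinAt ℝ (fun b => P.ℓ i y b s) univ a :=
    DifferentiableWithinAt.comp (g := fun q : ℝ × ℝ => P.ℓ i q.1 q.2 s) a h h2
      (fun b _ => ⟨hy, mem_univ _⟩)
  exact (differentiableWithinAt_univ.mp h3).hasDerivAt

lemma Regular.hasDerivWithinAt_partialY (hP : P.Regular) (i : Fin N) {y s : ℝ} (hy : 0 ≤ y)
    (hs : s ∈ Icc 0 P.T) (a : ℝ) :
    HasDerivWithinAt (fun z => P.ℓ i z a s) (P.partialY i y a s) (Ici 0) y := by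
  have h := hP.ℓ_differentiable i s hs (y, a) ⟨hy, mem_univ _⟩
  have h2 : DifferentiableWithinAt ℝ (fun z : ℝ => (z, a)) (Ici 0) y := by fun_prop
  have h3 : DifferentiableWithinAt ℝ (fun z => P.ℓ i z a s) (Ici 0) y :=
    DifferentiableWithinAt.comp (g := fun q : ℝ × ℝ => P.ℓ i q.1 q.2 s)
      (f := fun z : ℝ => (z, a)) (t := Ici 0 ×ˢ univ) y h h2 (fun b hb => ⟨hb, mem_univ _⟩)
  exact h3.hasDerivWithinAt

/-- The chain rule along a segment that stays in `y > 0`. -/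
lemma Regular.hasDerivAt_segment (hP : P.Regular) (i : Fin N) {s : ℝ} (hs : s ∈ Icc 0 P.T)
    (y a φ ψ θ : ℝ) (h : 0 < y + θ * φ) :
    HasDerivAt (fun θ => P.ℓ i (y + θ * φ) (a + θ * ψ) s)
      (P.partialY i (y + θ * φ) (a + θ * ψ) s * φ + P.partialA i (y + θ * φ) (a + θ * ψ) s * ψ)
      θ := by
  set q : ℝ × ℝ := (y + θ * φ, a + θ * ψ) with hq
  have hn : (Ici 0 ×ˢ univ : Set (ℝ × ℝ)) ∈ 𝓝 q :=
    prod_mem_nhds (Ici_mem_nhds h) univ_mem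
  obtain ⟨D, hD⟩ : DifferentiableAt ℝ (fun q : ℝ × ℝ => P.ℓ i q.1 q.2 s) q :=
    (hP.ℓ_differentiable i s hs q ⟨h.le, mem_univ _⟩).differentiableAt hn
  have hA : HasDerivAt (fun b => P.ℓ i q.1 b s) (D (0, 1)) q.2 := by
    have := hD.comp_hasDerivAt (f := fun b : ℝ => (q.1, b)) q.2
      ((hasDerivAt_const _ _).prodMk (hasDerivAt_id q.2))
    exact this
  have hY : HasDerivAt (fun z => P.ℓ i z q.2 s) (D (1, 0)) q.1 := by
    have := hD.comp_hasDerivAt (f := fun b : ℝ => (b, q.2)) q.1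
      ((hasDerivAt_id q.1).prodMk (hasDerivAt_const _ _))
    exact this
  have e1 : P.partialA i q.1 q.2 s = D (0, 1) := hA.deriv
  have e2 : P.partialY i q.1 q.2 s = D (1, 0) :=
    hY.hasDerivWithinAt.derivWithin ((uniqueDiffOn_Ici 0) _ h.le)
  have hc : HasDerivAt (fun θ : ℝ => (y + θ * φ, a + θ * ψ)) (φ, ψ) θ := by
    refine HasDerivAt.prodMk ?_ ?_
    · simpa using ((hasDerivAt_id θ).mul_const φ).const_add y
    · simpa using ((hasDerivAt_id θ).mul_const ψ).const_add a
  have e3 : D (φ, ψ) = P.partialY i q.1 q.2 s * φ + P.partialA i q.1 q.2 s * ψ := by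
    have e : ((φ, ψ) : ℝ × ℝ) = φ • (1, 0) + ψ • (0, 1) := by simp
    rw [e, map_add, map_smul, map_smul, e1, e2, smul_eq_mul, smul_eq_mul, mul_comm φ, mul_comm ψ]
  have := hD.comp_hasDerivAt θ hc
  rw [e3] at this
  exact this

/-- Mean value theorem along a segment that stays in `y > 0`. -/
lemma Regular.exists_mean_value (hP : P.Regular) (i : Fin N) {s : ℝ} (hs : s ∈ Icc 0 P.T)
    (y a φ ψ : ℝ) {h : ℝ} (h0 : h ≠ 0) (hy : 0 < y) (hyh : 0 < y + h * φ) :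
    ∃ θ : ℝ, |θ| ≤ |h| ∧ (y + θ * φ) ∈ segment ℝ y (y + h * φ) ∧
      (P.ℓ i (y + h * φ) (a + h * ψ) s - P.ℓ i y a s) / h =
      P.partialY i (y + θ * φ) (a + θ * ψ) s * φ
        + P.partialA i (y + θ * φ) (a + θ * ψ) s * ψ := by
  -- The segment is parametrised by `r ∈ [0, 1]`, with `θ = r * h`, so that both signs of `h` are
  -- treated at once.
  have key : ∀ r ∈ Icc (0 : ℝ) 1, 0 < y + (r * h) * φ := by
    intro r hr
    have : y + (r * h) * φ = (1 - r) * y + r * (y + h * φ) := by ring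
    rw [this]
    rcases hr.1.eq_or_lt with rfl | h'
    · simpa using hy
    · have := mul_pos h' hyh
      have := mul_nonneg (by linarith [hr.2] : 0 ≤ 1 - r) hy.le
      linarith
  have hd : ∀ r ∈ Icc (0 : ℝ) 1, HasDerivAt
      (fun r => P.ℓ i (y + (r * h) * φ) (a + (r * h) * ψ) s)
      ((P.partialY i (y + (r * h) * φ) (a + (r * h) * ψ) s * φ
        + P.partialA i (y + (r * h) * φ) (a + (r * h) * ψ) s * ψ) * h) r := by
    intro r hr
    have h1 := hP.hasDerivAt_segment i hs y a φ ψ (r * h) (key r hr)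
    have h2 : HasDerivAt (fun r : ℝ => r * h) h r := by
      simpa using (hasDerivAt_id r).mul_const h
    exact h1.comp r h2
  obtain ⟨r, hr, he⟩ := exists_hasDerivAt_eq_slope _ _ (zero_lt_one' ℝ)
    (fun r hr => (hd r hr).continuousAt.continuousWithinAt) (fun r hr => hd r (Ioo_subset_Icc_self hr))
  refine ⟨r * h, ?_, ?_, ?_⟩
  · rw [abs_mul, abs_of_pos hr.1]
    exact mul_le_of_le_one_left (abs_nonneg _) hr.2.le
  · refine ⟨1 - r, r, by linarith [hr.2], hr.1.le, by ring, ?_⟩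
    simp only [smul_eq_mul]; ring
  · simp only [one_mul, zero_mul, add_zero, sub_zero, div_one] at he
    rw [← he, mul_div_assoc, div_self h0, mul_one]

/-! ### Growth -/

/-- The bound on `∂_y` is integrated at frozen velocity. Because of the factor `|a| ^ p + 1`,
displacing a curve by `δ` without touching its velocity costs at most `δ` times its energy. -/
lemma H3.lipschitz_y (h3 : P.H3) (hP : P.Regular) {r : ℝ} (hr : 0 < r) :
    ∃ c : ℝ, 0 ≤ c ∧ ∀ i, ∀ y₁ ∈ Icc 0 r, ∀ y₂ ∈ Icc 0 r, ∀ a : ℝ, ∀ s ∈ Icc 0 P.T,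
      |P.ℓ i y₁ a s - P.ℓ i y₂ a s| ≤ c * (|a| ^ P.p + 1) * |y₁ - y₂| := by
  obtain ⟨c, hc, h⟩ := h3 r hr
  refine ⟨c, hc, fun i y₁ hy₁ y₂ hy₂ a s hs => ?_⟩
  have := (convex_Icc 0 r).norm_image_sub_le_of_norm_hasDerivWithin_le
    (f := fun z => P.ℓ i z a s) (f' := fun z => P.partialY i z a s)
    (C := c * (|a| ^ P.p + 1))
    (fun x hx => (hP.hasDerivWithinAt_partialY i hx.1 hs a).mono Icc_subset_Ici_self)
    (fun x hx => (h i x hx a s hs).1) hy₂ hy₁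
  simpa using this

/-- At zero velocity compactness gives the bound; integrating the growth of `∂_a` from `0` to `a`
raises the exponent from `p - 1` to `p`. -/
lemma H3.upper_bound (h3 : P.H3) (hP : P.Regular) {r : ℝ} (hr : 0 < r) :
    ∃ C : ℝ, 0 ≤ C ∧ ∀ i, ∀ y ∈ Icc 0 r, ∀ a : ℝ, ∀ s ∈ Icc 0 P.T,
      |P.ℓ i y a s| ≤ C * (|a| ^ P.p + 1) := by
  obtain ⟨c, hc, h⟩ := h3 r hr
  have hb : ∀ i, ∃ B : ℝ, ∀ y ∈ Icc 0 r, ∀ s ∈ Icc 0 P.T, |P.ℓ i y 0 s| ≤ B := by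
    intro i
    have hK : IsCompact (Icc 0 r ×ˢ ({0} : Set ℝ) ×ˢ Icc 0 P.T) :=
      isCompact_Icc.prod (isCompact_singleton.prod isCompact_Icc)
    obtain ⟨B, hB⟩ := hK.exists_bound_of_continuousOn
      ((hP.ℓ_continuous i).mono (prod_mono Icc_subset_Ici_self (prod_mono (subset_univ _) le_rfl)))
    exact ⟨B, fun y hy s hs => hB (y, 0, s) ⟨hy, rfl, hs⟩⟩
  choose B hB using hb
  refine ⟨(∑ i, |B i|) + 2 * c, by positivity, fun i y hy a s hs => ?_⟩
  have h1 : |P.ℓ i y a s - P.ℓ i y 0 s| ≤ c * (|a| ^ (P.p - 1) + 1) * |a| := by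
    have := (convex_Icc (-|a|) |a|).norm_image_sub_le_of_norm_hasDerivWithin_le
      (f := fun z => P.ℓ i y z s) (f' := fun z => P.partialA i y z s)
      (C := c * (|a| ^ (P.p - 1) + 1))
      (fun x hx => (hP.hasDerivAt_partialA i hy.1 hs x).hasDerivWithinAt)
      (fun x hx => ((h i y hy x s hs).2).trans (by
        have : |x| ≤ |a| := abs_le.mpr hx
        have hp := hP.one_lt_p
        have := Real.rpow_le_rpow (abs_nonneg x) this (by linarith : 0 ≤ P.p - 1)
        gcongr)) (x := 0) (y := a) (by simp) (by simp [neg_abs_le, le_abs_self])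
    simpa using this
  have h2 : |P.ℓ i y 0 s| ≤ ∑ i, |B i| :=
    (hB i y hy s hs).trans ((le_abs_self _).trans
      (Finset.single_le_sum (f := fun i => |B i|) (fun _ _ => abs_nonneg _) (Finset.mem_univ i)))
  have h3' : (|a| ^ (P.p - 1) + 1) * |a| ≤ 2 * (|a| ^ P.p + 1) := by
    have e := rpow_sub_one_mul_self hP.one_lt_p (abs_nonneg a)
    have := le_rpow_add_one hP.one_lt_p (abs_nonneg a)
    have : 0 ≤ |a| ^ P.p := by positivity
    rw [add_mul, e]; linarith
  have h4 : |P.ℓ i y a s| ≤ |P.ℓ i y 0 s| + |P.ℓ i y a s - P.ℓ i y 0 s| := by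
    have := abs_add_le (P.ℓ i y 0 s) (P.ℓ i y a s - P.ℓ i y 0 s)
    simpa using this
  have h5 : 0 ≤ ∑ i, |B i| := by positivity
  have h6 : 0 ≤ |a| ^ P.p := by positivity
  have := mul_le_mul_of_nonneg_left h3' hc
  nlinarith

/-! ### Convexity -/

lemma Regular.convex_le (hP : P.Regular) (h4 : P.H4) (i : Fin N) {y s : ℝ} (hy : 0 ≤ y)
    (hs : s ∈ Icc 0 P.T) (a b : ℝ) :
    P.ℓ i y a s + P.partialA i y a s * (b - a) ≤ P.ℓ i y b s := by
  have hc := (h4 i y hy s hs).convexOn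
  have hd := hP.hasDerivAt_partialA i hy hs a
  rcases lt_trichotomy a b with h | h | h
  · have := hc.le_slope_of_hasDerivAt (mem_univ a) (mem_univ b) h hd
    rw [slope_def_field, le_div_iff₀ (by linarith)] at this
    linarith
  · subst h; simp
  · have := hc.slope_le_of_hasDerivAt (mem_univ b) (mem_univ a) h hd
    rw [slope_def_field, div_le_iff₀ (by linarith)] at this
    linarith

lemma Regular.strictMono_partialA (hP : P.Regular) (h4 : P.H4) (i : Fin N) {y s : ℝ} (hy : 0 ≤ y)
    (hs : s ∈ Icc 0 P.T) : StrictMono (fun a => P.partialA i y a s) := by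
  have := (h4 i y hy s hs).strictMonoOn_deriv
    (fun a _ => (hP.hasDerivAt_partialA i hy hs a).differentiableAt)
  exact strictMonoOn_univ.mp this

/-- Follow the tangent at `a` up to the midpoint, then the tangent at the midpoint; the strict
monotonicity of `∂_a` makes the second half strictly better. -/
lemma Regular.convex_lt (hP : P.Regular) (h4 : P.H4) (i : Fin N) {y s : ℝ} (hy : 0 ≤ y)
    (hs : s ∈ Icc 0 P.T) {a b : ℝ} (hab : a ≠ b) :
    P.ℓ i y a s + P.partialA i y a s * (b - a) < P.ℓ i y b s := by
  set m := (a + b) / 2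
  have h1 := hP.convex_le h4 i hy hs a m
  have h2 := hP.convex_le h4 i hy hs m b
  have hm := hP.strictMono_partialA h4 i hy hs
  have e1 : m - a = (b - a) / 2 := by simp only [m]; ring
  have e2 : b - m = (b - a) / 2 := by simp only [m]; ring
  rw [e1] at h1
  rw [e2] at h2
  rcases lt_or_gt_of_ne hab with h | h
  · have := hm (show a < m by simp only [m]; linarith)
    nlinarith
  · have := hm (show m < a by simp only [m]; linarith)
    nlinarith

lemma Regular.continuous_partialA (hP : P.Regular) (i : Fin N) {y s : ℝ} (hy : 0 ≤ y)
    (hs : s ∈ Icc 0 P.T) : Continuous (fun a => P.partialA i y a s) := by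
  rw [← continuousOn_univ]
  exact (hP.partialA_continuous i).comp (f := fun a : ℝ => (y, a, s)) (by fun_prop)
    (fun a _ => ⟨hy, mem_univ _, hs⟩)

/-- The affine function `ℓ_i(y, 0, s) + K |a|` is eventually dominated by `C₀ |a|^p + c₀`. -/
lemma Regular.exists_large (hP : P.Regular) (h1 : P.H1) (i : Fin N) {y s : ℝ} (hy : 0 ≤ y)
    (hs : s ∈ Icc 0 P.T) (K : ℝ) : ∃ A : ℝ, 0 < A ∧
      ∀ a, A ≤ |a| → P.ℓ i y 0 s + K * |a| < P.ℓ i y a s := by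
  obtain ⟨C₀, c₀, hC, h, -⟩ := h1
  have hp := hP.one_lt_p
  -- With this `lam`, `(|K| + 1) * |a|` is at most `C₀ * |a| ^ p` plus a constant; the spare `|a|`
  -- then beats all constants.
  obtain ⟨C, hC0, hy'⟩ := exists_le_mul_rpow_add hp (lam := C₀ / (|K| + 1)) (by positivity)
  refine ⟨max 1 (|P.ℓ i y 0 s| + |c₀| + (|K| + 1) * C + 1), by positivity, fun a ha => ?_⟩
  have h2 := h i y hy a s hs
  have h3 := hy' a
  have h4 : (|K| + 1) * |a| ≤ C₀ * |a| ^ P.p + (|K| + 1) * C := by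
    have := mul_le_mul_of_nonneg_left h3 (by positivity : 0 ≤ |K| + 1)
    rw [mul_add, ← mul_assoc, mul_div_cancel₀ _ (by positivity)] at this
    exact this
  have h5 := (le_max_right _ _).trans ha
  have h6 : K * |a| ≤ |K| * |a| := mul_le_mul_of_nonneg_right (le_abs_self K) (abs_nonneg a)
  have := neg_abs_le c₀
  have := le_abs_self (P.ℓ i y 0 s)
  linarith

/-- Superlinear growth pushes the slopes at `A` and `-A` beyond `m` on either side, and intermediate
values do the rest. With strict monotonicity, velocity and momentum determine each other. -/
lemma Regular.exists_partialA_eq (hP : P.Regular) (h1 : P.H1) (h4 : P.H4) (i : Fin N) {y s : ℝ}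
    (hy : 0 ≤ y) (hs : s ∈ Icc 0 P.T) (m : ℝ) : ∃ a, P.partialA i y a s = m := by
  obtain ⟨A, hA, h⟩ := hP.exists_large h1 i hy hs |m|
  have hA1 := h A (le_abs_self A)
  have hA2 := h (-A) (by rw [abs_neg]; exact le_abs_self A)
  rw [abs_neg] at hA2
  rw [abs_of_pos hA] at hA1 hA2
  have c1 := hP.convex_le h4 i hy hs A 0
  have c2 := hP.convex_le h4 i hy hs (-A) 0
  have i1 : m ≤ P.partialA i y A s := by
    have : |m| * A < P.partialA i y A s * A := by linarith
    exact (le_abs_self m).trans (lt_of_mul_lt_mul_right this hA.le).le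
  have i2 : P.partialA i y (-A) s ≤ m := by
    have : P.partialA i y (-A) s * A < (-|m|) * A := by linarith
    exact (lt_of_mul_lt_mul_right this hA.le).le.trans (neg_abs_le m)
  exact mem_range_of_exists_le_of_exists_ge (hP.continuous_partialA i hy hs) ⟨-A, i2⟩ ⟨A, i1⟩

/-- The inverse of `∂_a ℓ_i(y, ·, s)` depends continuously on its arguments. -/
lemma Regular.continuousOn_of_partialA (hP : P.Regular) (h4 : P.H4) (i : Fin N)
    {S : Set ℝ} (hS : S ⊆ Icc 0 P.T) {c w m : ℝ → ℝ} (hc : ContinuousOn c S)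
    (hm : ContinuousOn m S) (hc0 : ∀ s ∈ S, 0 ≤ c s)
    (h : ∀ s ∈ S, P.partialA i (c s) (w s) s = m s) : ContinuousOn w S := by
  have hcont : ∀ a, ContinuousOn (fun s => P.partialA i (c s) a s) S := fun a =>
    (hP.partialA_continuous i).comp (f := fun s : ℝ => (c s, a, s)) (by fun_prop)
      (fun s hs => ⟨hc0 s hs, mem_univ _, hS hs⟩)
  intro s hs
  have mono := fun s hs => hP.strictMono_partialA h4 i (hc0 s hs) (hS hs)
  refine tendsto_order.2 ⟨fun b hb => ?_, fun b hb => ?_⟩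
  · have h1 : P.partialA i (c s) b s < m s := by rw [← h s hs]; exact mono s hs hb
    filter_upwards [(hcont b s hs).eventually_lt (hm s hs) h1, self_mem_nhdsWithin] with τ hτ hτS
    rw [← h τ hτS] at hτ
    exact (mono τ hτS).lt_iff_lt.mp hτ
  · have h1 : m s < P.partialA i (c s) b s := by rw [← h s hs]; exact mono s hs hb
    filter_upwards [(hm s hs).eventually_lt (hcont b s hs) h1, self_mem_nhdsWithin] with τ hτ hτS
    rw [← h τ hτS] at hτ
    exact (mono τ hτS).lt_iff_lt.mp hτ

/-- The Bregman gap of the strictly convex function `ℓ_i(y, ·, s)`. -/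
def gap (P : Problem N) (i : Fin N) (y a b s : ℝ) : ℝ :=
  P.ℓ i y b s - P.ℓ i y a s - P.partialA i y a s * (b - a)

lemma Regular.gap_nonneg (hP : P.Regular) (h4 : P.H4) (i : Fin N) {y s : ℝ} (hy : 0 ≤ y)
    (hs : s ∈ Icc 0 P.T) (a b : ℝ) : 0 ≤ P.gap i y a b s := by
  have := hP.convex_le h4 i hy hs a b
  unfold gap; linarith

lemma Regular.gap_le_right (hP : P.Regular) (h4 : P.H4) (i : Fin N) {y s : ℝ} (hy : 0 ≤ y)
    (hs : s ∈ Icc 0 P.T) {a b b' : ℝ} (h : a ≤ b ∧ b ≤ b' ∨ b' ≤ b ∧ b ≤ a) :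
    P.gap i y a b s ≤ P.gap i y a b' s := by
  have h1 := hP.convex_le h4 i hy hs b b'
  have hm := (hP.strictMono_partialA h4 i hy hs).monotone
  unfold gap
  rcases h with ⟨h, h'⟩ | ⟨h', h⟩
  · have := hm h
    nlinarith
  · have := hm h
    nlinarith

/-- Strict convexity makes the gap at every `c ≠ a` positive, and the gap only grows beyond `c`, so
a small gap confines `b n` to a neighbourhood of `a`. -/
lemma Regular.tendsto_of_gap (hP : P.Regular) (h4 : P.H4) (i : Fin N) {y s : ℝ} (hy : 0 ≤ y)
    (hs : s ∈ Icc 0 P.T) (a : ℝ) {b : ℕ → ℝ}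
    (h : Tendsto (fun n => P.gap i y a (b n) s) atTop (𝓝 0)) : Tendsto b atTop (𝓝 a) := by
  have pos : ∀ {c}, a ≠ c → 0 < P.gap i y a c s := fun {c} hc => by
    have := hP.convex_lt h4 i hy hs hc
    unfold gap; linarith
  refine tendsto_order.2 ⟨fun c hc => ?_, fun c hc => ?_⟩
  · filter_upwards [h.eventually_lt_const (pos hc.ne')] with n hn
    by_contra! hb
    exact absurd (hP.gap_le_right h4 i hy hs (a := a) (Or.inr ⟨hb, hc.le⟩)) (not_le.2 hn)
  · filter_upwards [h.eventually_lt_const (pos hc.ne)] with n hn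
    by_contra! hb
    exact absurd (hP.gap_le_right h4 i hy hs (a := a) (Or.inl ⟨hc.le, hb⟩)) (not_le.2 hn)

end Problem

/-! ### Measurability of superpositions -/

/-- Precomposing `F` with the projection onto its closed domain gives a globally continuous
function, which agrees with `F` at all arguments that occur. -/
lemma aestronglyMeasurable_superposition {F : ℝ × ℝ × ℝ → ℝ} {T : ℝ} (hT : 0 ≤ T)
    (hF : ContinuousOn F (Ici 0 ×ˢ univ ×ˢ Icc 0 T)) {S : Set ℝ} (hSm : MeasurableSet S)
    (hS : S ⊆ Icc 0 T) {Y V : ℝ → ℝ} (hY : AEMeasurable Y (volume.restrict S))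
    (hV : AEMeasurable V (volume.restrict S)) (hY0 : ∀ s ∈ S, 0 ≤ Y s) :
    AEStronglyMeasurable (fun s => F (Y s, V s, s)) (volume.restrict S) := by
  set pr : ℝ × ℝ × ℝ → ℝ × ℝ × ℝ := fun q => (max q.1 0, q.2.1, max 0 (min q.2.2 T)) with hpr
  have hc : Continuous (F ∘ pr) := by
    rw [← continuousOn_univ]
    refine hF.comp (by fun_prop) (fun q _ => ⟨mem_Ici.2 (le_max_right _ _), mem_univ _, le_max_left _ _, ?_⟩)
    exact max_le hT (min_le_right _ _)
  have hm : AEMeasurable (fun s => (Y s, V s, s)) (volume.restrict S) :=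
    hY.prodMk (hV.prodMk aemeasurable_id)
  have := (hc.measurable.comp_aemeasurable hm).aestronglyMeasurable
  refine this.congr ?_
  filter_upwards [ae_restrict_mem hSm] with s hs
  have h := hS hs
  simp only [Function.comp, hpr, max_eq_left (hY0 s hs), min_eq_left h.2, max_eq_right h.1]

lemma integrableOn_of_bound {f B : ℝ → ℝ} {S : Set ℝ} (hSm : MeasurableSet S)
    (hf : AEStronglyMeasurable f (volume.restrict S)) (hB : IntegrableOn B S)
    (h : ∀ s ∈ S, |f s| ≤ B s) : IntegrableOn f S :=
  Integrable.mono' hB hf (by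
    filter_upwards [ae_restrict_mem hSm] with s hs using h s hs)

/-! ### Integration by parts -/

/-- Primitives of integrable functions are absolutely continuous and differentiable a.e. with the
expected derivative, so merely integrable data suffice. -/
lemma integral_primitive_mul {f g : ℝ → ℝ} {a b : ℝ} (hf : IntervalIntegrable f volume a b)
    (hg : IntervalIntegrable g volume a b) :
    ∫ s in a..b, (∫ τ in a..s, f τ) * g s =
      (∫ s in a..b, f s) * (∫ s in a..b, g s) - ∫ s in a..b, f s * ∫ τ in a..s, g τ := by
  have hF := hf.absolutelyContinuousOnInterval_intervalIntegral (c := a) left_mem_uIcc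
  have hG := hg.absolutelyContinuousOnInterval_intervalIntegral (c := a) left_mem_uIcc
  have h := hF.integral_mul_deriv_eq_deriv_mul hG
  have e1 : ∫ s in a..b, (∫ τ in a..s, f τ) * deriv (fun x => ∫ τ in a..x, g τ) s
      = ∫ s in a..b, (∫ τ in a..s, f τ) * g s := by
    refine intervalIntegral.integral_congr_ae ?_
    filter_upwards [hg.ae_hasDerivAt_integral] with s hs hs'
    rw [(hs (uIoc_subset_uIcc hs') a left_mem_uIcc).deriv]
  have e2 : ∫ s in a..b, deriv (fun x => ∫ τ in a..x, f τ) s * (∫ τ in a..s, g τ)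
      = ∫ s in a..b, f s * ∫ τ in a..s, g τ := by
    refine intervalIntegral.integral_congr_ae ?_
    filter_upwards [hf.ae_hasDerivAt_integral] with s hs hs'
    rw [(hs (uIoc_subset_uIcc hs') a left_mem_uIcc).deriv]
  simpa [e1, e2] using h

/-! ### Weak convergence against bounded measurable functions -/

/-- Integration by parts moves the derivative onto `q` and leaves only the primitive of `f`, which
is uniformly small. The constant `D` does not depend on `f`. -/
lemma integral_polynomial_mul_le {a b : ℝ} (hab : a ≤ b) (q : Polynomial ℝ) :
    ∃ D : ℝ, 0 ≤ D ∧ ∀ (f : ℝ → ℝ) (ε : ℝ), IntegrableOn f (Ioc a b) →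
      (∀ s ∈ Icc a b, |∫ τ in a..s, f τ| ≤ ε) → |∫ s in Ioc a b, q.eval s * f s| ≤ D * ε := by
  obtain ⟨D, hD⟩ := isCompact_Icc.exists_bound_of_continuousOn (s := Icc a b)
    (f := fun s => q.derivative.eval s) (by fun_prop)
  refine ⟨|q.eval b| + |D| * (b - a), by
    have := sub_nonneg.2 hab
    positivity, fun f ε hf hε => ?_⟩
  have hf' : IntervalIntegrable f volume a b :=
    (intervalIntegrable_iff_integrableOn_Ioc_of_le hab).2 hf
  have hq' : IntervalIntegrable (fun s => q.derivative.eval s) volume a b :=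
    (by fun_prop : Continuous fun s => q.derivative.eval s).intervalIntegrable _ _
  have hq : ∀ s, q.eval s = q.eval a + ∫ τ in a..s, q.derivative.eval τ := by
    intro s
    rw [intervalIntegral.integral_eq_sub_of_hasDerivAt (f := fun s => q.eval s)
      (fun x _ => q.hasDerivAt x) ((by fun_prop : Continuous fun s =>
        q.derivative.eval s).intervalIntegrable _ _)]
    ring
  have hcF : ContinuousOn (fun s => ∫ τ in a..s, f τ) (uIcc a b) :=
    intervalIntegral.continuousOn_primitive_interval (by
      rw [uIcc_of_le hab]; exact (integrableOn_Icc_iff_integrableOn_Ioc (by simp)).2 hf)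
  have key : ∫ s in Ioc a b, q.eval s * f s =
      q.eval b * (∫ s in a..b, f s) - ∫ s in a..b, q.derivative.eval s * ∫ τ in a..s, f τ := by
    rw [← intervalIntegral.integral_of_le hab]
    have h := integral_primitive_mul hq' hf'
    calc ∫ s in a..b, q.eval s * f s
        = ∫ s in a..b, (q.eval a * f s + (∫ τ in a..s, q.derivative.eval τ) * f s) := by
          congr 1; ext s; rw [hq s]; ring
      _ = _ := by
          rw [intervalIntegral.integral_add (hf'.const_mul _) (hf'.continuousOn_mul (by
              have : (fun s => ∫ τ in a..s, q.derivative.eval τ) = fun s => q.eval s - q.eval a := by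
                ext s; rw [hq s]; ring
              rw [this]; fun_prop)), h, intervalIntegral.integral_const_mul, hq b]
          ring
  rw [key]
  have hb := hε b (right_mem_Icc.2 hab)
  have h1 : |q.eval b * (∫ s in a..b, f s)| ≤ |q.eval b| * ε := by
    rw [abs_mul]; gcongr
  have h2 : |∫ s in a..b, q.derivative.eval s * ∫ τ in a..s, f τ| ≤ |D| * ε * |b - a| := by
    rw [← Real.norm_eq_abs]
    refine intervalIntegral.norm_integral_le_of_norm_le_const fun s hs => ?_
    rw [uIoc_of_le hab] at hs
    have hs' := Ioc_subset_Icc_self hs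
    rw [norm_mul]
    exact mul_le_mul ((hD s hs').trans (le_abs_self D)) (hε s hs') (norm_nonneg _) (abs_nonneg _)
  rw [abs_of_nonneg (sub_nonneg.2 hab)] at h2
  calc _ ≤ _ := abs_sub _ _
    _ ≤ |q.eval b| * ε + |D| * ε * (b - a) := add_le_add h1 h2
    _ = _ := by ring

/-- `β` is replaced by a bounded continuous function close in `L^1`, and this one by a uniformly
close polynomial, to which `integral_polynomial_mul_le` applies. The first replacement is where
equi-integrability enters: the error is small in `L^1` only, while the `f n` are unbounded, so `|f
n|` is split into a part of small integral and a constant. -/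
lemma tendsto_integral_mul_of_equiintegrable {a b : ℝ} (hab : a ≤ b) {f : ℕ → ℝ → ℝ}
    (hf : ∀ n, IntegrableOn (f n) (Ioc a b))
    (hF : ∀ ε > 0, ∀ᶠ n in atTop, ∀ s ∈ Icc a b, |∫ τ in a..s, f n τ| ≤ ε)
    (hequi : ∀ ε > 0, ∃ C : ℝ, 0 ≤ C ∧ ∀ n, ∃ m : ℝ → ℝ, IntegrableOn m (Ioc a b) ∧
      (∀ s, 0 ≤ m s) ∧ ∫ s in Ioc a b, m s ≤ ε ∧ ∀ s, |f n s| ≤ m s + C)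
    {β : ℝ → ℝ} (hβ : AEStronglyMeasurable β (volume.restrict (Ioc a b))) {B : ℝ}
    (hB : ∀ s ∈ Ioc a b, |β s| ≤ B) :
    Tendsto (fun n => ∫ s in Ioc a b, β s * f n s) atTop (𝓝 0) := by
  wlog hB1 : 1 ≤ B generalizing B
  · exact this (B := max B 1) (fun s hs => (hB s hs).trans (le_max_left _ _)) (le_max_right _ _)
  have hB0 : 0 < B := by linarith
  have hfin : IsFiniteMeasure (volume.restrict (Ioc a b)) :=
    ⟨by rw [Measure.restrict_apply_univ]; exact measure_Ioc_lt_top⟩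
  have hβi : IntegrableOn β (Ioc a b) :=
    integrableOn_of_bound measurableSet_Ioc hβ (integrableOn_const measure_Ioc_lt_top.ne (C := B)) hB
  rw [Metric.tendsto_nhds]
  intro ε hε
  obtain ⟨C, hC0, hC⟩ := hequi (ε / (8 * B)) (by positivity)
  set M : ℝ := ε / (8 * B) + C * (b - a) with hM
  have hba := sub_nonneg.2 hab
  have hM0 : 0 ≤ M := by positivity
  have hfM : ∀ n, ∫ s in Ioc a b, |f n s| ≤ M := by
    intro n
    obtain ⟨m, hm, hm0, hmε, hfm⟩ := hC n
    calc ∫ s in Ioc a b, |f n s| ≤ ∫ s in Ioc a b, (m s + C) :=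
          integral_mono (hf n).abs (hm.add (integrableOn_const measure_Ioc_lt_top.ne (C := C))) hfm
      _ = (∫ s in Ioc a b, m s) + C * (b - a) := by
          rw [integral_add hm (integrableOn_const measure_Ioc_lt_top.ne (C := C))]
          simp [hab, mul_comm]
      _ ≤ _ := by linarith
  obtain ⟨g₀, -, hg₀, hg₀c, -⟩ := hβi.exists_hasCompactSupport_integral_sub_le
    (ε := ε / (4 * (C + 1))) (by positivity)
  -- Truncation at the bound of `β` makes the approximation bounded and does not move it away from
  -- `β`.
  set g : ℝ → ℝ := fun s => max (-B) (min B (g₀ s)) with hg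
  have hgc : Continuous g := by fun_prop
  have hgB : ∀ s, |g s| ≤ B := fun s =>
    abs_le.2 ⟨le_max_left _ _, max_le (by linarith) (min_le_left _ _)⟩
  have hgβ : ∀ s ∈ Ioc a b, |β s - g s| ≤ |β s - g₀ s| := by
    intro s hs
    have h := abs_le.1 (hB s hs)
    simp only [hg]
    rcases le_total B (g₀ s) with h1 | h1
    · rw [min_eq_left h1, max_eq_right (by linarith), abs_of_nonpos (by linarith),
        abs_of_nonpos (by linarith)]
      linarith
    · rw [min_eq_right h1]
      rcases le_total (-B) (g₀ s) with h2 | h2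
      · rw [max_eq_right h2]
      · rw [max_eq_left h2, abs_of_nonneg (by linarith), abs_of_nonneg (by linarith)]
        linarith
  have hgi : IntegrableOn g (Ioc a b) :=
    integrableOn_of_bound measurableSet_Ioc hgc.aestronglyMeasurable
      (integrableOn_const measure_Ioc_lt_top.ne (C := B)) (fun s _ => hgB s)
  have hgd : ∫ s in Ioc a b, |β s - g s| ≤ ε / (4 * (C + 1)) := by
    refine le_trans ?_ hg₀
    refine integral_mono_ae (hβi.sub hgi).abs (hβi.sub hg₀c.integrableOn_Ioc).norm ?_
    filter_upwards [ae_restrict_mem measurableSet_Ioc] with s hs using hgβ s hs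
  obtain ⟨q, hq⟩ := exists_polynomial_near_of_continuousOn a b g hgc.continuousOn
    (ε / (8 * (M + 1))) (by positivity)
  obtain ⟨D, hD0, hD⟩ := integral_polynomial_mul_le hab q
  filter_upwards [hF (ε / (8 * (D + 1))) (by positivity)] with n hn
  have hqf := hD (f n) _ (hf n) hn
  have hqc : Continuous fun s => q.eval s := by fun_prop
  obtain ⟨Bq, hBq⟩ := isCompact_Icc.exists_bound_of_continuousOn (s := Icc a b) hqc.continuousOn
  have hβg : IntegrableOn (fun s => |β s - g s|) (Ioc a b) := (hβi.sub hgi).abs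
  have i1 : IntegrableOn (fun s => (β s - g s) * f n s) (Ioc a b) :=
    (hf n).bdd_mul (c := B + B) (hβi.sub hgi).aestronglyMeasurable (by
      filter_upwards [ae_restrict_mem measurableSet_Ioc] with s hs
      exact (norm_sub_le _ _).trans (add_le_add (hB s hs) (hgB s)))
  have i2 : IntegrableOn (fun s => (g s - q.eval s) * f n s) (Ioc a b) :=
    (hf n).bdd_mul (c := ε / (8 * (M + 1))) (by fun_prop) (by
      filter_upwards [ae_restrict_mem measurableSet_Ioc] with s hs
      rw [norm_sub_rev]
      exact (hq s (Ioc_subset_Icc_self hs)).le)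
  have i3 : IntegrableOn (fun s => q.eval s * f n s) (Ioc a b) :=
    (hf n).bdd_mul (c := Bq) (by fun_prop) (by
      filter_upwards [ae_restrict_mem measurableSet_Ioc] with s hs
      exact hBq s (Ioc_subset_Icc_self hs))
  have e : ∫ s in Ioc a b, β s * f n s = (∫ s in Ioc a b, (β s - g s) * f n s) +
      (∫ s in Ioc a b, (g s - q.eval s) * f n s) + ∫ s in Ioc a b, q.eval s * f n s := by
    have i12 : IntegrableOn (fun s => (β s - g s) * f n s + (g s - q.eval s) * f n s)
      (Ioc a b) := i1.add i2
    rw [← integral_add i1 i2, ← integral_add i12 i3]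
    congr 1; ext s; ring
  obtain ⟨m, hm, hm0, hmε, hfm⟩ := hC n
  have b1 : |∫ s in Ioc a b, (β s - g s) * f n s| ≤ ε / 2 := by
    calc |∫ s in Ioc a b, (β s - g s) * f n s| ≤ ∫ s in Ioc a b, |(β s - g s) * f n s| :=
          abs_integral_le_integral_abs
      _ ≤ ∫ s in Ioc a b, (2 * B * m s + C * |β s - g s|) := by
          refine integral_mono_ae i1.abs
            ((hm.const_mul _).add (hβg.const_mul _)) ?_
          filter_upwards [ae_restrict_mem measurableSet_Ioc] with s hs
          have h1 : |β s - g s| ≤ 2 * B := by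
            have := abs_sub (β s) (g s)
            have := hB s hs
            have := hgB s
            linarith
          have h2 := mul_le_mul_of_nonneg_left (hfm s) (abs_nonneg (β s - g s))
          have h3 := mul_le_mul_of_nonneg_right h1 (hm0 s)
          simp only [abs_mul]
          linarith
      _ = 2 * B * (∫ s in Ioc a b, m s) + C * ∫ s in Ioc a b, |β s - g s| := by
          rw [integral_add (hm.const_mul _) (hβg.const_mul _),
            integral_const_mul, integral_const_mul]
      _ ≤ 2 * B * (ε / (8 * B)) + C * (ε / (4 * (C + 1))) := by gcongr
      _ ≤ ε / 4 + ε / 4 := by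
          have e1 : 2 * B * (ε / (8 * B)) = ε / 4 := by field_simp; ring
          have e2 : C * (ε / (4 * (C + 1))) ≤ (C + 1) * (ε / (4 * (C + 1))) := by gcongr; linarith
          have e3 : (C + 1) * (ε / (4 * (C + 1))) = ε / 4 := by field_simp
          linarith
      _ = ε / 2 := by ring
  have b2 : |∫ s in Ioc a b, (g s - q.eval s) * f n s| ≤ ε / 8 := by
    calc |∫ s in Ioc a b, (g s - q.eval s) * f n s|
        ≤ ∫ s in Ioc a b, |(g s - q.eval s) * f n s| := abs_integral_le_integral_abs
      _ ≤ ∫ s in Ioc a b, ε / (8 * (M + 1)) * |f n s| := by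
          refine integral_mono_ae i2.abs ((hf n).abs.const_mul _) ?_
          filter_upwards [ae_restrict_mem measurableSet_Ioc] with s hs
          simp only [abs_mul]
          rw [abs_sub_comm]
          exact mul_le_mul_of_nonneg_right (hq s (Ioc_subset_Icc_self hs)).le (abs_nonneg _)
      _ = ε / (8 * (M + 1)) * ∫ s in Ioc a b, |f n s| := integral_const_mul _ _
      _ ≤ ε / (8 * (M + 1)) * (M + 1) := by
          gcongr; linarith [hfM n]
      _ = ε / 8 := by field_simp
  have b3 : D * (ε / (8 * (D + 1))) ≤ ε / 8 := by
    have e2 : D * (ε / (8 * (D + 1))) ≤ (D + 1) * (ε / (8 * (D + 1))) := by gcongr; linarith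
    have e3 : (D + 1) * (ε / (8 * (D + 1))) = ε / 8 := by field_simp
    linarith
  rw [dist_zero_right, Real.norm_eq_abs, e]
  have := abs_add_three (∫ s in Ioc a b, (β s - g s) * f n s)
    (∫ s in Ioc a b, (g s - q.eval s) * f n s) (∫ s in Ioc a b, q.eval s * f n s)
  linarith

/-- The parts of an integrable function above high levels have small integral. -/
lemma exists_integral_tail_le {f : ℝ → ℝ} {S : Set ℝ} (hf : IntegrableOn f S) {ε : ℝ} (hε : 0 < ε) :
    ∃ C : ℝ, 0 ≤ C ∧ ∃ m : ℝ → ℝ, IntegrableOn m S ∧ (∀ s, 0 ≤ m s) ∧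
      ∫ s in S, m s ≤ ε ∧ ∀ s, |f s| ≤ m s + C := by
  have key : Tendsto (fun n : ℕ => ∫ s in S, max (|f s| - n) 0) atTop (𝓝 (∫ s in S, (0 : ℝ))) := by
    refine tendsto_integral_of_dominated_convergence (fun s => |f s|) (fun n => ?_) hf.abs
      (fun n => ?_) (ae_of_all _ fun s => ?_)
    · exact ((hf.abs.aestronglyMeasurable.sub aestronglyMeasurable_const).sup
        aestronglyMeasurable_const)
    · refine ae_of_all _ fun s => ?_
      rw [Real.norm_eq_abs, abs_of_nonneg (le_max_right _ _)]
      exact max_le (by simp) (abs_nonneg _)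
    · obtain ⟨k, hk⟩ := exists_nat_ge |f s|
      refine tendsto_const_nhds.congr' ?_
      filter_upwards [eventually_ge_atTop k] with n hn
      have : (k : ℝ) ≤ n := by exact_mod_cast hn
      rw [max_eq_right (by linarith)]
  rw [integral_zero] at key
  obtain ⟨n, hn⟩ := (key.eventually_le_const hε).exists
  refine ⟨n, n.cast_nonneg, fun s => max (|f s| - n) 0, ?_, fun s => le_max_right _ _, hn,
    fun s => ?_⟩
  · refine Integrable.mono' hf.abs ((hf.abs.aestronglyMeasurable.sub
      aestronglyMeasurable_const).sup aestronglyMeasurable_const) (ae_of_all _ fun s => ?_)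
    rw [Real.norm_eq_abs, abs_of_nonneg (le_max_right _ _)]
    exact max_le (by simp) (abs_nonneg _)
  · have := le_max_left (|f s| - n) 0
    linarith

/-- Bounded sequences of `L^p` whose primitives converge uniformly converge weakly. -/
lemma tendsto_integral_mul_of_rpow_bound {p : ℝ} (hp : 1 < p) {a b : ℝ} (hab : a ≤ b)
    {v : ℕ → ℝ → ℝ} {w : ℝ → ℝ} {K : ℝ}
    (hv : ∀ n, IntegrableOn (v n) (Ioc a b)) (hw : IntegrableOn w (Ioc a b))
    (hvp : ∀ n, IntegrableOn (fun s => |v n s| ^ p) (Ioc a b))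
    (hK : ∀ n, ∫ s in Ioc a b, |v n s| ^ p ≤ K)
    (hF : ∀ ε > 0, ∀ᶠ n in atTop, ∀ s ∈ Icc a b, |∫ τ in a..s, (v n τ - w τ)| ≤ ε)
    {β : ℝ → ℝ} (hβ : AEStronglyMeasurable β (volume.restrict (Ioc a b))) {B : ℝ}
    (hB : ∀ s ∈ Ioc a b, |β s| ≤ B) :
    Tendsto (fun n => ∫ s in Ioc a b, β s * (v n s - w s)) atTop (𝓝 0) := by
  refine tendsto_integral_mul_of_equiintegrable hab (fun n => (hv n).sub hw) hF (fun ε hε => ?_)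
    hβ hB
  have hK0 : 0 ≤ K := (integral_nonneg fun s => by positivity).trans (hK 0)
  obtain ⟨C₁, hC₁, m₁, hm₁, hm₁0, hm₁ε, h₁⟩ :=
    exists_integral_tail_le hw (half_pos hε)
  -- Whatever `n`, this factor leaves at most `ε / 2` once `|v n| ^ p` is integrated; the tail of
  -- `w` uses the other half.
  obtain ⟨C₂, hC₂, h₂⟩ := exists_le_mul_rpow_add hp (lam := ε / (2 * (K + 1))) (by positivity)
  refine ⟨C₁ + C₂, by positivity, fun n => ⟨fun s => m₁ s + ε / (2 * (K + 1)) * |v n s| ^ p,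
    hm₁.add ((hvp n).const_mul _), fun s => ?_, ?_, fun s => ?_⟩⟩
  · have := hm₁0 s
    positivity
  · rw [integral_add hm₁ ((hvp n).const_mul _), integral_const_mul]
    have e1 : ε / (2 * (K + 1)) * (∫ s in Ioc a b, |v n s| ^ p) ≤ ε / (2 * (K + 1)) * (K + 1) := by
      gcongr; linarith [hK n]
    have e2 : ε / (2 * (K + 1)) * (K + 1) = ε / 2 := by field_simp
    linarith
  · have := abs_sub (v n s) (w s)
    have := h₁ s
    have := h₂ (v n s)
    simp only [Pi.sub_apply]
    linarith

/-! ### Differentiation of the cost along curves -/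

namespace Problem
variable {N : ℕ} {P : Problem N}

lemma Regular.integrableOn_cost (hP : P.Regular) (h3 : P.H3) (i : Fin N) {S : Set ℝ}
    (hSm : MeasurableSet S) (hS : S ⊆ Icc 0 P.T) {R : ℝ} {Y V : ℝ → ℝ}
    (hY : AEMeasurable Y (volume.restrict S)) (hV : AEMeasurable V (volume.restrict S))
    (hYR : ∀ s ∈ S, Y s ∈ Icc 0 R) (hVp : IntegrableOn (fun s => |V s| ^ P.p) S) :
    IntegrableOn (fun s => P.ℓ i (Y s) (V s) s) S := by
  obtain ⟨C, hC0, hC⟩ := h3.upper_bound hP (r := max R 1) (by positivity)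
  have hfin : volume S ≠ ⊤ := ((measure_mono hS).trans_lt measure_Icc_lt_top).ne
  exact integrableOn_of_bound hSm
    (aestronglyMeasurable_superposition hP.T_pos.le (hP.ℓ_continuous i) hSm hS hY hV
      fun s hs => (hYR s hs).1)
    ((hVp.add (integrableOn_const hfin (C := (1 : ℝ)))).const_mul C)
    fun s hs => hC i _ ⟨(hYR s hs).1, (hYR s hs).2.trans (le_max_left _ _)⟩ _ s (hS hs)

lemma Regular.integrableOn_partialY (hP : P.Regular) (h3 : P.H3) (i : Fin N) {S : Set ℝ}
    (hSm : MeasurableSet S) (hS : S ⊆ Icc 0 P.T) {R : ℝ} {Y V : ℝ → ℝ}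
    (hY : AEMeasurable Y (volume.restrict S)) (hV : AEMeasurable V (volume.restrict S))
    (hYR : ∀ s ∈ S, Y s ∈ Icc 0 R) (hVp : IntegrableOn (fun s => |V s| ^ P.p) S) :
    IntegrableOn (fun s => P.partialY i (Y s) (V s) s) S := by
  obtain ⟨C, hC0, hC⟩ := h3 (max R 1) (by positivity)
  have hfin : volume S ≠ ⊤ := ((measure_mono hS).trans_lt measure_Icc_lt_top).ne
  exact integrableOn_of_bound hSm
    (aestronglyMeasurable_superposition hP.T_pos.le (hP.partialY_continuous i) hSm hS hY hV
      fun s hs => (hYR s hs).1)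
    ((hVp.add (integrableOn_const hfin (C := (1 : ℝ)))).const_mul C)
    fun s hs => (hC i _ ⟨(hYR s hs).1, (hYR s hs).2.trans (le_max_left _ _)⟩ _ s (hS hs)).1

lemma Regular.integrableOn_partialA (hP : P.Regular) (h3 : P.H3) (i : Fin N) {S : Set ℝ}
    (hSm : MeasurableSet S) (hS : S ⊆ Icc 0 P.T) {R : ℝ} {Y V : ℝ → ℝ}
    (hY : AEMeasurable Y (volume.restrict S)) (hV : AEMeasurable V (volume.restrict S))
    (hYR : ∀ s ∈ S, Y s ∈ Icc 0 R) (hVp : IntegrableOn (fun s => |V s| ^ P.p) S) :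
    IntegrableOn (fun s => P.partialA i (Y s) (V s) s) S := by
  obtain ⟨C, hC0, hC⟩ := h3 (max R 1) (by positivity)
  have hfin : volume S ≠ ⊤ := ((measure_mono hS).trans_lt measure_Icc_lt_top).ne
  refine integrableOn_of_bound hSm
    (aestronglyMeasurable_superposition hP.T_pos.le (hP.partialA_continuous i) hSm hS hY hV
      fun s hs => (hYR s hs).1)
    ((hVp.add (integrableOn_const hfin (C := (2 : ℝ)))).const_mul C)
    fun s hs => ((hC i _ ⟨(hYR s hs).1, (hYR s hs).2.trans (le_max_left _ _)⟩ _ s (hS hs)).2).trans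
      (mul_le_mul_of_nonneg_left ?_ hC0)
  have := rpow_sub_one_le hP.one_lt_p (abs_nonneg (V s))
  simp only [Pi.add_apply]
  linarith

lemma abs_rpow_add_le {p : ℝ} (hp : 1 < p) {x y z : ℝ} (h : |y| ≤ z) :
    |x + y| ^ p ≤ 2 ^ p * (|x| ^ p + z ^ p) := by
  refine (rpow_add_abs_le hp x y).trans ?_
  gcongr

/-- Difference quotients of the running cost along converging curves pass to the limit. -/
lemma Regular.tendsto_integral_quotient (hP : P.Regular) (h3 : P.H3) (i : Fin N) {S : Set ℝ}
    (hSm : MeasurableSet S) (hS : S ⊆ Icc 0 P.T) {r R K : ℝ} (hr : 0 < r)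
    {Y V : ℕ → ℝ → ℝ} {Y₀ V₀ φ ψ B : ℝ → ℝ} {h : ℕ → ℝ} (hh0 : ∀ n, h n ≠ 0)
    (hh : Tendsto h atTop (𝓝 0)) (hφK : ∀ s ∈ S, |φ s| ≤ K) (hψK : ∀ s ∈ S, |ψ s| ≤ K)
    (hφ : AEMeasurable φ (volume.restrict S)) (hψ : AEMeasurable ψ (volume.restrict S))
    (hY : ∀ n, AEMeasurable (Y n) (volume.restrict S))
    (hV : ∀ n, AEMeasurable (V n) (volume.restrict S))
    (hYr : ∀ n, ∀ s ∈ S, Y n s ∈ Icc r R) (hYr' : ∀ n, ∀ s ∈ S, Y n s + h n * φ s ∈ Icc r R)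
    (hYlim : ∀ᵐ s ∂(volume.restrict S), Tendsto (fun n => Y n s) atTop (𝓝 (Y₀ s)))
    (hVlim : ∀ᵐ s ∂(volume.restrict S), Tendsto (fun n => V n s) atTop (𝓝 (V₀ s)))
    (hB : IntegrableOn B S)
    (hVB : ∀ᵐ s ∂(volume.restrict S), ∀ n, |V n s| ^ P.p ≤ B s) :
    Tendsto (fun n => ∫ s in S,
        (P.ℓ i (Y n s + h n * φ s) (V n s + h n * ψ s) s - P.ℓ i (Y n s) (V n s) s) / h n) atTop
      (𝓝 (∫ s in S, (P.partialY i (Y₀ s) (V₀ s) s * φ s + P.partialA i (Y₀ s) (V₀ s) s * ψ s))) := by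
  have hp := hP.one_lt_p
  obtain ⟨C, hC0, hC⟩ := h3 (max R 1) (by positivity)
  have hfin : volume S ≠ ⊤ := ((measure_mono hS).trans_lt measure_Icc_lt_top).ne
  obtain ⟨H, hH⟩ : ∃ H, ∀ n, |h n| ≤ H := by
    obtain ⟨H, hH⟩ := (Metric.isBounded_range_of_tendsto h hh).exists_norm_le
    exact ⟨H, fun n => hH _ (mem_range_self n)⟩
  -- The mean value theorem is applied at each time separately. Measurability of `θ` in `s` is never
  -- needed, since `hmeas` treats the quotient itself.
  have hmean : ∀ n, ∀ s ∈ S, ∃ θ : ℝ, |θ| ≤ |h n| ∧ Y n s + θ * φ s ∈ Icc r R ∧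
      (P.ℓ i (Y n s + h n * φ s) (V n s + h n * ψ s) s - P.ℓ i (Y n s) (V n s) s) / h n =
      P.partialY i (Y n s + θ * φ s) (V n s + θ * ψ s) s * φ s
        + P.partialA i (Y n s + θ * φ s) (V n s + θ * ψ s) s * ψ s := by
    intro n s hs
    obtain ⟨θ, h1, h2, h3⟩ := hP.exists_mean_value i (hS hs) (Y n s) (V n s) (φ s) (ψ s) (hh0 n)
      (hr.trans_le (hYr n s hs).1) (hr.trans_le (hYr' n s hs).1)
    exact ⟨θ, h1, (convex_Icc r R).segment_subset (hYr n s hs) (hYr' n s hs) h2, h3⟩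
  have hmeas : ∀ n, AEStronglyMeasurable (fun s =>
      (P.ℓ i (Y n s + h n * φ s) (V n s + h n * ψ s) s - P.ℓ i (Y n s) (V n s) s) / h n)
      (volume.restrict S) := by
    intro n
    have m1 := aestronglyMeasurable_superposition hP.T_pos.le (hP.ℓ_continuous i) hSm hS
      ((hY n).add (hφ.const_mul (h n))) ((hV n).add (hψ.const_mul (h n)))
      (fun s hs => hr.le.trans (hYr' n s hs).1)
    have m2 := aestronglyMeasurable_superposition hP.T_pos.le (hP.ℓ_continuous i) hSm hS
      (hY n) (hV n) (fun s hs => hr.le.trans (hYr n s hs).1)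
    simp only [div_eq_mul_inv]
    exact (m1.sub m2).mul_const (h n)⁻¹
  refine tendsto_integral_of_dominated_convergence
    (fun s => C * K * (2 * (2 ^ P.p * (B s + (H * K) ^ P.p)) + 3)) hmeas
    (((((hB.add (integrableOn_const hfin)).const_mul _).const_mul _).add
      (integrableOn_const hfin)).const_mul _) (fun n => ?_) ?_
  · filter_upwards [ae_restrict_mem hSm, hVB] with s hs hVB
    obtain ⟨θ, hθ, hYθ, he⟩ := hmean n s hs
    rw [he, Real.norm_eq_abs]
    set Y' := Y n s + θ * φ s
    set V' := V n s + θ * ψ s with hV'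
    have hK : 0 ≤ K := (abs_nonneg _).trans (hφK s hs)
    have hb : |V'| ^ P.p ≤ 2 ^ P.p * (B s + (H * K) ^ P.p) := by
      refine (abs_rpow_add_le (z := H * K) hp ?_).trans ?_
      · rw [abs_mul]
        exact mul_le_mul (hθ.trans (hH n)) (hψK s hs) (abs_nonneg _)
          ((abs_nonneg _).trans (hH n))
      · have := hVB n
        gcongr
    obtain ⟨g1, g2⟩ := hC i Y' ⟨hr.le.trans hYθ.1, hYθ.2.trans (le_max_left _ _)⟩ V' s (hS hs)
    have g3 := rpow_sub_one_le hp (abs_nonneg V')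
    calc |P.partialY i Y' V' s * φ s + P.partialA i Y' V' s * ψ s|
        ≤ |P.partialY i Y' V' s| * |φ s| + |P.partialA i Y' V' s| * |ψ s| := by
          rw [← abs_mul, ← abs_mul]; exact abs_add_le _ _
      _ ≤ (C * (|V'| ^ P.p + 1)) * K + (C * (|V'| ^ (P.p - 1) + 1)) * K :=
          add_le_add (mul_le_mul g1 (hφK s hs) (abs_nonneg _) ((abs_nonneg _).trans g1))
            (mul_le_mul g2 (hψK s hs) (abs_nonneg _) ((abs_nonneg _).trans g2))
      _ = C * K * (|V'| ^ P.p + |V'| ^ (P.p - 1) + 2) := by ring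
      _ ≤ _ := by
          refine mul_le_mul_of_nonneg_left ?_ (by positivity)
          linarith
  · filter_upwards [ae_restrict_mem hSm, hYlim, hVlim] with s hs hy hv
    choose θ hθ hYθ he using fun n => hmean n s hs
    have hθ0 : Tendsto θ atTop (𝓝 0) := by
      refine squeeze_zero_norm hθ ?_
      simpa using hh.abs
    have t1 : Tendsto (fun n => Y n s + θ n * φ s) atTop (𝓝 (Y₀ s)) := by
      simpa using hy.add (hθ0.mul_const (φ s))
    have t2 : Tendsto (fun n => V n s + θ n * ψ s) atTop (𝓝 (V₀ s)) := by
      simpa using hv.add (hθ0.mul_const (ψ s))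
    have hY₀ : Y₀ s ∈ Icc r R := isClosed_Icc.mem_of_tendsto t1 (Eventually.of_forall hYθ)
    have t3 : Tendsto (fun n => (Y n s + θ n * φ s, V n s + θ n * ψ s, s)) atTop
        (𝓝[Ici 0 ×ˢ univ ×ˢ Icc 0 P.T] (Y₀ s, V₀ s, s)) := by
      refine tendsto_nhdsWithin_iff.2 ⟨t1.prodMk_nhds (t2.prodMk_nhds tendsto_const_nhds), ?_⟩
      exact Eventually.of_forall fun n => ⟨hr.le.trans (hYθ n).1, mem_univ _, hS hs⟩
    have hmem : (Y₀ s, V₀ s, s) ∈ (Ici 0 ×ˢ univ ×ˢ Icc 0 P.T : Set (ℝ × ℝ × ℝ)) :=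
      ⟨hr.le.trans hY₀.1, mem_univ _, hS hs⟩
    have l1 := (hP.partialY_continuous i _ hmem).tendsto.comp t3
    have l2 := (hP.partialA_continuous i _ hmem).tendsto.comp t3
    simp only [he]
    exact (l1.mul_const _).add (l2.mul_const _)

/-- Differentiation of the running cost of a curve in a direction. -/
lemma Regular.hasDerivAt_integral_cost (hP : P.Regular) (h3 : P.H3) (i : Fin N) {S : Set ℝ}
    (hSm : MeasurableSet S) (hS : S ⊆ Icc 0 P.T) {r R K : ℝ} (hr : 0 < r)
    {Y V φ ψ : ℝ → ℝ} (hφK : ∀ s ∈ S, |φ s| ≤ K) (hψK : ∀ s ∈ S, |ψ s| ≤ K)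
    (hφ : AEMeasurable φ (volume.restrict S)) (hψ : AEMeasurable ψ (volume.restrict S))
    (hY : AEMeasurable Y (volume.restrict S)) (hV : AEMeasurable V (volume.restrict S))
    (hYr : ∀ s ∈ S, Y s ∈ Icc r R) (hVp : IntegrableOn (fun s => |V s| ^ P.p) S) :
    HasDerivAt (fun h => ∫ s in S, P.ℓ i (Y s + h * φ s) (V s + h * ψ s) s)
      (∫ s in S, (P.partialY i (Y s) (V s) s * φ s + P.partialA i (Y s) (V s) s * ψ s)) 0 := by
  have hp := hP.one_lt_p
  have hfin : volume S ≠ ⊤ := ((measure_mono hS).trans_lt measure_Icc_lt_top).ne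
  obtain ⟨δ, hδ, hδY⟩ : ∃ δ > 0, ∀ h, |h| < δ → ∀ s ∈ S, Y s + h * φ s ∈ Icc (r / 2) (R + r) := by
    -- This radius keeps the displacement below `r / 2`, hence the curve away from `y = 0`, where
    -- the derivative in `y` is one-sided.
    refine ⟨r / (2 * (|K| + 1)), by positivity, fun h hh s hs => ?_⟩
    have h1 : |h * φ s| ≤ r / 2 := by
      rw [abs_mul]
      calc |h| * |φ s| ≤ r / (2 * (|K| + 1)) * (|K| + 1) := by
            gcongr
            have := hφK s hs
            have := le_abs_self K
            linarith
        _ = r / 2 := by field_simp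
    have h2 := abs_le.1 h1
    have h3 := hYr s hs
    exact ⟨by linarith [h3.1], by linarith [h3.2]⟩
  have hint : ∀ h, |h| < δ → IntegrableOn (fun s => P.ℓ i (Y s + h * φ s) (V s + h * ψ s) s) S := by
    intro h hh
    refine hP.integrableOn_cost h3 i hSm hS (R := R + r) (hY.add (hφ.const_mul h))
      (hV.add (hψ.const_mul h)) (fun s hs => ?_) ?_
    · have := hδY h hh s hs
      exact ⟨by linarith [this.1], this.2⟩
    · refine integrableOn_of_bound hSm ?_ ((hVp.add (integrableOn_const hfin
        (C := (|h| * K) ^ P.p))).const_mul (2 ^ P.p)) fun s hs => ?_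
      · exact ((hV.add (hψ.const_mul h)).abs.pow_const _).aestronglyMeasurable
      · rw [abs_of_nonneg (by positivity)]
        refine abs_rpow_add_le hp ?_
        rw [abs_mul]
        exact mul_le_mul_of_nonneg_left (hψK s hs) (abs_nonneg _)
  rw [hasDerivAt_iff_tendsto_slope_zero]
  refine tendsto_of_seq_tendsto fun h hh => ?_
  rw [tendsto_nhdsWithin_iff] at hh
  obtain ⟨n₀, hn₀⟩ : ∃ n₀, ∀ n ≥ n₀, h n ≠ 0 ∧ |h n| < δ := by
    rw [← eventually_atTop]
    have : Tendsto (fun n => |h n|) atTop (𝓝 0) := by simpa using hh.1.abs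
    exact hh.2.and (this.eventually_lt_const hδ)
  rw [← tendsto_add_atTop_iff_nat n₀]
  have key := hP.tendsto_integral_quotient h3 i hSm hS (half_pos hr) (R := R + r)
    (Y := fun _ => Y) (V := fun _ => V) (Y₀ := Y) (V₀ := V) (h := fun n => h (n + n₀))
    (fun n => (hn₀ _ (by simp)).1) ((tendsto_add_atTop_iff_nat n₀).2 hh.1) hφK hψK hφ hψ
    (fun _ => hY) (fun _ => hV)
    (fun _ s hs => by have := hYr s hs; exact ⟨by linarith [this.1], by linarith [this.2]⟩)
    (fun n s hs => hδY _ (hn₀ _ (by simp)).2 s hs) (ae_of_all _ fun s => tendsto_const_nhds)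
    (ae_of_all _ fun s => tendsto_const_nhds) hVp (ae_of_all _ fun _ _ => le_rfl)
  refine key.congr fun n => ?_
  have i0 := hint 0 (by simpa using hδ)
  have i1 := hint _ (hn₀ (n + n₀) (by simp)).2
  simp only [zero_mul, add_zero] at i0
  simp only [zero_add, zero_mul, add_zero, smul_eq_mul]
  rw [integral_div, integral_sub i1 i0, div_eq_inv_mul]
  rfl

end Problem

/-! ### Coordinates on the junction -/

section Coordinates
variable {N : ℕ}

lemma point_apply (i j : Fin N) (r : ℝ) : point i r j = if j = i then r else 0 := by
  simp [point]

@[simp] lemma point_apply_self (i : Fin N) (r : ℝ) : point i r i = r := by simp [point_apply]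

@[simp] lemma norm_point (i : Fin N) (r : ℝ) : ‖point i r‖ = |r| := by
  simp [point, norm_smul]

@[simp] lemma point_zero (i : Fin N) : point i (0 : ℝ) = 0 := by simp [point]

lemma point_mem_junction (i : Fin N) {r : ℝ} (hr : 0 ≤ r) : point i r ∈ junction N :=
  mem_iUnion.2 ⟨i, r, hr, rfl⟩

/-- These are closed conditions on the coordinates, so the state constraint passes to pointwise
limits. Without edges the junction would be empty while the conditions hold vacuously. -/
lemma mem_junction_iff [Nonempty (Fin N)] {x : EuclideanSpace ℝ (Fin N)} :
    x ∈ junction N ↔ (∀ j, 0 ≤ x j) ∧ ∀ j k, j ≠ k → x j * x k = 0 := by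
  constructor
  · intro h
    obtain ⟨i, r, hr, rfl⟩ := mem_iUnion.1 h
    refine ⟨fun j => ?_, fun j k hjk => ?_⟩
    · rw [point_apply]; split_ifs; exacts [hr, le_rfl]
    · rw [point_apply, point_apply]
      by_cases hj : j = i
      · rw [if_neg (show k ≠ i from fun hk => hjk (hj.trans hk.symm)), mul_zero]
      · rw [if_neg hj, zero_mul]
  · rintro ⟨h0, h⟩
    by_cases hx : ∃ i, x i ≠ 0
    · obtain ⟨i, hi⟩ := hx
      have : x = point i (x i) := by
        ext j
        rw [point_apply]
        split_ifs with hj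
        · rw [hj]
        · exact (mul_eq_zero.1 (h j i hj)).resolve_right hi
      rw [this]
      exact point_mem_junction i (h0 i)
    · push Not at hx
      obtain ⟨i⟩ := ‹Nonempty (Fin N)›
      have : x = point i 0 := by ext j; simp [hx j]
      rw [this]
      exact point_mem_junction i le_rfl

lemma nonneg_of_mem_junction {x : EuclideanSpace ℝ (Fin N)} (hx : x ∈ junction N) (j : Fin N) :
    0 ≤ x j := by
  obtain ⟨i, r, hr, rfl⟩ := mem_iUnion.1 hx
  rw [point_apply]; split_ifs; exacts [hr, le_rfl]

lemma eq_point_of_pos {x : EuclideanSpace ℝ (Fin N)} (hx : x ∈ junction N) {i : Fin N}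
    (h : 0 < x i) : x = point i (x i) := by
  obtain ⟨j, r, hr, rfl⟩ := mem_iUnion.1 hx
  rw [point_apply] at h
  split_ifs at h with hij
  · subst hij; rw [point_apply_self]
  · exact absurd h (lt_irrefl _)

lemma norm_eq_of_pos {x : EuclideanSpace ℝ (Fin N)} (hx : x ∈ junction N) {i : Fin N}
    (h : 0 < x i) : ‖x‖ = x i := by
  conv_lhs => rw [eq_point_of_pos hx h]
  rw [norm_point, abs_of_pos h]

lemma exists_pos_or_eq_zero {x : EuclideanSpace ℝ (Fin N)} (hx : x ∈ junction N) :
    (∃ i, 0 < x i) ∨ x = 0 := by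
  obtain ⟨i, r, hr, rfl⟩ := mem_iUnion.1 hx
  rcases (show 0 ≤ r from hr).eq_or_lt with rfl | h
  · right; simp
  · left; exact ⟨i, by simpa using h⟩

lemma point_mem_edge_diff {i j : Fin N} {r : ℝ} (hr : 0 < r) :
    point i r ∈ edge j \ {0} ↔ j = i := by
  constructor
  · rintro ⟨⟨r', hr', h⟩, h0⟩
    by_contra hij
    have : point j r' i = point i r i := by rw [h]
    rw [point_apply, if_neg (Ne.symm hij), point_apply_self] at this
    exact hr.ne this
  · rintro rfl
    refine ⟨⟨r, hr.le, rfl⟩, fun h => ?_⟩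
    have := congrArg norm (show point j r = 0 from h)
    rw [norm_point, norm_zero, abs_of_pos hr] at this
    exact hr.ne' this

lemma abs_apply_le_norm (x : EuclideanSpace ℝ (Fin N)) (j : Fin N) : |x j| ≤ ‖x‖ := by
  simpa using PiLp.norm_apply_le x j

end Coordinates

namespace Problem
variable {N : ℕ} {P : Problem N}

lemma runningCost_point (i : Fin N) {r : ℝ} (hr : 0 < r) (v : EuclideanSpace ℝ (Fin N)) (τ : ℝ) :
    P.runningCost (point i r) v τ = P.ℓ i r (v i) τ := by
  have h0 : point i r ∉ ({0} : Set (EuclideanSpace ℝ (Fin N))) :=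
    ((point_mem_edge_diff (i := i) hr).2 rfl).2
  rw [runningCost, indicator_of_notMem h0, add_zero, Finset.sum_eq_single i]
  · rw [indicator_of_mem ((point_mem_edge_diff hr).2 rfl), norm_point, abs_of_pos hr]
  · intro j _ hj
    exact indicator_of_notMem (fun h => hj ((point_mem_edge_diff hr).1 h)) _
  · simp

lemma runningCost_of_pos {x : EuclideanSpace ℝ (Fin N)} (hx : x ∈ junction N) {i : Fin N}
    (h : 0 < x i) (v : EuclideanSpace ℝ (Fin N)) (τ : ℝ) :
    P.runningCost x v τ = P.ℓ i (x i) (v i) τ := by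
  conv_lhs => rw [eq_point_of_pos hx h]
  exact runningCost_point i h v τ

lemma runningCost_zero (v : EuclideanSpace ℝ (Fin N)) (τ : ℝ) :
    P.runningCost 0 v τ = P.vertexCost τ := by
  simp [runningCost]

lemma terminalCost_point (i : Fin N) {r : ℝ} (hr : 0 < r) :
    P.terminalCost (point i r) = P.g i r := by
  have h0 : point i r ∉ ({0} : Set (EuclideanSpace ℝ (Fin N))) :=
    ((point_mem_edge_diff (i := i) hr).2 rfl).2
  rw [terminalCost, indicator_of_notMem h0, add_zero, Finset.sum_eq_single i]
  · rw [indicator_of_mem ((point_mem_edge_diff hr).2 rfl), norm_point, abs_of_pos hr]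
  · intro j _ hj
    exact indicator_of_notMem (fun h => hj ((point_mem_edge_diff hr).1 h)) _
  · simp

lemma terminalCost_of_pos {x : EuclideanSpace ℝ (Fin N)} (hx : x ∈ junction N) {i : Fin N}
    (h : 0 < x i) : P.terminalCost x = P.g i (x i) := by
  conv_lhs => rw [eq_point_of_pos hx h]
  exact terminalCost_point i h

lemma terminalCost_zero :
    P.terminalCost (0 : EuclideanSpace ℝ (Fin N)) = min P.gStar (⨅ i, P.g i 0) := by
  simp [terminalCost]

lemma Regular.continuousOn_vertexCost [Nonempty (Fin N)] (hP : P.Regular) :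
    ContinuousOn P.vertexCost (Icc 0 P.T) := by
  have h : ∀ j, ContinuousOn (fun s => P.ℓ j 0 0 s) (Icc 0 P.T) := fun j =>
    (hP.ℓ_continuous j).comp (f := fun s : ℝ => ((0 : ℝ), (0 : ℝ), s)) (by fun_prop)
      (fun s hs => ⟨mem_Ici.2 le_rfl, mem_univ _, hs⟩)
  have h2 : ContinuousOn (fun s => ⨅ j, P.ℓ j 0 0 s) (Icc 0 P.T) := by
    simp only [← Finset.inf'_univ_eq_ciInf]
    exact ContinuousOn.finset_inf'_apply _ (fun j _ => h j)
  exact hP.ℓStar_continuous.inf h2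

lemma vertexCost_le (τ : ℝ) (j : Fin N) : P.vertexCost τ ≤ P.ℓ j 0 0 τ :=
  (min_le_right _ _).trans (ciInf_le (finite_range _).bddBelow j)

lemma Regular.terminalCost_lower [Nonempty (Fin N)] (hP : P.Regular) :
    ∃ G : ℝ, ∀ x ∈ junction N, G ≤ P.terminalCost x := by
  choose C hC using hP.g_bounded
  set G := min P.gStar (⨅ i, -C i)
  have hG : ∀ i, G ≤ -C i := fun i =>
    (min_le_right _ _).trans (ciInf_le (finite_range _).bddBelow i)
  refine ⟨G, fun x hx => ?_⟩
  rcases exists_pos_or_eq_zero hx with ⟨i, hi⟩ | rfl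
  · rw [terminalCost_of_pos hx hi]
    exact (hG i).trans (abs_le.1 (hC i _ hi.le)).1
  · rw [terminalCost_zero]
    refine le_min (min_le_left _ _) (le_ciInf fun i => (hG i).trans ?_)
    exact (abs_le.1 (hC i 0 (mem_Ici.2 le_rfl))).1

end Problem

/-! ### Scalar functions of class `W^{1,p}` -/

/-- On `[a, b]`, the function `c` is the primitive of `v ∈ L^p`. -/
structure IsW (p a b : ℝ) (c v : ℝ → ℝ) : Prop where
  meas : AEStronglyMeasurable v (volume.restrict (Icc a b))
  pow : IntegrableOn (fun s => |v s| ^ p) (Icc a b)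
  eq : ∀ s ∈ Icc a b, c s = c a + ∫ τ in a..s, v τ

lemma volume_Icc_ne_top {a b : ℝ} : volume (Icc a b) ≠ ⊤ := measure_Icc_lt_top.ne

namespace IsW
variable {p a b : ℝ} {c v : ℝ → ℝ}

lemma integrableOn (h : IsW p a b c v) (hp : 1 < p) : IntegrableOn v (Icc a b) :=
  Integrable.mono' (h.pow.add (integrableOn_const volume_Icc_ne_top (C := (1 : ℝ)))) h.meas
    (ae_of_all _ fun s => le_rpow_add_one hp (abs_nonneg (v s)))

lemma intervalIntegrable (h : IsW p a b c v) (hp : 1 < p) {a' b' : ℝ} (ha : a' ∈ Icc a b)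
    (hb : b' ∈ Icc a b) : IntervalIntegrable v volume a' b' := by
  rw [intervalIntegrable_iff]
  exact (h.integrableOn hp).mono_set
    (uIoc_subset_uIcc.trans ((convex_Icc a b).ordConnected.uIcc_subset ha hb))

lemma sub_eq (h : IsW p a b c v) (hp : 1 < p) {a' b' : ℝ} (ha : a' ∈ Icc a b)
    (hb : b' ∈ Icc a b) : c b' - c a' = ∫ τ in a'..b', v τ := by
  have hab : a ∈ Icc a b := ⟨le_rfl, ha.1.trans ha.2⟩
  rw [h.eq _ hb, h.eq _ ha, ← intervalIntegral.integral_add_adjacent_intervals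
    (h.intervalIntegrable hp hab ha) (h.intervalIntegrable hp ha hb)]
  ring

lemma restrict (h : IsW p a b c v) (hp : 1 < p) {a' b' : ℝ} (ha : a' ∈ Icc a b)
    (hb : b' ∈ Icc a b) : IsW p a' b' c v where
  meas := h.meas.mono_measure (Measure.restrict_mono (Icc_subset_Icc ha.1 hb.2) le_rfl)
  pow := h.pow.mono_set (Icc_subset_Icc ha.1 hb.2)
  eq s hs := by
    have := h.sub_eq hp ha ⟨ha.1.trans hs.1, hs.2.trans hb.2⟩
    linarith

lemma continuousOn (h : IsW p a b c v) (hp : 1 < p) : ContinuousOn c (Icc a b) := by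
  rcases le_or_gt a b with hab | hab
  · have : ContinuousOn (fun s => ∫ τ in a..s, v τ) (uIcc a b) :=
      intervalIntegral.continuousOn_primitive_interval (by
        rw [uIcc_of_le hab]; exact h.integrableOn hp)
    rw [uIcc_of_le hab] at this
    exact (this.const_add (c a)).congr h.eq
  · rw [Icc_eq_empty hab.not_ge]; exact continuousOn_empty _

lemma congr {c' v' : ℝ → ℝ} (h : IsW p a b c v) (hc : ∀ s ∈ Icc a b, c' s = c s)
    (hv : ∀ᵐ s ∂(volume.restrict (Icc a b)), v' s = v s) : IsW p a b c' v' where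
  meas := h.meas.congr (by filter_upwards [hv] with s hs using hs.symm)
  pow := Integrable.congr h.pow (by filter_upwards [hv] with s hs; rw [hs])
  eq s hs := by
    rw [hc s hs, hc a ⟨le_rfl, hs.1.trans hs.2⟩, h.eq s hs]
    congr 1
    refine intervalIntegral.integral_congr_ae ?_
    filter_upwards [(ae_restrict_iff' measurableSet_Icc).1 hv] with τ hτ hτ'
    rw [uIoc_of_le hs.1] at hτ'
    exact (hτ ⟨hτ'.1.le, hτ'.2.trans hs.2⟩).symm

lemma ae_hasDerivAt (h : IsW p a b c v) (hp : 1 < p) :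
    ∀ᵐ s, s ∈ Ioo a b → HasDerivAt c (v s) s := by
  rcases le_or_gt a b with hab | hab
  · have hi := h.intervalIntegrable hp (left_mem_Icc.2 hab) (right_mem_Icc.2 hab)
    filter_upwards [hi.ae_hasDerivAt_integral] with s hs hs'
    have h1 := (hs (by rw [uIcc_of_le hab]; exact Ioo_subset_Icc_self hs') a
      left_mem_uIcc).const_add (c a)
    refine h1.congr_of_eventuallyEq ?_
    filter_upwards [Icc_mem_nhds hs'.1 hs'.2] with τ hτ using h.eq τ hτ
  · simp [Ioo_eq_empty hab.le.not_gt]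

/-- Concatenation. -/
lemma concat {d : ℝ} {c' v' : ℝ → ℝ} (hp : 1 < p) (hab : a ≤ b) (hbd : b ≤ d)
    (h : IsW p a b c v) (h' : IsW p b d c' v') (hcc : c b = c' b) :
    IsW p a d (fun s => if s ≤ b then c s else c' s) (fun s => if s ≤ b then v s else v' s) := by
  have hunion : Icc a d = Icc a b ∪ Ioc b d := (Icc_union_Ioc_eq_Icc hab hbd).symm
  have e1 : ∀ s ∈ Icc a b, (if s ≤ b then v s else v' s) = v s := fun s hs => if_pos hs.2
  have e2 : ∀ s ∈ Ioc b d, (if s ≤ b then v s else v' s) = v' s := fun s hs => if_neg hs.1.not_ge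
  refine ⟨?_, ?_, fun s hs => ?_⟩
  · rw [hunion, aestronglyMeasurable_union_iff]
    refine ⟨h.meas.congr ?_, (h'.meas.mono_measure
      (Measure.restrict_mono Ioc_subset_Icc_self le_rfl)).congr ?_⟩
    · filter_upwards [ae_restrict_mem measurableSet_Icc] with s hs using (e1 s hs).symm
    · filter_upwards [ae_restrict_mem measurableSet_Ioc] with s hs using (e2 s hs).symm
  · rw [hunion]
    refine IntegrableOn.union ?_ ?_
    · refine h.pow.congr_fun (fun s hs => ?_) measurableSet_Icc
      simp only [e1 s hs]
    · refine (h'.pow.mono_set Ioc_subset_Icc_self).congr_fun (fun s hs => ?_) measurableSet_Ioc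
      simp only [e2 s hs]
  · have f1 : ∀ s ∈ Icc a b, ∫ τ in a..s, (if τ ≤ b then v τ else v' τ) = ∫ τ in a..s, v τ := by
      intro s hs
      refine intervalIntegral.integral_congr fun τ hτ => ?_
      rw [uIcc_of_le hs.1] at hτ
      exact e1 τ ⟨hτ.1, hτ.2.trans hs.2⟩
    simp only [if_pos hab]
    by_cases hsb : s ≤ b
    · rw [if_pos hsb, f1 s ⟨hs.1, hsb⟩, h.eq s ⟨hs.1, hsb⟩]
    · rw [if_neg hsb]
      push Not at hsb
      have f2 : ∫ τ in b..s, (if τ ≤ b then v τ else v' τ) = ∫ τ in b..s, v' τ := by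
        refine intervalIntegral.integral_congr_ae (ae_of_all _ fun τ hτ => ?_)
        rw [uIoc_of_le hsb.le] at hτ
        exact e2 τ ⟨hτ.1, hτ.2.trans hs.2⟩
      have i1 : IntervalIntegrable (fun τ => if τ ≤ b then v τ else v' τ) volume a b := by
        rw [intervalIntegrable_iff_integrableOn_Ioc_of_le hab]
        exact ((h.integrableOn hp).mono_set Ioc_subset_Icc_self).congr_fun
          (fun τ hτ => (e1 τ (Ioc_subset_Icc_self hτ)).symm) measurableSet_Ioc
      have i2 : IntervalIntegrable (fun τ => if τ ≤ b then v τ else v' τ) volume b s := by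
        rw [intervalIntegrable_iff_integrableOn_Ioc_of_le hsb.le]
        exact ((h'.integrableOn hp).mono_set
          (Ioc_subset_Icc_self.trans (Icc_subset_Icc_right hs.2))).congr_fun
          (fun τ hτ => (e2 τ ⟨hτ.1, hτ.2.trans hs.2⟩).symm) measurableSet_Ioc
      rw [← intervalIntegral.integral_add_adjacent_intervals i1 i2, f2, f1 b ⟨hab, le_rfl⟩,
        h'.eq s ⟨hsb.le, hs.2⟩, ← hcc, h.eq b ⟨hab, le_rfl⟩]
      ring

end IsW

/-! ### Coordinates of vector-valued curves of class `W^{1,p}` -/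

section MemW1p
variable {N : ℕ} {p a b : ℝ}

lemma memW1p_of_coord (hp : 1 < p) {y : ℝ → EuclideanSpace ℝ (Fin N)} {v : Fin N → ℝ → ℝ}
    (h : ∀ j, IsW p a b (fun s => y s j) (v j)) : MemW1p p a b y := by
  have hp0 : ENNReal.ofReal p ≠ 0 := by
    simp only [ne_eq, ENNReal.ofReal_eq_zero, not_le]; linarith
  have hmem : ∀ j, MemLp (v j) (ENNReal.ofReal p) (volume.restrict (Icc a b)) := by
    intro j
    rw [← integrable_norm_rpow_iff (h j).meas hp0 ENNReal.ofReal_ne_top,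
      ENNReal.toReal_ofReal (by linarith)]
    exact (h j).pow
  have hα : MemLp (fun s => ∑ j, (ContinuousLinearMap.toSpanSingleton ℝ
      (EuclideanSpace.single j (1 : ℝ))) (v j s)) (ENNReal.ofReal p)
      (volume.restrict (Icc a b)) :=
    memLp_finsetSum _ fun j _ => (ContinuousLinearMap.toSpanSingleton ℝ
      (EuclideanSpace.single j (1 : ℝ))).comp_memLp' (hmem j)
  refine ⟨_, hα, fun s hs => ?_⟩
  have hi : IntervalIntegrable (fun s => ∑ j, (ContinuousLinearMap.toSpanSingleton ℝ
      (EuclideanSpace.single j (1 : ℝ))) (v j s)) volume a s := by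
    rw [intervalIntegrable_iff_integrableOn_Ioc_of_le hs.1]
    have : IsFiniteMeasure (volume.restrict (Icc a b)) :=
      ⟨by rw [Measure.restrict_apply_univ]; exact measure_Icc_lt_top⟩
    have h1 : (1 : ENNReal) ≤ ENNReal.ofReal p := by
      rw [← ENNReal.ofReal_one]; exact ENNReal.ofReal_le_ofReal hp.le
    have h2 : IntegrableOn _ (Icc a b) := hα.integrable h1
    exact h2.mono_set (Ioc_subset_Icc_self.trans (Icc_subset_Icc_right hs.2))
  ext j
  have h3 := ContinuousLinearMap.intervalIntegral_comp_comm
    (EuclideanSpace.proj j : EuclideanSpace ℝ (Fin N) →L[ℝ] ℝ) hi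
  rw [PiLp.add_apply, (h j).eq s hs]
  congr 1
  refine Eq.trans ?_ h3
  refine intervalIntegral.integral_congr fun τ _ => ?_
  simp

/-- By Lebesgue differentiation the weak derivative coincides a.e. with `deriv y`, which is the
velocity that enters the cost. -/
lemma MemW1p.coord (hp : 1 < p) {y : ℝ → EuclideanSpace ℝ (Fin N)} (h : MemW1p p a b y)
    (j : Fin N) : IsW p a b (fun s => y s j) (fun s => deriv y s j) := by
  obtain ⟨α, hα, hy⟩ := h
  have hp0 : ENNReal.ofReal p ≠ 0 := by
    simp only [ne_eq, ENNReal.ofReal_eq_zero, not_le]; linarith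
  have : IsFiniteMeasure (volume.restrict (Icc a b)) :=
    ⟨by rw [Measure.restrict_apply_univ]; exact measure_Icc_lt_top⟩
  have h1 : (1 : ENNReal) ≤ ENNReal.ofReal p := by
    rw [← ENNReal.ofReal_one]; exact ENNReal.ofReal_le_ofReal hp.le
  have hint : IntegrableOn α (Icc a b) := hα.integrable h1
  have hαj := (EuclideanSpace.proj j : EuclideanSpace ℝ (Fin N) →L[ℝ] ℝ).comp_memLp' hα
  have hW : IsW p a b (fun s => y s j) (fun s => α s j) := by
    refine ⟨hαj.1, ?_, fun s hs => ?_⟩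
    · have := (integrable_norm_rpow_iff hαj.1 hp0 ENNReal.ofReal_ne_top).2 hαj
      rw [ENNReal.toReal_ofReal (by linarith)] at this
      exact this
    · have hi : IntervalIntegrable α volume a s := by
        rw [intervalIntegrable_iff_integrableOn_Ioc_of_le hs.1]
        exact hint.mono_set (Ioc_subset_Icc_self.trans (Icc_subset_Icc_right hs.2))
      have h3 := ContinuousLinearMap.intervalIntegral_comp_comm
        (EuclideanSpace.proj j : EuclideanSpace ℝ (Fin N) →L[ℝ] ℝ) hi
      have h4 : (y s) j = (y a) j + (∫ τ in a..s, α τ) j := by rw [hy s hs, PiLp.add_apply]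
      exact h4.trans (congrArg _ h3.symm)
  refine hW.congr (fun _ _ => rfl) ?_
  rcases le_or_gt a b with hab | hab
  · have hi : IntervalIntegrable α volume a b := by
      rw [intervalIntegrable_iff_integrableOn_Ioc_of_le hab]
      exact hint.mono_set Ioc_subset_Icc_self
    rw [← restrict_Ioo_eq_restrict_Icc, ae_restrict_iff' measurableSet_Ioo]
    filter_upwards [hi.ae_hasDerivAt_integral] with s hs hs'
    have h1 := (hs (by rw [uIcc_of_le hab]; exact Ioo_subset_Icc_self hs') a
      left_mem_uIcc).const_add (y a)
    have h2 : HasDerivAt y (α s) s := by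
      refine h1.congr_of_eventuallyEq ?_
      filter_upwards [Icc_mem_nhds hs'.1 hs'.2] with τ hτ using hy τ hτ
    rw [h2.deriv]
  · rw [Icc_eq_empty hab.not_ge]; simp

end MemW1p

/-! ### Paths on the junction and their costs -/

namespace Problem
variable {N : ℕ} {P : Problem N}

/-- Trajectories of class `W^{1,p}` on `[a, b]` with values in the junction. -/
structure IsPath (P : Problem N) (a b : ℝ) (y : ℝ → EuclideanSpace ℝ (Fin N)) : Prop where
  coord : ∀ j, IsW P.p a b (fun s => y s j) (fun s => deriv y s j)
  mem : ∀ s ∈ Icc a b, y s ∈ junction N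

lemma mem_admissible_iff (hP : P.Regular) {t : ℝ} {x : EuclideanSpace ℝ (Fin N)}
    {y : ℝ → EuclideanSpace ℝ (Fin N)} :
    y ∈ P.admissible t x ↔ P.IsPath t P.T y ∧ y t = x :=
  ⟨fun h => ⟨⟨fun j => h.1.coord hP.one_lt_p j, h.2.1⟩, h.2.2⟩,
    fun h => ⟨memW1p_of_coord hP.one_lt_p h.1.coord, h.1.mem, h.2⟩⟩

lemma IsPath.of_coord (hP : P.Regular) {a b : ℝ} {y : ℝ → EuclideanSpace ℝ (Fin N)}
    {v : Fin N → ℝ → ℝ} (h : ∀ j, IsW P.p a b (fun s => y s j) (v j))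
    (hy : ∀ s ∈ Icc a b, y s ∈ junction N) : P.IsPath a b y :=
  ⟨fun j => (memW1p_of_coord hP.one_lt_p h).coord hP.one_lt_p j, hy⟩

namespace IsPath
variable {a b : ℝ} {y : ℝ → EuclideanSpace ℝ (Fin N)}

lemma restrict (hP : P.Regular) (h : P.IsPath a b y) {a' b' : ℝ} (ha : a' ∈ Icc a b)
    (hb : b' ∈ Icc a b) : P.IsPath a' b' y :=
  ⟨fun j => (h.coord j).restrict hP.one_lt_p ha hb,
    fun s hs => h.mem s ⟨ha.1.trans hs.1, hs.2.trans hb.2⟩⟩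

lemma continuousOn (hP : P.Regular) (h : P.IsPath a b y) : ContinuousOn y (Icc a b) := by
  have h1 : ContinuousOn (fun s => (y s).ofLp) (Icc a b) :=
    continuousOn_pi.2 fun j => (h.coord j).continuousOn hP.one_lt_p
  exact (PiLp.continuous_toLp 2 _).comp_continuousOn h1

/-- Almost everywhere, the coordinates have derivatives, which vanish where the coordinate does. -/
lemma ae_deriv (hP : P.Regular) (h : P.IsPath a b y) :
    ∀ᵐ s ∂(volume.restrict (Icc a b)), ∀ j, HasDerivAt (fun s => y s j) (deriv y s j) s ∧
      (y s j = 0 → deriv y s j = 0) := by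
  rw [← restrict_Ioo_eq_restrict_Icc, ae_restrict_iff' measurableSet_Ioo]
  have h1 := ae_all_iff.2 fun j => (h.coord j).ae_hasDerivAt hP.one_lt_p
  filter_upwards [h1] with s hs hs' j
  refine ⟨hs j hs', fun h0 => ?_⟩
  -- Coordinates are nonnegative on the junction, so a zero at an interior time is a minimum.
  have hmin : IsLocalMin (fun s => y s j) s := by
    filter_upwards [Icc_mem_nhds hs'.1 hs'.2] with τ hτ
    rw [h0]
    exact nonneg_of_mem_junction (h.mem τ hτ) j
  exact hmin.hasDerivAt_eq_zero (hs j hs')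

lemma measurable_deriv_apply (y : ℝ → EuclideanSpace ℝ (Fin N)) (j : Fin N) :
    Measurable fun s => deriv y s j :=
  (EuclideanSpace.proj j : EuclideanSpace ℝ (Fin N) →L[ℝ] ℝ).measurable.comp (measurable_deriv y)

lemma exists_bound (hP : P.Regular) (h : P.IsPath a b y) :
    ∃ R : ℝ, 0 < R ∧ ∀ s ∈ Icc a b, ∀ j, y s j ∈ Icc 0 R := by
  obtain ⟨R, hR⟩ := isCompact_Icc.exists_bound_of_continuousOn (h.continuousOn hP)
  refine ⟨max R 1, by positivity, fun s hs j => ⟨nonneg_of_mem_junction (h.mem s hs) j, ?_⟩⟩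
  exact (le_abs_self _).trans ((abs_apply_le_norm _ j).trans ((hR s hs).trans (le_max_left _ _)))

lemma integrableOn_runningCost [Nonempty (Fin N)] (hP : P.Regular) (h3 : P.H3)
    (h : P.IsPath a b y) (ha : 0 ≤ a) (hb : b ≤ P.T) :
    IntegrableOn (fun s => P.runningCost (y s) (deriv y s) s) (Icc a b) := by
  rcases lt_or_ge b a with hab | hab
  · rw [Icc_eq_empty hab.not_ge]; exact integrableOn_empty
  have hS : Icc a b ⊆ Icc 0 P.T := Icc_subset_Icc ha hb
  -- A continuous extension of `y` to `ℝ`, for which the sets where a coordinate is positive, or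
  -- where the vertex is occupied, are measurable.
  set z : ℝ → EuclideanSpace ℝ (Fin N) := IccExtend hab ((Icc a b).domRestrict y) with hz
  have hzc : Continuous z := continuous_IccExtend_iff.2 (h.continuousOn hP).domRestrict
  have hzy : ∀ s ∈ Icc a b, z s = y s := fun s hs => IccExtend_of_mem hab _ hs
  have hzj : ∀ j, Continuous fun s => z s j := fun j =>
    (EuclideanSpace.proj j : EuclideanSpace ℝ (Fin N) →L[ℝ] ℝ).continuous.comp hzc
  obtain ⟨R, hR, hyR⟩ := h.exists_bound hP
  have e : ∀ s ∈ Icc a b, (∑ j, ({s | 0 < z s j}.indicator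
      (fun s => P.ℓ j (z s j) (deriv y s j) s) s)) + {s | z s = 0}.indicator P.vertexCost s =
      P.runningCost (y s) (deriv y s) s := by
    intro s hs
    rcases exists_pos_or_eq_zero (h.mem s hs) with ⟨i, hi⟩ | h0
    · rw [runningCost_of_pos (h.mem s hs) hi, Finset.sum_eq_single i]
      · rw [indicator_of_mem (by simpa [hzy s hs] using hi), indicator_of_notMem, hzy s hs, add_zero]
        intro h0
        rw [mem_ofPred_eq, hzy s hs] at h0
        rw [h0] at hi
        exact lt_irrefl _ hi
      · intro j _ hj
        refine indicator_of_notMem ?_ _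
        rw [mem_ofPred_eq, hzy s hs, eq_point_of_pos (h.mem s hs) hi, point_apply, if_neg hj]
        exact lt_irrefl _
      · simp
    · rw [h0, runningCost_zero, indicator_of_mem (by rw [mem_ofPred_eq, hzy s hs, h0]),
        Finset.sum_eq_zero, zero_add]
      intro j _
      refine indicator_of_notMem ?_ _
      rw [mem_ofPred_eq, hzy s hs, h0]
      simp
  refine IntegrableOn.congr_fun ?_ e measurableSet_Icc
  refine Integrable.add (integrable_finsetSum _ fun j _ => ?_) ?_
  · refine IntegrableOn.indicator ?_ (isOpen_lt continuous_const (hzj j)).measurableSet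
    refine hP.integrableOn_cost h3 j measurableSet_Icc hS (R := R) (hzj j).aemeasurable
      (measurable_deriv_apply y j).aemeasurable (fun s hs => ?_) (h.coord j).pow
    rw [hzy s hs]; exact hyR s hs j
  · refine IntegrableOn.indicator ?_ (isClosed_eq hzc continuous_const).measurableSet
    exact (hP.continuousOn_vertexCost.mono hS).integrableOn_Icc

lemma intervalIntegrable_runningCost [Nonempty (Fin N)] (hP : P.Regular) (h3 : P.H3)
    (h : P.IsPath a b y) (ha : 0 ≤ a) (hb : b ≤ P.T) (hab : a ≤ b) :
    IntervalIntegrable (fun s => P.runningCost (y s) (deriv y s) s) volume a b := by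
  rw [intervalIntegrable_iff_integrableOn_Ioc_of_le hab]
  exact (h.integrableOn_runningCost hP h3 ha hb).mono_set Ioc_subset_Icc_self

lemma integral_runningCost_eq (h : P.IsPath a b y) (hab : a ≤ b)
    {i : Fin N} (hi : ∀ s ∈ Icc a b, 0 < y s i) :
    ∫ s in a..b, P.runningCost (y s) (deriv y s) s =
      ∫ s in a..b, P.ℓ i (y s i) (deriv y s i) s := by
  refine intervalIntegral.integral_congr fun s hs => ?_
  rw [uIcc_of_le hab] at hs
  exact runningCost_of_pos (h.mem s hs) (hi s hs) _ _

end IsPath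

/-- Follow `y` up to time `b`, then `z`. -/
def concat (b : ℝ) (y z : ℝ → EuclideanSpace ℝ (Fin N)) : ℝ → EuclideanSpace ℝ (Fin N) :=
  fun s => if s ≤ b then y s else z s

lemma concat_of_le {b s : ℝ} (y z : ℝ → EuclideanSpace ℝ (Fin N)) (h : s ≤ b) :
    concat b y z s = y s := if_pos h

lemma concat_of_ge {b s : ℝ} {y z : ℝ → EuclideanSpace ℝ (Fin N)} (hyz : y b = z b) (h : b ≤ s) :
    concat b y z s = z s := by
  rcases h.eq_or_lt with rfl | h
  · rw [concat_of_le _ _ le_rfl, hyz]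
  · exact if_neg h.not_ge

lemma IsPath.concat (hP : P.Regular) {a b d : ℝ} {y z : ℝ → EuclideanSpace ℝ (Fin N)}
    (hab : a ≤ b) (hbd : b ≤ d) (hy : P.IsPath a b y) (hz : P.IsPath b d z) (hyz : y b = z b) :
    P.IsPath a d (concat b y z) := by
  refine IsPath.of_coord hP
    (v := fun j s => if s ≤ b then deriv y s j else deriv z s j) (fun j => ?_) (fun s hs => ?_)
  · refine ((hy.coord j).concat hP.one_lt_p hab hbd (hz.coord j) (by rw [hyz])).congr
      (fun s _ => ?_) (ae_of_all _ fun s => rfl)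
    unfold Problem.concat
    split_ifs <;> rfl
  · by_cases h : s ≤ b
    · rw [concat_of_le _ _ h]; exact hy.mem s ⟨hs.1, h⟩
    · push Not at h
      rw [concat_of_ge hyz h.le]; exact hz.mem s ⟨h.le, hs.2⟩

lemma integral_concat_left {a b : ℝ} (hab : a ≤ b) (y z : ℝ → EuclideanSpace ℝ (Fin N)) :
    ∫ s in a..b, P.runningCost (concat b y z s) (deriv (concat b y z) s) s =
      ∫ s in a..b, P.runningCost (y s) (deriv y s) s := by
  -- At the gluing time `b` the derivatives of the two curves may differ, hence the passage to the
  -- open interval.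
  rw [intervalIntegral.integral_of_le hab, intervalIntegral.integral_of_le hab,
    integral_Ioc_eq_integral_Ioo, integral_Ioc_eq_integral_Ioo]
  refine setIntegral_congr_fun measurableSet_Ioo fun s hs => ?_
  have : concat b y z =ᶠ[𝓝 s] y := by
    filter_upwards [Iio_mem_nhds hs.2] with τ hτ using concat_of_le _ _ (le_of_lt hτ)
  simp only [this.deriv_eq, concat_of_le y z hs.2.le]

lemma integral_concat_right {b d : ℝ} (hbd : b ≤ d) (y z : ℝ → EuclideanSpace ℝ (Fin N)) :
    ∫ s in b..d, P.runningCost (concat b y z s) (deriv (concat b y z) s) s =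
      ∫ s in b..d, P.runningCost (z s) (deriv z s) s := by
  rw [intervalIntegral.integral_of_le hbd, intervalIntegral.integral_of_le hbd,
    integral_Ioc_eq_integral_Ioo, integral_Ioc_eq_integral_Ioo]
  refine setIntegral_congr_fun measurableSet_Ioo fun s hs => ?_
  have : concat b y z =ᶠ[𝓝 s] z := by
    filter_upwards [Ioi_mem_nhds hs.1] with τ hτ using if_neg (not_le.2 hτ)
  simp only [this.deriv_eq, this.eq_of_nhds]

lemma cost_split [Nonempty (Fin N)] (hP : P.Regular) (h3 : P.H3) {t b : ℝ} (ht : 0 ≤ t)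
    (htb : t ≤ b) (hb : b ≤ P.T) {y : ℝ → EuclideanSpace ℝ (Fin N)} (hy : P.IsPath t P.T y) :
    P.cost t y = (∫ s in t..b, P.runningCost (y s) (deriv y s) s) + P.cost b y := by
  have hbm : b ∈ Icc t P.T := ⟨htb, hb⟩
  have htm : t ∈ Icc t P.T := ⟨le_rfl, htb.trans hb⟩
  have hTm : P.T ∈ Icc t P.T := ⟨htb.trans hb, le_rfl⟩
  unfold cost
  rw [← intervalIntegral.integral_add_adjacent_intervals
    ((hy.restrict hP htm hbm).intervalIntegrable_runningCost hP h3 ht hb htb)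
    ((hy.restrict hP hbm hTm).intervalIntegrable_runningCost hP h3 (ht.trans htb) le_rfl hb)]
  ring

lemma cost_concat [Nonempty (Fin N)] (hP : P.Regular) (h3 : P.H3) {t b : ℝ} (ht : 0 ≤ t)
    (htb : t ≤ b) (hb : b ≤ P.T) {y z : ℝ → EuclideanSpace ℝ (Fin N)} (hy : P.IsPath t b y)
    (hz : P.IsPath b P.T z) (hyz : y b = z b) :
    P.cost t (concat b y z) = (∫ s in t..b, P.runningCost (y s) (deriv y s) s) + P.cost b z := by
  rw [cost_split hP h3 ht htb hb (hy.concat hP htb hb hz hyz), integral_concat_left htb]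
  unfold cost
  rw [integral_concat_right hb, concat_of_ge hyz hb]

/-! ### The value function -/

lemma Regular.le_runningCost [Nonempty (Fin N)] {C₀ c₀ : ℝ}
    (hC : 0 < C₀) (hℓ : ∀ i, ∀ y ∈ Ici (0 : ℝ), ∀ a : ℝ, ∀ s ∈ Icc 0 P.T,
      C₀ * |a| ^ P.p + c₀ ≤ P.ℓ i y a s) (hs : ∀ s ∈ Icc 0 P.T, c₀ ≤ P.ℓStar s)
    {s : ℝ} (hsT : s ∈ Icc 0 P.T) : c₀ ≤ P.vertexCost s := by
  refine le_min (hs s hsT) (le_ciInf fun i => ?_)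
  have := hℓ i 0 (mem_Ici.2 le_rfl) 0 s hsT
  have h0 : 0 ≤ C₀ * |(0 : ℝ)| ^ P.p := by positivity
  linarith

/-- Coercivity of the cost of a path. -/
lemma IsPath.coercive [Nonempty (Fin N)] (hP : P.Regular) (h1 : P.H1) :
    ∃ C₀ c₀ : ℝ, 0 < C₀ ∧ (∀ s ∈ Icc 0 P.T, ∀ x ∈ junction N, ∀ v,
        c₀ ≤ P.runningCost x v s) ∧
      ∀ (a b : ℝ) (y : ℝ → EuclideanSpace ℝ (Fin N)), 0 ≤ a → b ≤ P.T → P.IsPath a b y →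
      ∀ᵐ s ∂(volume.restrict (Icc a b)), ∀ j,
        C₀ * |deriv y s j| ^ P.p + c₀ ≤ P.runningCost (y s) (deriv y s) s := by
  obtain ⟨C₀, c₀, hC, hℓ, hℓs⟩ := h1
  refine ⟨C₀, c₀, hC, fun s hs x hx v => ?_, fun a b y ha hb hy => ?_⟩
  · rcases exists_pos_or_eq_zero hx with ⟨i, hi⟩ | rfl
    · rw [runningCost_of_pos hx hi]
      have := hℓ i _ hi.le (v i) s hs
      have h0 : 0 ≤ C₀ * |v i| ^ P.p := by positivity
      linarith
    · rw [runningCost_zero]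
      exact Regular.le_runningCost hC hℓ hℓs hs
  · filter_upwards [hy.ae_deriv hP, ae_restrict_mem measurableSet_Icc] with s hd hs j
    have hsT : s ∈ Icc 0 P.T := ⟨ha.trans hs.1, hs.2.trans hb⟩
    have hp0 : P.p ≠ 0 := by have := hP.one_lt_p; linarith
    rcases exists_pos_or_eq_zero (hy.mem s hs) with ⟨i, hi⟩ | h0
    · rw [runningCost_of_pos (hy.mem s hs) hi]
      have := hℓ i _ hi.le (deriv y s i) s hsT
      by_cases hij : j = i
      · rw [hij]; exact this
      · have hj : y s j = 0 := by
          rw [eq_point_of_pos (hy.mem s hs) hi, point_apply, if_neg hij]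
        rw [(hd j).2 hj, abs_zero, Real.zero_rpow hp0]
        have h0 : 0 ≤ C₀ * |deriv y s i| ^ P.p := by positivity
        linarith
    · rw [(hd j).2 (by rw [h0]; rfl), abs_zero, Real.zero_rpow hp0, h0, runningCost_zero]
      have := Regular.le_runningCost hC hℓ hℓs hsT
      linarith

/-- Without a lower bound, the real `sInf` in `value` would be the default value `0`; this bound
makes it a true infimum. -/
lemma exists_le_cost [Nonempty (Fin N)] (hP : P.Regular) (h1 : P.H1) (h3 : P.H3) :
    ∃ M : ℝ, ∀ t ∈ Icc 0 P.T, ∀ y, P.IsPath t P.T y → M ≤ P.cost t y := by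
  obtain ⟨C₀, c₀, hC, hc, -⟩ := IsPath.coercive (P := P) hP h1
  obtain ⟨G, hG⟩ := hP.terminalCost_lower
  refine ⟨-|c₀| * P.T + G, fun t ht y hy => ?_⟩
  refine add_le_add ?_ (hG _ (hy.mem _ ⟨ht.2, le_rfl⟩))
  calc -|c₀| * P.T ≤ -|c₀| * (P.T - t) := by
        have := abs_nonneg c₀
        nlinarith [ht.1]
    _ = ∫ s in t..P.T, -|c₀| := by simp; ring
    _ ≤ _ := by
        refine intervalIntegral.integral_mono_on ht.2 (by simp)
          (hy.intervalIntegrable_runningCost hP h3 ht.1 le_rfl ht.2) fun s hs => ?_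
        exact (neg_abs_le c₀).trans (hc s ⟨ht.1.trans hs.1, hs.2⟩ _ (hy.mem s hs) _)

lemma value_le_cost [Nonempty (Fin N)] (hP : P.Regular) (h1 : P.H1) (h3 : P.H3) {t : ℝ}
    (ht : t ∈ Icc 0 P.T) {y : ℝ → EuclideanSpace ℝ (Fin N)} (hy : P.IsPath t P.T y) :
    P.value (y t) t ≤ P.cost t y := by
  obtain ⟨M, hM⟩ := exists_le_cost hP h1 h3
  refine csInf_le ⟨M, ?_⟩ ⟨y, (mem_admissible_iff hP).2 ⟨hy, rfl⟩, rfl⟩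
  rintro _ ⟨z, hz, rfl⟩
  exact hM t ht z ((mem_admissible_iff hP).1 hz).1

lemma IsPath.const (hP : P.Regular) (a b : ℝ) {x : EuclideanSpace ℝ (Fin N)}
    (hx : x ∈ junction N) : P.IsPath a b fun _ => x := by
  refine IsPath.of_coord hP (v := fun _ _ => 0) (fun j => ⟨aestronglyMeasurable_const, ?_, ?_⟩)
    (fun _ _ => hx)
  · exact integrableOn_const volume_Icc_ne_top
  · simp

lemma exists_cost_lt (hP : P.Regular) {t : ℝ}
    {x : EuclideanSpace ℝ (Fin N)} (hx : x ∈ junction N) {ε : ℝ} (hε : 0 < ε) :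
    ∃ y, P.IsPath t P.T y ∧ y t = x ∧ P.cost t y < P.value x t + ε := by
  obtain ⟨_, ⟨y, hy, rfl⟩, hlt⟩ := Real.lt_sInf_add_pos (s := P.cost t '' P.admissible t x)
    ⟨_, mem_image_of_mem _ ((mem_admissible_iff hP).2 ⟨IsPath.const hP t P.T hx, rfl⟩)⟩ hε
  obtain ⟨h1, h2⟩ := (mem_admissible_iff hP).1 hy
  exact ⟨y, h1, h2, hlt⟩

/-- Dynamic programming inequality. -/
lemma value_le_integral_add_value [Nonempty (Fin N)] (hP : P.Regular) (h1 : P.H1) (h3 : P.H3)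
    {a b : ℝ} (ha : 0 ≤ a) (hab : a ≤ b) (hb : b ≤ P.T) {y : ℝ → EuclideanSpace ℝ (Fin N)}
    (hy : P.IsPath a b y) :
    P.value (y a) a ≤ (∫ s in a..b, P.runningCost (y s) (deriv y s) s) + P.value (y b) b := by
  -- Nearly optimal continuations suffice, so no existence of minimisers is needed.
  refine le_of_forall_pos_le_add fun ε hε => ?_
  obtain ⟨z, hz, hzb, hlt⟩ := exists_cost_lt hP (hy.mem b ⟨hab, le_rfl⟩) (t := b) hε
  have h := value_le_cost hP h1 h3 ⟨ha, hab.trans hb⟩ (hy.concat hP hab hb hz hzb.symm)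
  rw [cost_concat hP h3 ha hab hb hy hz hzb.symm, concat_of_le _ _ hab] at h
  linarith

/-- Dynamic programming for scalar curves on one edge, the form in which every variation is tested;
`v` may be any a.e. representative of the velocity. -/
lemma value_point_le [Nonempty (Fin N)] (hP : P.Regular) (h1 : P.H1) (h3 : P.H3)
    {a b : ℝ} (ha : 0 ≤ a) (hab : a ≤ b) (hb : b ≤ P.T) (i : Fin N) {c v : ℝ → ℝ}
    (hc : IsW P.p a b c v) (hc0 : ∀ s ∈ Icc a b, 0 < c s) :
    P.value (point i (c a)) a ≤
      (∫ s in a..b, P.ℓ i (c s) (v s) s) + P.value (point i (c b)) b := by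
  have hpath : P.IsPath a b fun s => point i (c s) := by
    refine IsPath.of_coord hP (v := fun j => if j = i then v else 0) (fun j => ?_)
      (fun s hs => point_mem_junction i (hc0 s hs).le)
    by_cases hj : j = i
    · simp only [point_apply, if_pos hj]; exact hc
    · simp only [point_apply, if_neg hj]
      refine ⟨aestronglyMeasurable_const, ?_, by simp⟩
      exact (integrableOn_const volume_Icc_ne_top (C := |(0 : ℝ)| ^ P.p))
  have h := value_le_integral_add_value hP h1 h3 ha hab hb hpath
  rw [hpath.integral_runningCost_eq hab (i := i)
    (fun s hs => by simpa only [point_apply_self] using hc0 s hs)] at h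
  refine h.trans_eq ?_
  congr 1
  rw [intervalIntegral.integral_of_le hab, intervalIntegral.integral_of_le hab,
    integral_Ioc_eq_integral_Ioo, integral_Ioc_eq_integral_Ioo]
  refine setIntegral_congr_ae measurableSet_Ioo ?_
  filter_upwards [hc.ae_hasDerivAt hP.one_lt_p, (hpath.coord i).ae_hasDerivAt hP.one_lt_p]
    with s h1 h2 hs
  have h2' := h2 hs
  simp only [point_apply_self] at h2'
  rw [point_apply_self, h2'.unique (h1 hs)]

lemma optimal_isPath (hP : P.Regular) {t : ℝ} {x : EuclideanSpace ℝ (Fin N)}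
    {y : ℝ → EuclideanSpace ℝ (Fin N)} (hy : y ∈ P.optimal t x) : P.IsPath t P.T y :=
  ((mem_admissible_iff hP).1 hy.1).1

lemma IsPath.mem_optimal (hP : P.Regular) {t : ℝ} {y : ℝ → EuclideanSpace ℝ (Fin N)}
    (hy : P.IsPath t P.T y) (h : P.cost t y = P.value (y t) t) : y ∈ P.optimal t (y t) :=
  ⟨(mem_admissible_iff hP).2 ⟨hy, rfl⟩, h⟩

/-- Optimal trajectories remain optimal. -/
lemma optimal_restrict [Nonempty (Fin N)] (hP : P.Regular) (h1 : P.H1) (h3 : P.H3)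
    {t a : ℝ} (ht : 0 ≤ t) (hta : t ≤ a) (ha : a ≤ P.T) {x : EuclideanSpace ℝ (Fin N)}
    {y : ℝ → EuclideanSpace ℝ (Fin N)} (hy : y ∈ P.optimal t x) : y ∈ P.optimal a (y a) := by
  have hp := optimal_isPath hP hy
  have ham : a ∈ Icc t P.T := ⟨hta, ha⟩
  have htm : t ∈ Icc t P.T := ⟨le_rfl, hta.trans ha⟩
  have hTm : P.T ∈ Icc t P.T := ⟨hta.trans ha, le_rfl⟩
  refine (hp.restrict hP ham hTm).mem_optimal hP (le_antisymm ?_ ?_)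
  · have h := value_le_integral_add_value hP h1 h3 ht hta ha (hp.restrict hP htm ham)
    rw [hy.1.2.2, ← hy.2, cost_split hP h3 ht hta ha hp] at h
    linarith
  · exact value_le_cost hP h1 h3 ⟨ht.trans hta, ha⟩ (hp.restrict hP ham hTm)

/-- Dynamic programming principle along an optimal trajectory. -/
lemma optimal_split [Nonempty (Fin N)] (hP : P.Regular) (h1 : P.H1) (h3 : P.H3)
    {t b : ℝ} (ht : 0 ≤ t) (htb : t ≤ b) (hb : b ≤ P.T) {x : EuclideanSpace ℝ (Fin N)}
    {y : ℝ → EuclideanSpace ℝ (Fin N)} (hy : y ∈ P.optimal t x) :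
    P.value x t = (∫ s in t..b, P.runningCost (y s) (deriv y s) s) + P.value (y b) b := by
  rw [← hy.2, cost_split hP h3 ht htb hb (optimal_isPath hP hy),
    (optimal_restrict hP h1 h3 ht htb hb hy).2]

/-- Replacing the end of an optimal trajectory by an optimal one gives an optimal trajectory. -/
lemma optimal_concat [Nonempty (Fin N)] (hP : P.Regular) (h1 : P.H1) (h3 : P.H3)
    {t b : ℝ} (ht : 0 ≤ t) (htb : t ≤ b) (hb : b ≤ P.T) {x : EuclideanSpace ℝ (Fin N)}
    {y z : ℝ → EuclideanSpace ℝ (Fin N)} (hy : y ∈ P.optimal t x) (hz : z ∈ P.optimal b (y b)) :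
    concat b y z ∈ P.optimal t x := by
  have hp := optimal_isPath hP hy
  have hbm : b ∈ Icc t P.T := ⟨htb, hb⟩
  have htm : t ∈ Icc t P.T := ⟨le_rfl, htb.trans hb⟩
  have hyb := hp.restrict hP htm hbm
  have hzp := optimal_isPath hP hz
  refine ⟨(mem_admissible_iff hP).2 ⟨hyb.concat hP htb hb hzp hz.1.2.2.symm, ?_⟩, ?_⟩
  · rw [concat_of_le _ _ htb, hy.1.2.2]
  · rw [cost_concat hP h3 ht htb hb hyb hzp hz.1.2.2.symm, hz.2,
      optimal_split hP h1 h3 ht htb hb hy]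

end Problem

lemma IsW.add_mul {p a b K : ℝ} (hp : 1 < p) {c v φ ψ : ℝ → ℝ} (hc : IsW p a b c v)
    (hψ : Measurable ψ) (hψK : ∀ s, |ψ s| ≤ K)
    (hφ : ∀ s ∈ Icc a b, φ s = φ a + ∫ τ in a..s, ψ τ) (h : ℝ) :
    IsW p a b (fun s => c s + h * φ s) (fun s => v s + h * ψ s) := by
  have hψi : ∀ s, IntervalIntegrable ψ volume a s := fun s => by
    rw [intervalIntegrable_iff]
    exact Measure.integrableOn_of_bounded (by simp) hψ.aestronglyMeasurable (ae_of_all _ hψK)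
  refine ⟨hc.meas.add (hψ.const_mul h).aestronglyMeasurable, ?_, fun s hs => ?_⟩
  · refine integrableOn_of_bound measurableSet_Icc ?_ ((hc.pow.add
      (integrableOn_const volume_Icc_ne_top (C := (|h| * K) ^ p))).const_mul (2 ^ p)) fun s hs => ?_
    · exact ((hc.meas.aemeasurable.add (hψ.const_mul h).aemeasurable).abs.pow_const _).aestronglyMeasurable
    · rw [abs_of_nonneg (by positivity)]
      refine Problem.abs_rpow_add_le hp ?_
      rw [abs_mul]
      exact mul_le_mul_of_nonneg_left (hψK s) (abs_nonneg _)
  · have hi := hc.intervalIntegrable hp (left_mem_Icc.2 (hs.1.trans hs.2)) hs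
    rw [intervalIntegral.integral_add hi ((hψi s).const_mul h),
      intervalIntegral.integral_const_mul, hc.eq s hs, hφ s hs]
    ring

/-- The lemma of du Bois-Reymond. -/
lemma ae_eq_const_of_integral_mul_eq_zero {a b : ℝ} (hab : a < b) {k : ℝ → ℝ}
    (hk : IntervalIntegrable k volume a b)
    (h : ∀ ψ : ℝ → ℝ, Measurable ψ → (∀ s, |ψ s| ≤ 2) → ∫ s in a..b, ψ s = 0 →
      ∫ s in a..b, k s * ψ s = 0) :
    ∃ κ : ℝ, ∀ᵐ s ∂(volume.restrict (Icc a b)), k s = κ := by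
  have hba : 0 < b - a := sub_pos.2 hab
  set κ := (∫ s in a..b, k s) / (b - a) with hκ
  refine ⟨κ, ?_⟩
  have key : ∀ σ ∈ Icc a b, ∫ s in a..σ, k s = κ * (σ - a) := by
    intro σ hσ
    -- The test function is the indicator of `[a, σ]` minus its mean. It gives the integral of `k`
    -- up to every `σ`, and differentiation in `σ` recovers `k`.
    set χ : ℝ → ℝ := fun s => if s ≤ σ then 1 else 0 with hχ
    have hχm : Measurable χ := Measurable.ite measurableSet_Iic measurable_const measurable_const
    have hprod : ∀ f : ℝ → ℝ, IntervalIntegrable f volume a b →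
        IntervalIntegrable (fun s => f s * χ s) volume a b ∧
        ∫ s in a..b, f s * χ s = ∫ s in a..σ, f s := by
      intro f hf
      have hf1 : IntervalIntegrable f volume a σ := hf.mono_set (by
        rw [uIcc_of_le hab.le, uIcc_of_le hσ.1]; exact Icc_subset_Icc_right hσ.2)
      have e1 : ∀ s ∈ uIoc a σ, f s = f s * χ s := fun s hs => by
        rw [uIoc_of_le hσ.1] at hs
        simp only [hχ, if_pos hs.2, mul_one]
      have e2 : ∀ s ∈ uIoc σ b, 0 = f s * χ s := fun s hs => by
        rw [uIoc_of_le hσ.2] at hs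
        simp only [hχ, if_neg hs.1.not_ge, mul_zero]
      have i1 := hf1.congr e1
      have i2 : IntervalIntegrable (fun s => f s * χ s) volume σ b :=
        (intervalIntegrable_const (c := (0 : ℝ))).congr e2
      refine ⟨i1.trans i2, ?_⟩
      rw [← intervalIntegral.integral_add_adjacent_intervals i1 i2,
        ← intervalIntegral.integral_congr_ae (ae_of_all _ e1),
        ← intervalIntegral.integral_congr_ae (ae_of_all _ e2)]
      simp
    have hone := hprod (fun _ => 1) intervalIntegrable_const
    have hχi : IntervalIntegrable χ volume a b := by simpa using hone.1
    have hχv : ∫ s in a..b, χ s = σ - a := by simpa using hone.2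
    set m := (σ - a) / (b - a) with hm
    have hm0 : 0 ≤ m := div_nonneg (sub_nonneg.2 hσ.1) hba.le
    have hm1 : m ≤ 1 := (div_le_one hba).2 (by linarith [hσ.2])
    have h0 := h (fun s => χ s - m) (hχm.sub_const m) (fun s => by
      simp only [hχ]
      split_ifs <;> rw [abs_le] <;> constructor <;> linarith) (by
      rw [intervalIntegral.integral_sub hχi intervalIntegrable_const, hχv,
        intervalIntegral.integral_const, smul_eq_mul, hm]
      field_simp
      ring)
    have hkχ := hprod k hk
    simp only [mul_sub] at h0
    rw [intervalIntegral.integral_sub hkχ.1 (hk.mul_const m), hkχ.2,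
      intervalIntegral.integral_mul_const] at h0
    rw [sub_eq_zero.1 h0, hκ, hm]
    ring
  rw [← restrict_Ioo_eq_restrict_Icc, ae_restrict_iff' measurableSet_Ioo]
  filter_upwards [hk.ae_hasDerivAt_integral] with s hs hs'
  have h1 := hs (by rw [uIcc_of_le hab.le]; exact Ioo_subset_Icc_self hs') a left_mem_uIcc
  have h2 : HasDerivAt (fun σ => κ * (σ - a)) κ s := by
    simpa using ((hasDerivAt_id s).sub_const a).const_mul κ
  refine h1.unique (h2.congr_of_eventuallyEq ?_)
  filter_upwards [Icc_mem_nhds hs'.1 hs'.2] with τ hτ using key τ hτ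

/-! ### First variation and the Euler-Lagrange equation -/

namespace Problem
variable {N : ℕ} {P : Problem N}

/-- A curve that stays in an edge can be varied; this yields a bound for the value function. -/
lemma exists_variation [Nonempty (Fin N)] (hP : P.Regular) (h1 : P.H1) (h3 : P.H3)
    {a b : ℝ} (ha : 0 ≤ a) (hab : a ≤ b) (hb : b ≤ P.T) (i : Fin N) {c v : ℝ → ℝ}
    (hc : IsW P.p a b c v) (hc0 : ∀ s ∈ Icc a b, 0 < c s) {φ ψ : ℝ → ℝ} {K : ℝ}
    (hψ : Measurable ψ) (hψK : ∀ s, |ψ s| ≤ K)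
    (hφ : ∀ s ∈ Icc a b, φ s = φ a + ∫ τ in a..s, ψ τ) :
    ∃ Ψ : ℝ → ℝ, Ψ 0 = ∫ s in a..b, P.ℓ i (c s) (v s) s ∧
      HasDerivAt Ψ (∫ s in a..b, (P.partialY i (c s) (v s) s * φ s
        + P.partialA i (c s) (v s) s * ψ s)) 0 ∧
      ∀ᶠ h in 𝓝 0, P.value (point i (c a + h * φ a)) a ≤
        Ψ h + P.value (point i (c b + h * φ b)) b := by
  have hp := hP.one_lt_p
  have hS : Ioc a b ⊆ Icc 0 P.T := Ioc_subset_Icc_self.trans (Icc_subset_Icc ha hb)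
  have hψi : IntervalIntegrable ψ volume a b := by
    rw [intervalIntegrable_iff]
    exact Measure.integrableOn_of_bounded (by simp) hψ.aestronglyMeasurable (ae_of_all _ hψK)
  have hφc : ContinuousOn φ (Icc a b) := by
    have h := intervalIntegral.continuousOn_primitive_interval' hψi left_mem_uIcc
    rw [uIcc_of_le hab] at h
    exact (h.const_add (φ a)).congr hφ
  have hcc := hc.continuousOn hp
  obtain ⟨K', hK'⟩ := isCompact_Icc.exists_bound_of_continuousOn hφc
  obtain ⟨s₀, hs₀, hmin⟩ := isCompact_Icc.exists_isMinOn (nonempty_Icc.2 hab) hcc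
  obtain ⟨R, hR⟩ := isCompact_Icc.exists_bound_of_continuousOn hcc
  have hd := hP.hasDerivAt_integral_cost h3 i measurableSet_Ioc hS (r := c s₀) (R := R)
    (K := max K' K) (hc0 s₀ hs₀) (Y := c) (V := v) (φ := φ) (ψ := ψ)
    (fun s hs => (hK' s (Ioc_subset_Icc_self hs)).trans (le_max_left _ _))
    (fun s _ => (hψK s).trans (le_max_right _ _))
    ((hφc.mono Ioc_subset_Icc_self).aemeasurable measurableSet_Ioc) hψ.aemeasurable
    ((hcc.mono Ioc_subset_Icc_self).aemeasurable measurableSet_Ioc)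
    (hc.meas.aemeasurable.mono_measure (Measure.restrict_mono Ioc_subset_Icc_self le_rfl))
    (fun s hs => ⟨hmin (Ioc_subset_Icc_self hs),
      (le_abs_self _).trans (hR s (Ioc_subset_Icc_self hs))⟩)
    (hc.pow.mono_set Ioc_subset_Icc_self)
  simp only [← intervalIntegral.integral_of_le hab] at hd
  refine ⟨_, by simp, hd, ?_⟩
  -- `c s₀` is the minimum of the curve: for `h` below this radius the perturbed curve stays in the
  -- open edge.
  have hδ : 0 < c s₀ / (|K'| + 1) := div_pos (hc0 s₀ hs₀) (by positivity)
  filter_upwards [Metric.ball_mem_nhds (0 : ℝ) hδ] with h hh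
  rw [mem_ball_zero_iff, Real.norm_eq_abs, lt_div_iff₀ (by positivity)] at hh
  refine value_point_le hP h1 h3 ha hab hb i (hc.add_mul hp hψ hψK hφ h) fun s hs => ?_
  have h1 : |h * φ s| < c s₀ := by
    rw [abs_mul]
    refine lt_of_le_of_lt ?_ hh
    gcongr
    exact (hK' s hs).trans ((le_abs_self _).trans (by linarith))
  have h2 : c s₀ ≤ c s := hmin hs
  linarith [(abs_lt.1 h1).1]

/-- Euler-Lagrange: optimal curves are of class `C^1` as long as they stay in the interior of an
edge. -/
lemma exists_deriv_of_optimal [Nonempty (Fin N)] (hP : P.Regular) (h1 : P.H1) (h3 : P.H3)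
    (h4 : P.H4) {a b : ℝ} (ha : 0 ≤ a) (hab : a < b) (hb : b ≤ P.T) (i : Fin N) {c v : ℝ → ℝ}
    (hc : IsW P.p a b c v) (hc0 : ∀ s ∈ Icc a b, 0 < c s)
    (hopt : P.value (point i (c a)) a =
      (∫ s in a..b, P.ℓ i (c s) (v s) s) + P.value (point i (c b)) b) :
    ∃ w : ℝ → ℝ, ContinuousOn w (Icc a b) ∧
      (∀ᵐ s ∂(volume.restrict (Icc a b)), v s = w s) ∧
      (∀ s ∈ Icc a b, HasDerivWithinAt c (w s) (Icc a b) s) ∧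
      ∀ s ∈ Icc a b, HasDerivWithinAt (fun s => P.partialA i (c s) (w s) s)
        (P.partialY i (c s) (w s) s) (Icc a b) s := by
  have hp := hP.one_lt_p
  have hS : Icc a b ⊆ Icc 0 P.T := Icc_subset_Icc ha hb
  have hcc := hc.continuousOn hp
  obtain ⟨R, hR⟩ := isCompact_Icc.exists_bound_of_continuousOn hcc
  have hcR : ∀ s ∈ Icc a b, c s ∈ Icc 0 R := fun s hs =>
    ⟨(hc0 s hs).le, (le_abs_self _).trans (hR s hs)⟩
  have hfy := hP.integrableOn_partialY h3 i measurableSet_Icc hS (hcc.aemeasurable measurableSet_Icc)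
    hc.meas.aemeasurable hcR hc.pow
  have hfa := hP.integrableOn_partialA h3 i measurableSet_Icc hS (hcc.aemeasurable measurableSet_Icc)
    hc.meas.aemeasurable hcR hc.pow
  set fy : ℝ → ℝ := fun s => P.partialY i (c s) (v s) s with hfy_def
  set fa : ℝ → ℝ := fun s => P.partialA i (c s) (v s) s with hfa_def
  have ify : IntervalIntegrable fy volume a b :=
    (intervalIntegrable_iff_integrableOn_Ioc_of_le hab.le).2 (hfy.mono_set Ioc_subset_Icc_self)
  have ifa : IntervalIntegrable fa volume a b :=
    (intervalIntegrable_iff_integrableOn_Ioc_of_le hab.le).2 (hfa.mono_set Ioc_subset_Icc_self)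
  set Q : ℝ → ℝ := fun s => ∫ τ in a..s, fy τ with hQ
  have hQc : ContinuousOn Q (Icc a b) := by
    have := intervalIntegral.continuousOn_primitive_interval' ify left_mem_uIcc
    rwa [uIcc_of_le hab.le] at this
  have iQ : IntervalIntegrable Q volume a b :=
    ContinuousOn.intervalIntegrable (by rwa [uIcc_of_le hab.le])
  -- Variations that vanish at both ends make `0` a minimum of `Ψ`. Integrating the `∂_y` term by
  -- parts turns the first-order condition into orthogonality of `fa - Q` to all bounded `ψ` of mean
  -- zero.
  obtain ⟨κ, hκ⟩ := ae_eq_const_of_integral_mul_eq_zero hab (ifa.sub iQ) (by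
    intro ψ hψ hψ2 hψ0
    have iψ : IntervalIntegrable ψ volume a b := by
      rw [intervalIntegrable_iff]
      exact Measure.integrableOn_of_bounded (by simp) hψ.aestronglyMeasurable (ae_of_all _ hψ2)
    obtain ⟨Ψ, hΨ0, hΨd, hΨ⟩ := exists_variation hP h1 h3 ha hab.le hb i hc hc0
      (φ := fun s => ∫ τ in a..s, ψ τ) hψ hψ2 (fun s _ => by simp)
    have hmin : IsLocalMin Ψ 0 := by
      filter_upwards [hΨ] with h hh
      simp only [intervalIntegral.integral_same, mul_zero, add_zero, hψ0] at hh
      rw [hopt] at hh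
      rw [hΨ0]
      linarith
    have hz := hmin.hasDerivAt_eq_zero hΨd
    have bdd : ∀ f : ℝ → ℝ, IntervalIntegrable f volume a b →
        IntervalIntegrable (fun s => f s * ψ s) volume a b := by
      intro f hf
      rw [intervalIntegrable_iff] at hf ⊢
      exact hf.mul_bdd (c := 2) hψ.aestronglyMeasurable (ae_of_all _ hψ2)
    have hφc : ContinuousOn (fun s => ∫ τ in a..s, ψ τ) (uIcc a b) :=
      intervalIntegral.continuousOn_primitive_interval' iψ left_mem_uIcc
    rw [intervalIntegral.integral_add (ify.mul_continuousOn hφc) (bdd fa ifa)] at hz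
    have hparts := integral_primitive_mul iψ ify
    rw [hψ0, zero_mul, zero_sub] at hparts
    have e1 : ∫ s in a..b, fy s * ∫ τ in a..s, ψ τ = -∫ s in a..b, Q s * ψ s := by
      rw [show (∫ s in a..b, Q s * ψ s) = ∫ s in a..b, ψ s * Q s from by simp only [mul_comm],
        ← hparts]
      simp only [mul_comm]
    rw [e1] at hz
    simp only [sub_mul]
    rw [intervalIntegral.integral_sub (bdd fa ifa) (bdd Q iQ)]
    linarith)
  -- The velocity is known only a.e.; its continuous representative is found by inverting `∂_a ℓ_i`
  -- at the continuous momentum `κ + Q`.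
  have hex : ∀ s, ∃ u, s ∈ Icc a b → P.partialA i (c s) u s = κ + Q s := by
    intro s
    by_cases hs : s ∈ Icc a b
    · obtain ⟨u, hu⟩ := hP.exists_partialA_eq h1 h4 i (hc0 s hs).le (hS hs) (κ + Q s)
      exact ⟨u, fun _ => hu⟩
    · exact ⟨0, fun h => absurd h hs⟩
  choose w hw using hex
  have hwc : ContinuousOn w (Icc a b) :=
    hP.continuousOn_of_partialA h4 i hS hcc (continuousOn_const.add hQc)
      (fun s hs => (hc0 s hs).le) hw
  have hvw : ∀ᵐ s ∂(volume.restrict (Icc a b)), v s = w s := by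
    filter_upwards [hκ, ae_restrict_mem measurableSet_Icc] with s hs hs'
    refine (hP.strictMono_partialA h4 i (hc0 s hs').le (hS hs')).injective ?_
    change fa s = P.partialA i (c s) (w s) s
    rw [hw s hs']
    linarith
  have hprim : ∀ (f : ℝ → ℝ), ContinuousOn f (Icc a b) → ∀ s ∈ Icc a b,
      HasDerivWithinAt (fun s => ∫ τ in a..s, f τ) (f s) (Icc a b) s := by
    intro f hf s hs
    have hi : IntervalIntegrable f volume a s :=
      ContinuousOn.intervalIntegrable (by
        rw [uIcc_of_le hs.1]; exact hf.mono (Icc_subset_Icc_right hs.2))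
    have : Fact (s ∈ Icc a b) := ⟨hs⟩
    exact intervalIntegral.integral_hasDerivWithinAt_right hi
      (hf.stronglyMeasurableAtFilter_nhdsWithin measurableSet_Icc s) (hf s hs)
  have hcongr : ∀ {f g : ℝ → ℝ}, (∀ᵐ s ∂(volume.restrict (Icc a b)), f s = g s) →
      ∀ s ∈ Icc a b, ∫ τ in a..s, f τ = ∫ τ in a..s, g τ := by
    intro f g hfg s hs
    refine intervalIntegral.integral_congr_ae ?_
    filter_upwards [(ae_restrict_iff' measurableSet_Icc).1 hfg] with τ hτ hτ'
    rw [uIoc_of_le hs.1] at hτ'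
    exact hτ ⟨hτ'.1.le, hτ'.2.trans hs.2⟩
  have hyc : ContinuousOn (fun s => P.partialY i (c s) (w s) s) (Icc a b) :=
    (hP.partialY_continuous i).comp (f := fun s : ℝ => (c s, w s, s)) (by fun_prop)
      (fun s hs => ⟨(hc0 s hs).le, mem_univ _, hS hs⟩)
  refine ⟨w, hwc, hvw, fun s hs => ?_, fun s hs => ?_⟩
  · refine ((hprim w hwc s hs).const_add (c a)).congr (fun τ hτ => ?_) ?_
    · rw [hc.eq τ hτ, hcongr hvw τ hτ]
    · rw [hc.eq s hs, hcongr hvw s hs]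
  · have hQ' : ∀ τ ∈ Icc a b, P.partialA i (c τ) (w τ) τ =
        κ + ∫ σ in a..τ, P.partialY i (c σ) (w σ) σ := by
      intro τ hτ
      rw [hw τ hτ, hQ]
      congr 1
      refine hcongr ?_ τ hτ
      filter_upwards [hvw] with σ hσ
      simp only [hfy_def, hσ]
    exact ((hprim _ hyc s hs).const_add κ).congr hQ' (hQ' s hs)

/-- The Euler-Lagrange equation, integrated against an affine function. -/
lemma integral_affine_of_hasDerivWithinAt {a b : ℝ} (hab : a ≤ b) {M m : ℝ → ℝ}
    (hm : ContinuousOn m (Icc a b)) (hM : ∀ s ∈ Icc a b, HasDerivWithinAt M (m s) (Icc a b) s)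
    (α β : ℝ) :
    ∫ s in a..b, (m s * (α + β * (s - a)) + M s * β) = M b * (α + β * (b - a)) - M a * α := by
  have hMc : ContinuousOn M (Icc a b) := fun s hs => (hM s hs).continuousWithinAt
  rw [intervalIntegral.integral_eq_sub_of_hasDerivAt_of_le hab
    (f := fun s => M s * (α + β * (s - a)))]
  · simp
  · exact hMc.mul (by fun_prop)
  · intro s hs
    have e := (hM s (Ioo_subset_Icc_self hs)).hasDerivAt (Icc_mem_nhds hs.1 hs.2)
    have e2 : HasDerivAt (fun s => α + β * (s - a)) β s := by
      simpa using (((hasDerivAt_id s).sub_const a).const_mul β).const_add α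
    exact e.mul e2
  · refine ContinuousOn.intervalIntegrable ?_
    rw [uIcc_of_le hab]
    exact (hm.mul (by fun_prop)).add (hMc.mul continuousOn_const)

end Problem

/-- Near `x`, `u - L` lies between `0` and `U - L`, which is `o(r - x)`. -/
lemma hasDerivAt_of_squeeze {u L U : ℝ → ℝ} {x D : ℝ} (hL : HasDerivAt L D x)
    (hU : HasDerivAt U D x) (hLx : L x = u x) (hUx : U x = u x) (hLu : ∀ᶠ r in 𝓝 x, L r ≤ u r)
    (huU : ∀ᶠ r in 𝓝 x, u r ≤ U r) : HasDerivAt u D x := by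
  have h := hU.sub hL
  rw [sub_self, hasDerivAt_iff_isLittleO] at h
  have h' : HasDerivAt (fun r => u r - L r) 0 x := by
    rw [hasDerivAt_iff_isLittleO]
    refine Asymptotics.IsBigO.trans_isLittleO (Asymptotics.IsBigO.of_bound 1 ?_) h
    filter_upwards [hLu, huU] with r h1 h2
    simp only [Pi.sub_apply, hLx, hUx, sub_self, sub_zero, smul_zero, one_mul, Real.norm_eq_abs]
    rw [abs_of_nonneg (by linarith), abs_of_nonneg (by linarith)]
    linarith
  have e : (fun r => u r - L r) + L = u := by ext r; simp
  have h2 := h'.add hL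
  rwa [e, zero_add] at h2

/-! ### The Hamiltonian, and functions touching the value function -/

namespace Problem
variable {N : ℕ} {P : Problem N}

/-- The tangent inequality at `a` says precisely that `a` maximises in the Legendre transform. It
also bounds the family above, so that the real supremum is not a default value. -/
lemma Regular.hamiltonian_eq (hP : P.Regular) (h4 : P.H4) (i : Fin N) {x t : ℝ} (hx : 0 ≤ x)
    (ht : t ∈ Icc 0 P.T) {a q : ℝ} (ha : P.partialA i x a t = -q) :
    P.hamiltonian i x q t = -q * a - P.ℓ i x a t ∧
      ∀ b, -q * b - P.ℓ i x b t ≤ P.hamiltonian i x q t := by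
  have hle : ∀ b, -q * b - P.ℓ i x b t ≤ -q * a - P.ℓ i x a t := by
    intro b
    have := hP.convex_le h4 i hx ht a b
    rw [ha] at this
    linarith
  have he : P.hamiltonian i x q t = -q * a - P.ℓ i x a t :=
    le_antisymm (ciSup_le hle) (le_ciSup (f := fun b => -q * b - P.ℓ i x b t)
      ⟨_, by rintro _ ⟨b, rfl⟩; exact hle b⟩ a)
  exact ⟨he, fun b => he ▸ hle b⟩

/-- Using each of the two maximisers as a competitor for the other momentum traps the error of the
linear expansion between `0` and `|q' - q|` times the distance of the maximisers. That distance
tends to `0`, since an increasing bijection of `ℝ` is a homeomorphism. -/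
lemma Regular.hasDerivAt_hamiltonian (hP : P.Regular) (h1 : P.H1) (h4 : P.H4) (i : Fin N)
    {x t : ℝ} (hx : 0 ≤ x) (ht : t ∈ Icc 0 P.T) {a q : ℝ} (ha : P.partialA i x a t = -q) :
    HasDerivAt (fun q => P.hamiltonian i x q t) (-a) q := by
  set e := (hP.strictMono_partialA h4 i hx ht).orderIsoOfSurjective _
    (fun m => hP.exists_partialA_eq h1 h4 i hx ht m)
  have he : ∀ q', P.partialA i x (e.symm (-q')) t = -q' := fun q' => e.apply_symm_apply (-q')
  have hea : e.symm (-q) = a :=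
    (hP.strictMono_partialA h4 i hx ht).injective ((he q).trans ha.symm)
  have hc : Tendsto (fun q' => e.symm (-q')) (𝓝 q) (𝓝 a) := by
    have := (e.symm.continuous.comp continuous_neg).tendsto q
    simpa [Function.comp_def, hea] using this
  rw [hasDerivAt_iff_isLittleO, Asymptotics.isLittleO_iff]
  intro ε hε
  filter_upwards [hc (Metric.ball_mem_nhds a hε)] with q' hq'
  rw [mem_preimage, Metric.mem_ball, Real.dist_eq] at hq'
  obtain ⟨e1, g1⟩ := hP.hamiltonian_eq h4 i hx ht ha
  obtain ⟨e2, g2⟩ := hP.hamiltonian_eq h4 i hx ht (he q')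
  have g1' := g1 (e.symm (-q'))
  have g2' := g2 a
  rw [Real.norm_eq_abs, Real.norm_eq_abs, smul_eq_mul]
  have l1 : 0 ≤ P.hamiltonian i x q' t - P.hamiltonian i x q t - (q' - q) * -a := by
    rw [e1]; linarith
  have l2 : P.hamiltonian i x q' t - P.hamiltonian i x q t - (q' - q) * -a ≤
      -(q' - q) * (e.symm (-q') - a) := by
    rw [e2]; linarith
  rw [abs_of_nonneg l1]
  refine l2.trans ((le_abs_self _).trans ?_)
  rw [abs_mul, abs_neg, mul_comm]
  exact mul_le_mul_of_nonneg_right hq'.le (abs_nonneg _)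

/-- The data given by the Euler-Lagrange equation for an optimal trajectory that stays in the
interior of `J_i` on `[a, b]`. -/
lemma exists_deriv_of_optimal_trajectory [Nonempty (Fin N)] (hP : P.Regular) (h1 : P.H1)
    (h3 : P.H3) (h4 : P.H4) {a b : ℝ} (ha : 0 ≤ a) (hab : a < b) (hb : b ≤ P.T) {i : Fin N}
    {x : EuclideanSpace ℝ (Fin N)} {y : ℝ → EuclideanSpace ℝ (Fin N)} (hy : y ∈ P.optimal a x)
    (hpos : ∀ s ∈ Icc a b, 0 < y s i) :
    ∃ w : ℝ → ℝ, ContinuousOn w (Icc a b) ∧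
      (∀ᵐ s ∂(volume.restrict (Icc a b)), deriv y s i = w s) ∧
      (∀ s ∈ Icc a b, HasDerivWithinAt (fun s => y s i) (w s) (Icc a b) s) ∧
      (∀ s ∈ Icc a b, HasDerivWithinAt (fun s => P.partialA i (y s i) (w s) s)
        (P.partialY i (y s i) (w s) s) (Icc a b) s) ∧
      IsW P.p a b (fun s => y s i) w ∧
      P.value (point i (y a i)) a =
        (∫ s in a..b, P.ℓ i (y s i) (w s) s) + P.value (point i (y b i)) b := by
  have hp := optimal_isPath hP hy
  have ham : a ∈ Icc a P.T := ⟨le_rfl, hab.le.trans hb⟩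
  have hbm : b ∈ Icc a P.T := ⟨hab.le, hb⟩
  have hpab := hp.restrict hP ham hbm
  have hsplit := optimal_split hP h1 h3 ha hab.le hb hy
  rw [hpab.integral_runningCost_eq hab.le hpos, ← hy.1.2.2,
    eq_point_of_pos (hp.mem a ham) (hpos a ⟨le_rfl, hab.le⟩),
    eq_point_of_pos (hp.mem b hbm) (hpos b ⟨hab.le, le_rfl⟩)] at hsplit
  obtain ⟨w, hw, hvw, hd, hM⟩ :=
    exists_deriv_of_optimal hP h1 h3 h4 ha hab hb i (hpab.coord i) hpos hsplit
  refine ⟨w, hw, hvw, hd, hM, (hpab.coord i).congr (fun _ _ => rfl)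
    (hvw.mono fun s hs => hs.symm), hsplit.trans ?_⟩
  congr 1
  refine intervalIntegral.integral_congr_ae ?_
  filter_upwards [(ae_restrict_iff' measurableSet_Icc).1 hvw] with τ hτ hτ'
  rw [uIoc_of_le hab.le] at hτ'
  rw [hτ (Ioc_subset_Icc_self hτ')]

lemma continuousOn_partialY_comp (hP : P.Regular) {a b : ℝ} (ha : 0 ≤ a) (hb : b ≤ P.T)
    (i : Fin N) {c w : ℝ → ℝ} (hc : ContinuousOn c (Icc a b)) (hw : ContinuousOn w (Icc a b))
    (hc0 : ∀ s ∈ Icc a b, 0 < c s) :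
    ContinuousOn (fun s => P.partialY i (c s) (w s) s) (Icc a b) :=
  (hP.partialY_continuous i).comp (f := fun s : ℝ => (c s, w s, s)) (by fun_prop)
    (fun s hs => ⟨(hc0 s hs).le, mem_univ _, ha.trans hs.1, hs.2.trans hb⟩)

/-- The value function is touched from above at the starting point of an optimal trajectory. -/
lemma exists_upper_touch [Nonempty (Fin N)] (hP : P.Regular) (h1 : P.H1) (h3 : P.H3) (h4 : P.H4)
    {a b : ℝ} (ha : 0 ≤ a) (hab : a < b) (hb : b ≤ P.T) {i : Fin N}
    {x : EuclideanSpace ℝ (Fin N)} {y : ℝ → EuclideanSpace ℝ (Fin N)} (hy : y ∈ P.optimal a x)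
    (hpos : ∀ s ∈ Icc a b, 0 < y s i) :
    ∃ (v : ℝ) (U : ℝ → ℝ), HasDerivWithinAt (fun s => y s i) v (Icc a b) a ∧
      U (y a i) = P.value (point i (y a i)) a ∧
      HasDerivAt U (-P.partialA i (y a i) v a) (y a i) ∧
      ∀ᶠ r in 𝓝 (y a i), P.value (point i r) a ≤ U r := by
  obtain ⟨w, hw, -, hd, hM, hW, hval⟩ :=
    exists_deriv_of_optimal_trajectory hP h1 h3 h4 ha hab hb hy hpos
  set c : ℝ → ℝ := fun s => y s i with hc
  have hcc := hW.continuousOn hP.one_lt_p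
  have hba : b - a ≠ 0 := (sub_pos.2 hab).ne'
  -- The affine weight is `1` at `a` and `0` at `b`: the start moves while the end is fixed, and
  -- only the boundary term at `a` survives.
  obtain ⟨Ψ, hΨ0, hΨd, hΨ⟩ := exists_variation hP h1 h3 ha hab.le hb i hW hpos
    (φ := fun s => 1 + (-(b - a)⁻¹) * (s - a)) (ψ := fun _ => -(b - a)⁻¹)
    measurable_const (fun _ => le_rfl) (fun s _ => by simp; ring)
  rw [integral_affine_of_hasDerivWithinAt hab.le
    (continuousOn_partialY_comp hP ha hb i hcc hw hpos) hM] at hΨd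
  have e0 : 1 + -(b - a)⁻¹ * (b - a) = 0 := by rw [neg_mul, inv_mul_cancel₀ hba]; ring
  simp only [e0, mul_zero, zero_sub, mul_one, sub_self, add_zero] at hΨd hΨ
  refine ⟨w a, fun r => Ψ (r - c a) + P.value (point i (c b)) b, hd a ⟨le_rfl, hab.le⟩, ?_, ?_, ?_⟩
  · change Ψ (c a - c a) + _ = _
    rw [sub_self, hΨ0, hval]
  · have h2 : HasDerivAt (fun r => r - c a) 1 (c a) := (hasDerivAt_id _).sub_const _
    have h3 : HasDerivAt Ψ (-P.partialA i (c a) (w a) a) (c a - c a) := by rw [sub_self]; exact hΨd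
    have h5 := (HasDerivAt.comp (h := fun r => r - c a) (c a) h3 h2).add_const
      (P.value (point i (c b)) b)
    rwa [mul_one] at h5
  · have h2 : Tendsto (fun r => r - c a) (𝓝 (c a)) (𝓝 0) := by
      have : Continuous fun r => r - c a := by fun_prop
      simpa using this.tendsto (c a)
    filter_upwards [h2.eventually hΨ] with r hr
    simpa using hr

/-- The value function is touched from below at later points of an optimal trajectory. -/
lemma exists_lower_touch [Nonempty (Fin N)] (hP : P.Regular) (h1 : P.H1) (h3 : P.H3) (h4 : P.H4)
    {a b : ℝ} (ha : 0 ≤ a) (hab : a < b) (hb : b ≤ P.T) {i : Fin N}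
    {x : EuclideanSpace ℝ (Fin N)} {y : ℝ → EuclideanSpace ℝ (Fin N)} (hy : y ∈ P.optimal a x)
    (hpos : ∀ s ∈ Icc a b, 0 < y s i) :
    ∃ (v : ℝ) (L : ℝ → ℝ), HasDerivWithinAt (fun s => y s i) v (Icc a b) b ∧
      L (y b i) = P.value (point i (y b i)) b ∧
      HasDerivAt L (-P.partialA i (y b i) v b) (y b i) ∧
      ∀ᶠ r in 𝓝 (y b i), L r ≤ P.value (point i r) b := by
  obtain ⟨w, hw, -, hd, hM, hW, hval⟩ :=
    exists_deriv_of_optimal_trajectory hP h1 h3 h4 ha hab hb hy hpos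
  set c : ℝ → ℝ := fun s => y s i with hc
  have hcc := hW.continuousOn hP.one_lt_p
  have hba : b - a ≠ 0 := (sub_pos.2 hab).ne'
  -- The opposite weight: the start, hence the value at `a`, is fixed, so the inequality bounds the
  -- value at time `b` from below.
  obtain ⟨Ψ, hΨ0, hΨd, hΨ⟩ := exists_variation hP h1 h3 ha hab.le hb i hW hpos
    (φ := fun s => 0 + (b - a)⁻¹ * (s - a)) (ψ := fun _ => (b - a)⁻¹)
    measurable_const (fun _ => le_rfl) (fun s _ => by simp; ring)
  rw [integral_affine_of_hasDerivWithinAt hab.le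
    (continuousOn_partialY_comp hP ha hb i hcc hw hpos) hM] at hΨd
  have e0 : 0 + (b - a)⁻¹ * (b - a) = 1 := by rw [inv_mul_cancel₀ hba]; ring
  simp only [e0, mul_zero, sub_zero, mul_one, sub_self, add_zero] at hΨd hΨ
  refine ⟨w b, fun r => P.value (point i (c a)) a - Ψ (r - c b), hd b ⟨hab.le, le_rfl⟩, ?_, ?_, ?_⟩
  · change P.value (point i (c a)) a - Ψ (c b - c b) = _
    rw [sub_self, hΨ0, hval]
    ring
  · have h2 : HasDerivAt (fun r => r - c b) 1 (c b) := (hasDerivAt_id _).sub_const _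
    have h3 : HasDerivAt Ψ (P.partialA i (c b) (w b) b) (c b - c b) := by rw [sub_self]; exact hΨd
    have h5 := (HasDerivAt.comp (h := fun r => r - c b) (c b) h3 h2).const_sub
      (P.value (point i (c a)) a)
    rwa [mul_one] at h5
  · have h2 : Tendsto (fun r => r - c b) (𝓝 (c b)) (𝓝 0) := by
      have : Continuous fun r => r - c b := by fun_prop
      simpa using this.tendsto (c b)
    filter_upwards [h2.eventually hΨ] with r hr
    have e : c b + (r - c b) = r := by ring
    rw [e] at hr
    linarith

/-! ### Behaviour before the vertex is reached -/

lemma IsPath.continuousOn_coord (hP : P.Regular) {a b : ℝ} {y : ℝ → EuclideanSpace ℝ (Fin N)}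
    (h : P.IsPath a b y) (j : Fin N) : ContinuousOn (fun s => y s j) (Icc a b) :=
  (h.coord j).continuousOn hP.one_lt_p

/-- A trajectory that starts in the interior of an edge stays there until it reaches the vertex. -/
lemma IsPath.pos_of_ne_zero (hP : P.Regular) {a b : ℝ} {y : ℝ → EuclideanSpace ℝ (Fin N)}
    (h : P.IsPath a b y) {i : Fin N} (hya : 0 < y a i) (hne : ∀ s ∈ Icc a b, y s ≠ 0) :
    ∀ s ∈ Icc a b, 0 < y s i := by
  intro s hs
  by_contra hcon
  have hsi : y s i = 0 := le_antisymm (not_lt.1 hcon) (nonneg_of_mem_junction (h.mem s hs) i)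
  have hci := h.continuousOn_coord hP i
  have hclosed : IsCompact (Icc a b ∩ (fun s => y s i) ⁻¹' {0}) :=
    isCompact_Icc.of_isClosed_subset
      (hci.preimage_isClosed_of_isClosed isClosed_Icc isClosed_singleton) inter_subset_left
  -- At the first zero of coordinate `i` the other coordinates vanish too, being limits of zeros
  -- from the left; so the vertex is reached.
  obtain ⟨σ, ⟨hσ, hσ0⟩, hmin⟩ := hclosed.exists_isLeast ⟨s, hs, hsi⟩
  have hσ0' : y σ i = 0 := hσ0
  have haσ : a < σ := lt_of_le_of_ne hσ.1 (by rintro rfl; exact hya.ne' hσ0')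
  have hbefore : ∀ τ ∈ Ico a σ, 0 < y τ i := by
    intro τ hτ
    have hτm : τ ∈ Icc a b := ⟨hτ.1, hτ.2.le.trans hσ.2⟩
    refine lt_of_le_of_ne (nonneg_of_mem_junction (h.mem τ hτm) i) fun h0 => ?_
    exact absurd (hmin ⟨hτm, h0.symm⟩) (not_le.2 hτ.2)
  refine hne σ hσ ?_
  ext j
  by_cases hj : j = i
  · rw [hj, hσ0']; rfl
  · have hcj : ContinuousWithinAt (fun s => y s j) (Ico a σ) σ :=
      (h.continuousOn_coord hP j σ hσ).mono fun τ hτ => ⟨hτ.1, hτ.2.le.trans hσ.2⟩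
    have hz : Tendsto (fun s => y s j) (𝓝[Ico a σ] σ) (𝓝 0) := by
      refine tendsto_const_nhds.congr' ?_
      filter_upwards [self_mem_nhdsWithin] with τ hτ
      rw [eq_point_of_pos (h.mem τ ⟨hτ.1, hτ.2.le.trans hσ.2⟩) (hbefore τ hτ), point_apply, if_neg hj]
    have : (𝓝[Ico a σ] σ).NeBot := by
      rw [← mem_closure_iff_nhdsWithin_neBot, closure_Ico haσ.ne]
      exact ⟨haσ.le, le_rfl⟩
    exact tendsto_nhds_unique hcj hz

lemma ne_zero_of_lt_hittingTime {t s : ℝ} {y : ℝ → EuclideanSpace ℝ (Fin N)} (htT : t ≤ P.T)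
    (hs : s ∈ Ico t (P.hittingTime t y)) : y s ≠ 0 ∧ s < P.T := by
  have hbdd : BddBelow (insert P.T {τ | τ ∈ Icc t P.T ∧ y τ = 0}) := by
    refine ⟨t, ?_⟩
    rintro τ (rfl | hτ)
    · exact htT
    · exact hτ.1.1
  have hsT : s < P.T := hs.2.trans_le (csInf_le hbdd (mem_insert _ _))
  refine ⟨fun h0 => ?_, hsT⟩
  exact absurd (csInf_le hbdd (mem_insert_of_mem _ ⟨⟨hs.1, hsT.le⟩, h0⟩)) (not_le.2 hs.2)

/-- A trajectory that starts in the interior of an edge stays there for some time. -/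
lemma IsPath.exists_pos (hP : P.Regular) {a b : ℝ} (hab : a < b)
    {y : ℝ → EuclideanSpace ℝ (Fin N)} (h : P.IsPath a b y) {i : Fin N} (hya : 0 < y a i) :
    ∃ d, a < d ∧ d ≤ b ∧ ∀ s ∈ Icc a d, 0 < y s i := by
  have hc := h.continuousOn_coord hP i a ⟨le_rfl, hab.le⟩
  have := hc.eventually_const_lt hya
  rw [nhdsWithin_Icc_eq_nhdsGE hab] at this
  obtain ⟨d, had, hd⟩ := mem_nhdsGE_iff_exists_Icc_subset.1 this
  exact ⟨min d b, lt_min had hab, min_le_right _ _,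
    fun s hs => hd ⟨hs.1, hs.2.trans (min_le_left _ _)⟩⟩

lemma hasDerivWithinAt_Icc_right {f : ℝ → ℝ} {a b d v : ℝ} (hab : a < b) (hbd : b ≤ d)
    (h : HasDerivWithinAt f v (Icc a b) a) : HasDerivWithinAt f v (Icc a d) a := by
  refine h.mono_of_mem_nhdsWithin ?_
  rw [nhdsWithin_Icc_eq_nhdsGE (hab.trans_le hbd)]
  exact Icc_mem_nhdsGE hab

lemma unique_right_deriv {f : ℝ → ℝ} {a b v v' : ℝ} (hab : a < b)
    (h : HasDerivWithinAt f v (Icc a b) a) (h' : HasDerivWithinAt f v' (Icc a b) a) : v = v' :=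
  (uniqueDiffOn_Icc hab a ⟨le_rfl, hab.le⟩).eq_deriv _ h h'

lemma unique_left_deriv {f : ℝ → ℝ} {a b v v' : ℝ} (hab : a < b)
    (h : HasDerivWithinAt f v (Icc a b) b) (h' : HasDerivWithinAt f v' (Icc a b) b) : v = v' :=
  (uniqueDiffOn_Icc hab b ⟨hab.le, le_rfl⟩).eq_deriv _ h h'

/-! ### Optimal initial velocities -/

/-- Optimal trajectories have initial velocities, which yield upper bounds for the value
function. -/
lemma exists_initialVelocity [Nonempty (Fin N)] (hP : P.Regular) (h1 : P.H1) (h3 : P.H3)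
    (h4 : P.H4) {s : ℝ} (hs : s ∈ Ico 0 P.T) {i : Fin N} {r : ℝ} (hr : 0 < r)
    {z : ℝ → EuclideanSpace ℝ (Fin N)} (hz : z ∈ P.optimal s (point i r)) :
    ∃ (v : ℝ) (U : ℝ → ℝ), HasDerivWithinAt (fun s => z s i) v (Icc s P.T) s ∧
      U r = P.value (point i r) s ∧ HasDerivAt U (-P.partialA i r v s) r ∧
      ∀ᶠ r' in 𝓝 r, P.value (point i r') s ≤ U r' := by
  have hzs : z s i = r := by rw [hz.1.2.2, point_apply_self]
  obtain ⟨d, hsd, hdT, hd⟩ := (optimal_isPath hP hz).exists_pos hP hs.2 (i := i) (by rwa [hzs])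
  obtain ⟨v, U, hv, hU⟩ := exists_upper_touch hP h1 h3 h4 hs.1 hsd hdT hz hd
  rw [hzs] at hU
  exact ⟨v, U, hasDerivWithinAt_Icc_right hsd hdT hv, hU⟩

/-- The upper touching function minus `u` has a local minimum at `r`, so the two slopes agree. -/
lemma partialA_eq_of_mem_initialVelocities [Nonempty (Fin N)] (hP : P.Regular) (h1 : P.H1)
    (h3 : P.H3) (h4 : P.H4) {s : ℝ} (hs : s ∈ Ico 0 P.T) {i : Fin N} {r : ℝ} (hr : 0 < r)
    {q a : ℝ} (hq : HasDerivAt (fun r => P.value (point i r) s) q r)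
    (ha : a ∈ P.initialVelocities i (point i r) s) : P.partialA i r a s = -q := by
  obtain ⟨z, hz, hza⟩ := ha
  obtain ⟨v, U, hv, hU0, hUd, hU⟩ := exists_initialVelocity hP h1 h3 h4 hs hr hz
  obtain rfl := unique_right_deriv hs.2 hza hv
  have hmin : IsLocalMin (fun r => U r - P.value (point i r) s) r := by
    filter_upwards [hU] with r' hr'
    rw [hU0, sub_self]
    linarith
  have := hmin.hasDerivAt_eq_zero (hUd.sub hq)
  linarith

/-- Every optimal velocity solves an equation that is injective in `a`; the given optimal trajectory
shows that its unique solution is attained. -/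
lemma initialVelocities_eq_preimage [Nonempty (Fin N)] (hP : P.Regular) (h1 : P.H1)
    (h3 : P.H3) (h4 : P.H4) {s : ℝ} (hs : s ∈ Ico 0 P.T) {i : Fin N} {r : ℝ} (hr : 0 < r)
    {z : ℝ → EuclideanSpace ℝ (Fin N)} (hz : z ∈ P.optimal s (point i r))
    {q : ℝ} (hq : HasDerivAt (fun r => P.value (point i r) s) q r) :
    ∃ a, P.initialVelocities i (point i r) s = {a} ∧
      P.initialVelocities i (point i r) s = (fun a => P.partialA i r a s) ⁻¹' {-q} ∧
      P.partialA i r a s = -q := by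
  have hsT : s ∈ Icc 0 P.T := Ico_subset_Icc_self hs
  obtain ⟨a, -, ha, -⟩ := exists_initialVelocity hP h1 h3 h4 hs hr hz
  have ha' : a ∈ P.initialVelocities i (point i r) s := ⟨z, hz, ha⟩
  have haq := partialA_eq_of_mem_initialVelocities hP h1 h3 h4 hs hr hq ha'
  have hinj := (hP.strictMono_partialA h4 i hr.le hsT).injective
  refine ⟨a, ?_, ?_, haq⟩
  · refine eq_singleton_iff_unique_mem.2 ⟨ha', fun b hb => hinj ?_⟩
    exact (partialA_eq_of_mem_initialVelocities hP h1 h3 h4 hs hr hq hb).trans haq.symm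
  · ext b
    refine ⟨fun hb => partialA_eq_of_mem_initialVelocities hP h1 h3 h4 hs hr hq hb, fun hb => ?_⟩
    rwa [hinj (show P.partialA i r b s = P.partialA i r a s from Eq.trans hb haq.symm)]

/-- At an interior time, an optimal trajectory is differentiable, there is only one optimal
velocity, and the value function is differentiable. -/
lemma interior_time [Nonempty (Fin N)] (hP : P.Regular) (h1 : P.H1) (h3 : P.H3) (h4 : P.H4)
    {t s b : ℝ} (ht : 0 ≤ t) (hts : t < s) (hsb : s < b) (hb : b ≤ P.T) {i : Fin N}
    {x : EuclideanSpace ℝ (Fin N)} {y : ℝ → EuclideanSpace ℝ (Fin N)} (hy : y ∈ P.optimal t x)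
    (hpos : ∀ τ ∈ Icc t b, 0 < y τ i) :
    ∃ a, P.initialVelocities i (y s) s = {a} ∧ HasDerivAt (fun τ => y τ i) a s ∧
      HasDerivAt (fun r => P.value (point i r) s) (-P.partialA i (y s i) a s) (y s i) := by
  have hsT : s < P.T := hsb.trans_le hb
  have hp := optimal_isPath hP hy
  have hys := optimal_restrict hP h1 h3 ht hts.le hsT.le hy
  obtain ⟨w, -, -, hd, -⟩ :=
    exists_deriv_of_optimal_trajectory hP h1 h3 h4 ht (hts.trans hsb) hb hy hpos
  have hds := hd s ⟨hts.le, hsb.le⟩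
  have hds' := hds.hasDerivAt (Icc_mem_nhds hts hsb)
  refine ⟨w s, ?_, hds', ?_⟩
  · refine eq_singleton_iff_unique_mem.2 ⟨⟨y, hys, hds'.hasDerivWithinAt⟩, ?_⟩
    rintro a ⟨z, hz, hza⟩
    have hzs : z s = y s := hz.1.2.2
    obtain ⟨d, hsd, hdT, hdpos⟩ := (optimal_isPath hP hz).exists_pos hP hsT (i := i)
      (by rw [hzs]; exact hpos s ⟨hts.le, hsb.le⟩)
    -- Following `y` up to `s` and then `z` is optimal from time `t`, hence `C^1` across `s`: its
    -- right velocity, that of `z`, equals its left velocity, that of `y`.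
    obtain ⟨w', -, -, hd', -⟩ := exists_deriv_of_optimal_trajectory hP h1 h3 h4 ht
      (hts.trans hsd) hdT (optimal_concat hP h1 h3 ht hts.le hsT.le hy hz) (i := i) (by
        intro τ hτ
        rcases le_total τ s with h | h
        · rw [concat_of_le _ _ h]; exact hpos τ ⟨hτ.1, h.trans hsb.le⟩
        · rw [concat_of_ge hzs.symm h]; exact hdpos τ ⟨h, hτ.2⟩)
    have hc := hd' s ⟨hts.le, hsd.le⟩
    have e1 : w' s = w s := by
      refine unique_left_deriv hts ?_ (hds.mono (Icc_subset_Icc_right hsb.le))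
      refine (hc.mono (Icc_subset_Icc_right hsd.le)).congr (fun τ hτ => ?_) ?_
      · rw [concat_of_le _ _ hτ.2]
      · rw [concat_of_le _ _ le_rfl]
    have e2 : w' s = a := by
      refine unique_right_deriv hsd ?_ (hza.mono (Icc_subset_Icc_right hdT))
      refine (hc.mono (Icc_subset_Icc_left hts.le)).congr (fun τ hτ => ?_) ?_
      · rw [concat_of_ge hzs.symm hτ.1]
      · rw [concat_of_ge hzs.symm le_rfl]
    rw [← e1, e2]
  -- As `y` is differentiable at `s`, its one-sided velocities agree, and so do the slopes of the
  -- upper and lower touching functions.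
  · obtain ⟨v, U, hv, hU0, hUd, hU⟩ := exists_upper_touch hP h1 h3 h4 (ht.trans hts.le) hsb hb hys
      (fun τ hτ => hpos τ ⟨hts.le.trans hτ.1, hτ.2⟩)
    obtain ⟨v', L, hv', hL0, hLd, hL⟩ := exists_lower_touch hP h1 h3 h4 ht hts hsT.le hy
      (fun τ hτ => hpos τ ⟨hτ.1, hτ.2.trans hsb.le⟩)
    obtain rfl := unique_right_deriv hsb hv hds'.hasDerivWithinAt
    obtain rfl := unique_left_deriv hts hv' hds'.hasDerivWithinAt
    exact hasDerivAt_of_squeeze hLd hUd hL0 hU0 hL hU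

end Problem

/-! ### Compactness in scalar `W^{1,p}` -/

section ScalarCompactness
variable {p a b K : ℝ}

lemma uIoc_subset_Icc' {s τ : ℝ} (hτ : τ ∈ Icc a b) (hs : s ∈ Icc a b) : uIoc τ s ⊆ Icc a b :=
  uIoc_subset_uIcc.trans ((convex_Icc a b).ordConnected.uIcc_subset hτ hs)

/-- Integrated Young inequality: for small `lam` it is a modulus of continuity that depends only on
a bound for the energy. -/
lemma IsW.abs_sub_le (hp : 1 < p) {c v : ℝ → ℝ} (h : IsW p a b c v) {lam C : ℝ}
    (hC : ∀ x : ℝ, |x| ≤ lam * |x| ^ p + C) {τ s : ℝ} (hτ : τ ∈ Icc a b) (hs : s ∈ Icc a b) :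
    |c s - c τ| ≤ lam * (∫ σ in uIoc τ s, |v σ| ^ p) + C * |s - τ| := by
  have hsub := uIoc_subset_Icc' hτ hs
  have hvol : volume (uIoc τ s) ≠ ⊤ := by simp
  have hpow := h.pow.mono_set hsub
  rw [h.sub_eq hp hτ hs]
  rw [← Real.norm_eq_abs]
  calc ‖∫ σ in τ..s, v σ‖ ≤ ∫ σ in uIoc τ s, ‖v σ‖ :=
        intervalIntegral.norm_integral_le_integral_norm_uIoc
    _ ≤ ∫ σ in uIoc τ s, (lam * |v σ| ^ p + C) :=
        integral_mono ((h.integrableOn hp).mono_set hsub).norm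
          ((hpow.const_mul lam).add (integrableOn_const hvol)) (fun σ => hC (v σ))
    _ = _ := by
        rw [integral_add (hpow.const_mul lam) (integrableOn_const hvol), integral_const_mul]
        congr 1
        simp [measureReal_def, mul_comm]

/-- Over disjoint intervals the energy terms of `IsW.abs_sub_le` sum to at most `lam * K`, and the
others to `C` times the total length. Both bounds are uniform in `n`, so they survive in the
pointwise limit. -/
lemma absolutelyContinuous_of_tendsto (hp : 1 < p) (hab : a ≤ b) {c v : ℕ → ℝ → ℝ}
    (h : ∀ n, IsW p a b (c n) (v n)) (hK : ∀ n, ∫ s in Icc a b, |v n s| ^ p ≤ K) {c₀ : ℝ → ℝ}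
    (hc : ∀ s ∈ Icc a b, Tendsto (fun n => c n s) atTop (𝓝 (c₀ s))) :
    AbsolutelyContinuousOnInterval c₀ a b := by
  have hK0 : 0 ≤ K := (integral_nonneg fun s => by positivity).trans (hK 0)
  rw [absolutelyContinuousOnInterval_iff]
  intro ε hε
  obtain ⟨C, hC0, hC⟩ := exists_le_mul_rpow_add hp (lam := ε / (4 * (K + 1))) (by positivity)
  refine ⟨ε / (4 * (C + 1)), by positivity, fun E hE hlen => ?_⟩
  obtain ⟨hmem, hdisj⟩ := hE
  rw [uIcc_of_le hab] at hmem
  have hbound : ∀ n, ∑ i ∈ Finset.range E.1, dist (c n (E.2 i).1) (c n (E.2 i).2) ≤ ε / 2 := by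
    intro n
    have hsub : ∀ i ∈ Finset.range E.1, uIoc (E.2 i).1 (E.2 i).2 ⊆ Icc a b := fun i hi =>
      uIoc_subset_Icc' (hmem i hi).1 (hmem i hi).2
    have e1 : ∑ i ∈ Finset.range E.1, ∫ σ in uIoc (E.2 i).1 (E.2 i).2, |v n σ| ^ p ≤ K := by
      rw [← integral_biUnion_finset _ (fun i _ => measurableSet_uIoc) hdisj
        (fun i hi => (h n).pow.mono_set (hsub i hi))]
      refine (setIntegral_mono_set (h n).pow (ae_of_all _ fun s => by positivity)
        (LE.le.eventuallyLE (iUnion₂_subset hsub))).trans (hK n)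
    calc ∑ i ∈ Finset.range E.1, dist (c n (E.2 i).1) (c n (E.2 i).2)
        ≤ ∑ i ∈ Finset.range E.1, (ε / (4 * (K + 1)) *
            (∫ σ in uIoc (E.2 i).1 (E.2 i).2, |v n σ| ^ p) + C * dist (E.2 i).1 (E.2 i).2) := by
          refine Finset.sum_le_sum fun i hi => ?_
          rw [dist_comm, Real.dist_eq, dist_comm (E.2 i).1, Real.dist_eq]
          exact (h n).abs_sub_le hp hC (hmem i hi).1 (hmem i hi).2
      _ = ε / (4 * (K + 1)) * (∑ i ∈ Finset.range E.1,
            ∫ σ in uIoc (E.2 i).1 (E.2 i).2, |v n σ| ^ p)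
            + C * ∑ i ∈ Finset.range E.1, dist (E.2 i).1 (E.2 i).2 := by
          rw [Finset.sum_add_distrib, Finset.mul_sum, Finset.mul_sum]
      _ ≤ ε / (4 * (K + 1)) * (K + 1) + (C + 1) * (ε / (4 * (C + 1))) := by
          gcongr <;> linarith
      _ = ε / 2 := by field_simp; ring
  have hlim := tendsto_finsetSum (Finset.range E.1) fun i hi =>
    (hc _ (hmem i hi).1).dist (hc _ (hmem i hi).2)
  have := le_of_tendsto' hlim hbound
  linarith

/-- Bounded sets of `W^{1,p}` are closed under uniform convergence. -/
lemma exists_isW_of_tendsto (hp : 1 < p) (hab : a ≤ b) {c v : ℕ → ℝ → ℝ}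
    (h : ∀ n, IsW p a b (c n) (v n)) (hK : ∀ n, ∫ s in Icc a b, |v n s| ^ p ≤ K) {c₀ : ℝ → ℝ}
    (hc : ∀ ε > 0, ∀ᶠ n in atTop, ∀ s ∈ Icc a b, |c n s - c₀ s| ≤ ε) :
    IsW p a b c₀ (deriv c₀) := by
  have hK0 : 0 ≤ K := (integral_nonneg fun s => by positivity).trans (hK 0)
  have hpt : ∀ s ∈ Icc a b, Tendsto (fun n => c n s) atTop (𝓝 (c₀ s)) := by
    intro s hs
    rw [Metric.tendsto_nhds]
    intro ε hε
    filter_upwards [hc (ε / 2) (by positivity)] with n hn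
    rw [Real.dist_eq]
    linarith [hn s hs]
  have hac := absolutelyContinuous_of_tendsto hp hab h hK hpt
  set w := deriv c₀ with hw
  have hwm : Measurable w := measurable_deriv c₀
  have hwi : IntervalIntegrable w volume a b := hac.intervalIntegrable_deriv
  have heq : ∀ s ∈ Icc a b, c₀ s = c₀ a + ∫ τ in a..s, w τ := by
    intro s hs
    have := (hac.mono (c := a) (d := s) (by
      rw [uIcc_of_le hs.1, uIcc_of_le hab]
      exact Icc_subset_Icc_right hs.2)).integral_deriv_eq_sub
    rw [this]; ring
  have hwI : IntegrableOn w (Ioc a b) := (intervalIntegrable_iff_integrableOn_Ioc_of_le hab).1 hwi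
  have hvI : ∀ n, IntegrableOn (v n) (Ioc a b) := fun n =>
    ((h n).integrableOn hp).mono_set Ioc_subset_Icc_self
  have hvp : ∀ n, IntegrableOn (fun s => |v n s| ^ p) (Ioc a b) := fun n =>
    (h n).pow.mono_set Ioc_subset_Icc_self
  have hKc : ∀ n, ∫ s in Ioc a b, |v n s| ^ p ≤ K := fun n => by
    rw [← integral_Icc_eq_integral_Ioc]; exact hK n
  have hF : ∀ ε > 0, ∀ᶠ n in atTop, ∀ s ∈ Icc a b, |∫ τ in a..s, (v n τ - w τ)| ≤ ε := by
    intro ε hε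
    filter_upwards [hc (ε / 2) (by positivity)] with n hn s hs
    have hwis : IntervalIntegrable w volume a s := hwi.mono_set (by
      rw [uIcc_of_le hs.1, uIcc_of_le hab]; exact Icc_subset_Icc_right hs.2)
    rw [intervalIntegral.integral_sub
      ((h n).intervalIntegrable hp (left_mem_Icc.2 hab) hs) hwis,
      ← (h n).sub_eq hp (left_mem_Icc.2 hab) hs, show (∫ τ in a..s, w τ) = c₀ s - c₀ a by
        rw [heq s hs]; ring]
    have h1 := hn s hs
    have h2 := hn a (left_mem_Icc.2 hab)
    calc |c n s - c n a - (c₀ s - c₀ a)| = |(c n s - c₀ s) - (c n a - c₀ a)| := by ring_nf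
      _ ≤ |c n s - c₀ s| + |c n a - c₀ a| := abs_sub _ _
      _ ≤ ε := by linarith
  refine ⟨hwm.aestronglyMeasurable, ?_, heq⟩
  -- Integrability of `|w| ^ p` is not yet known, so the bound `K` is proved on these sets, which
  -- exhaust the interval.
  set G : ℕ → Set ℝ := fun M => {s | |w s| ≤ M} with hG
  have hGm : ∀ M, MeasurableSet (G M) := fun M => measurableSet_le hwm.abs measurable_const
  have hcover : AECover (volume.restrict (Ioc a b)) atTop G := by
    refine ⟨ae_of_all _ fun s => ?_, hGm⟩
    obtain ⟨k, hk⟩ := exists_nat_ge |w s|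
    filter_upwards [eventually_ge_atTop k] with n hn
    exact hk.trans (by exact_mod_cast hn)
  have hpow : ∀ M, IntegrableOn ((G M).indicator fun s => |w s| ^ p) (Ioc a b) := by
    intro M
    refine integrableOn_of_bound measurableSet_Ioc
      ((hwm.abs.pow_const p).indicator (hGm M)).aestronglyMeasurable
      (integrableOn_const measure_Ioc_lt_top.ne (C := (M : ℝ) ^ p)) fun s _ => ?_
    rw [indicator]
    split_ifs with hs
    · rw [abs_of_nonneg (by positivity)]
      exact Real.rpow_le_rpow (abs_nonneg _) hs (by linarith)
    · rw [abs_zero]; positivity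
  have hbound : ∀ M, ∫ s in Ioc a b, (G M).indicator (fun s => |w s| ^ p) s ≤ K := by
    intro M
    -- The function dual to `w`, truncated to be bounded, so that the weak convergence can be tested
    -- against it.
    set β : ℝ → ℝ := (G M).indicator fun s => SignType.sign (w s) * |w s| ^ (p - 1) with hβ
    have hβm : Measurable β := by
      refine Measurable.indicator ?_ (hGm M)
      have hs : Measurable fun s => ((SignType.sign (w s) : SignType) : ℝ) := by
        have : (fun x : ℝ => ((SignType.sign x : SignType) : ℝ)) =
            fun x => if 0 < x then 1 else if x < 0 then -1 else 0 := by
          ext x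
          rw [sign_apply]
          split_ifs <;> simp
        have hm : Measurable fun x : ℝ => ((SignType.sign x : SignType) : ℝ) := by
          rw [this]
          exact Measurable.ite measurableSet_Ioi measurable_const
            (Measurable.ite measurableSet_Iio measurable_const measurable_const)
        exact hm.comp hwm
      exact hs.mul (hwm.abs.pow_const _)
    have hβabs : ∀ s, |β s| ≤ (G M).indicator (fun s => |w s| ^ (p - 1)) s := by
      intro s
      rw [hβ, indicator, indicator]
      split_ifs with hs
      · rw [abs_mul, abs_of_nonneg (by positivity : 0 ≤ |w s| ^ (p - 1))]
        refine mul_le_of_le_one_left (by positivity) ?_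
        rcases lt_trichotomy (w s) 0 with h | h | h <;> simp [h]
      · simp
    have hβB : ∀ s ∈ Ioc a b, |β s| ≤ (M : ℝ) ^ (p - 1) := by
      intro s _
      refine (hβabs s).trans ?_
      rw [indicator]
      split_ifs with hs
      · exact Real.rpow_le_rpow (abs_nonneg _) hs (by linarith)
      · positivity
    have hweak := tendsto_integral_mul_of_rpow_bound hp hab hvI hwI hvp hKc hF
      hβm.aestronglyMeasurable hβB
    set q := p / (p - 1) with hq
    have hpq : p.HolderConjugate q := Real.HolderConjugate.conjExponent hp
    have hβw : ∀ s, β s * w s = (G M).indicator (fun s => |w s| ^ p) s := by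
      intro s
      rw [hβ, indicator, indicator]
      split_ifs with hs
      · rw [← rpow_sub_one_mul_self hp (abs_nonneg (w s)), mul_right_comm, sign_mul_self, mul_comm]
      · simp
    -- Young's inequality for the pair `v n`, `β`. In the limit the left side integrates to `0`,
    -- which leaves `∫ |w| ^ p ≤ K` on `G M`.
    have hpt : ∀ n s, β s * (v n s - w s) ≤
        |v n s| ^ p / p - 1 / p * (G M).indicator (fun s => |w s| ^ p) s := by
      intro n s
      rw [mul_sub, hβw]
      have hp0 : 0 < p := by linarith
      by_cases hs : s ∈ G M
      · have hb := hβabs s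
        rw [indicator_of_mem hs] at hb ⊢
        have hy := Real.young_inequality_of_nonneg (abs_nonneg (v n s))
          (by positivity : 0 ≤ |w s| ^ (p - 1)) hpq
        have e1 : (|w s| ^ (p - 1)) ^ q = |w s| ^ p := by
          rw [← Real.rpow_mul (abs_nonneg _), hq, mul_div_cancel₀ _ (by linarith : p - 1 ≠ 0)]
        have e2 : |w s| ^ p / q = |w s| ^ p - 1 / p * |w s| ^ p := by
          rw [hq]; field_simp
        rw [e1, e2] at hy
        have h3 : β s * v n s ≤ |v n s| * |w s| ^ (p - 1) := by
          calc β s * v n s ≤ |β s * v n s| := le_abs_self _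
            _ = |β s| * |v n s| := abs_mul _ _
            _ ≤ |w s| ^ (p - 1) * |v n s| := by gcongr
            _ = _ := mul_comm _ _
        linarith
      · have hz : β s = 0 := indicator_of_notMem hs _
        rw [indicator_of_notMem hs, hz]
        have : 0 ≤ |v n s| ^ p / p := by positivity
        linarith
    have hp0 : 0 < p := by linarith
    have hint : ∀ n, ∫ s in Ioc a b, β s * (v n s - w s) ≤
        K / p - 1 / p * ∫ s in Ioc a b, (G M).indicator (fun s => |w s| ^ p) s := by
      intro n
      calc ∫ s in Ioc a b, β s * (v n s - w s)
          ≤ ∫ s in Ioc a b, (|v n s| ^ p / p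
              - 1 / p * (G M).indicator (fun s => |w s| ^ p) s) := by
            refine integral_mono ?_ (((hvp n).div_const p).sub ((hpow M).const_mul _)) (hpt n)
            refine ((hvI n).sub hwI).bdd_mul (c := (M : ℝ) ^ (p - 1)) hβm.aestronglyMeasurable ?_
            filter_upwards [ae_restrict_mem measurableSet_Ioc] with s hs using hβB s hs
        _ = (∫ s in Ioc a b, |v n s| ^ p) / p
              - 1 / p * ∫ s in Ioc a b, (G M).indicator (fun s => |w s| ^ p) s := by
            rw [integral_sub ((hvp n).div_const p) ((hpow M).const_mul _), integral_div,
              integral_const_mul]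
        _ ≤ _ := by
            have := hKc n
            gcongr
    have h0 := le_of_tendsto' hweak hint
    have h1 : K / p - 1 / p * (∫ s in Ioc a b, (G M).indicator (fun s => |w s| ^ p) s) =
      (K - ∫ s in Ioc a b, (G M).indicator (fun s => |w s| ^ p) s) / p := by ring
    rw [h1] at h0
    have := (div_nonneg_iff.1 h0).resolve_right (by rintro ⟨-, h⟩; linarith)
    linarith [this.1]
  rw [integrableOn_Icc_iff_integrableOn_Ioc (by simp)]
  refine hcover.integrable_of_integral_norm_bounded K (fun M => ?_) (Eventually.of_forall fun M => ?_)
  · exact (integrable_indicator_iff (hGm M)).1 (hpow M)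
  · rw [← integral_indicator (hGm M)]
    refine le_trans (le_of_eq ?_) (hbound M)
    congr 1
    ext s
    rw [indicator, indicator]
    split_ifs
    · rw [Real.norm_eq_abs, abs_of_nonneg (by positivity)]
    · rfl

end ScalarCompactness

/-! ### Compactness and lower semicontinuity on the junction -/

namespace Problem
variable {N : ℕ} {P : Problem N}

/-- Compactness of sets of trajectories with bounded energy. -/
lemma exists_tendsto_subseq [Nonempty (Fin N)] (hP : P.Regular) {a b : ℝ} (hab : a ≤ b)
    {z : ℕ → ℝ → EuclideanSpace ℝ (Fin N)} (hz : ∀ n, P.IsPath a b (z n)) {R K : ℝ}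
    (hR : ∀ n j, |z n a j| ≤ R) (hK : ∀ n j, ∫ s in Icc a b, |deriv (z n) s j| ^ P.p ≤ K) :
    ∃ (σ : ℕ → ℕ) (y : ℝ → EuclideanSpace ℝ (Fin N)), StrictMono σ ∧ P.IsPath a b y ∧
      ∀ ε > 0, ∀ᶠ n in atTop, ∀ s ∈ Icc a b, ∀ j, |z (σ n) s j - y s j| ≤ ε := by
  have hp := hP.one_lt_p
  have hK0 : 0 ≤ K := by
    obtain ⟨j⟩ := ‹Nonempty (Fin N)›
    exact (integral_nonneg fun s => by positivity).trans (hK 0 j)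
  have hmod : ∀ {lam C : ℝ}, 0 ≤ lam → (∀ x : ℝ, |x| ≤ lam * |x| ^ P.p + C) → ∀ n j,
      ∀ τ ∈ Icc a b, ∀ s ∈ Icc a b, |z n s j - z n τ j| ≤ lam * K + C * |s - τ| := by
    intro lam C hlam hC n j τ hτ s hs
    refine (((hz n).coord j).abs_sub_le hp hC hτ hs).trans ?_
    gcongr
    exact (setIntegral_mono_set ((hz n).coord j).pow (ae_of_all _ fun s => by positivity)
      (LE.le.eventuallyLE (uIoc_subset_Icc' hτ hs))).trans (hK n j)
  set f : ℕ → BoundedContinuousFunction (Icc a b) (Fin N → ℝ) := fun n =>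
    BoundedContinuousFunction.mkOfCompact ⟨fun s => (z n s).ofLp, by
      refine continuous_pi fun j => ?_
      exact ((hz n).continuousOn_coord hP j).domRestrict⟩ with hf
  have hfa : ∀ n s j, f n s j = z n s j := fun n s j => rfl
  obtain ⟨C₁, hC₁, hC₁'⟩ := exists_le_mul_rpow_add hp (lam := 1) one_pos
  -- The bound `hmod` gives boundedness with `lam = 1` and equicontinuity with `lam` of order `ε /
  -- K`.
  have hcomp : IsCompact (closure (range f)) := by
    refine BoundedContinuousFunction.arzela_ascoli
      (Metric.closedBall 0 (|R| + (1 * K + C₁ * (b - a)))) (isCompact_closedBall _ _) _ ?_ ?_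
    · rintro _ s ⟨n, rfl⟩
      have hba := sub_nonneg.2 hab
      rw [mem_closedBall_zero_iff, pi_norm_le_iff_of_nonneg (by positivity)]
      intro j
      rw [hfa, Real.norm_eq_abs]
      have h1 := hmod zero_le_one hC₁' n j a ⟨le_rfl, hab⟩ s s.2
      have h2 : C₁ * |(s : ℝ) - a| ≤ C₁ * (b - a) := by
        rw [abs_of_nonneg (sub_nonneg.2 s.2.1)]
        gcongr
        exact s.2.2
      have h3 : |z n s j| ≤ |z n a j| + |z n s j - z n a j| := by
        have := abs_add_le (z n a j) (z n s j - z n a j)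
        simpa using this
      have h4 := hR n j
      have := le_abs_self R
      linarith
    · intro s
      rw [Metric.equicontinuousAt_iff]
      intro ε hε
      obtain ⟨C, hC0, hC⟩ := exists_le_mul_rpow_add hp (lam := ε / (4 * (K + 1))) (by positivity)
      refine ⟨ε / (4 * (C + 1)), by positivity, fun τ hτ => ?_⟩
      rintro ⟨_, n, rfl⟩
      have h1 : dist (f n s) (f n τ) ≤ ε / 2 := by
        rw [dist_pi_le_iff (by positivity)]
        intro j
        rw [hfa, hfa, Real.dist_eq]
        refine (hmod (by positivity) hC n j τ τ.2 s s.2).trans ?_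
        have h2 : |(s : ℝ) - τ| ≤ ε / (4 * (C + 1)) := by
          rw [Subtype.dist_eq, Real.dist_eq, abs_sub_comm] at hτ
          exact hτ.le
        calc ε / (4 * (K + 1)) * K + C * |(s : ℝ) - τ|
            ≤ ε / (4 * (K + 1)) * (K + 1) + (C + 1) * (ε / (4 * (C + 1))) := by
              gcongr <;> linarith
          _ = ε / 2 := by field_simp; ring
      exact lt_of_le_of_lt h1 (by linarith)
  obtain ⟨g, -, σ, hσ, hlim⟩ := hcomp.tendsto_subseq (x := f)
    (fun n => subset_closure (mem_range_self n))
  set y : ℝ → EuclideanSpace ℝ (Fin N) := fun s => WithLp.toLp 2 (IccExtend hab g s) with hy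
  have hyg : ∀ s (hs : s ∈ Icc a b) j, y s j = g ⟨s, hs⟩ j := fun s hs j => by
    simp only [hy, IccExtend_of_mem hab _ hs]
  have hunif : ∀ ε > 0, ∀ᶠ n in atTop, ∀ s ∈ Icc a b, ∀ j, |z (σ n) s j - y s j| ≤ ε := by
    intro ε hε
    filter_upwards [(Metric.tendsto_nhds.1 hlim) ε hε] with n hn s hs j
    rw [hyg s hs j, ← hfa (σ n) ⟨s, hs⟩ j, ← Real.dist_eq]
    exact (dist_le_pi_dist _ _ j).trans
      ((BoundedContinuousFunction.dist_coe_le_dist _).trans hn.le)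
  refine ⟨σ, y, hσ, ?_, hunif⟩
  have hpt : ∀ s ∈ Icc a b, ∀ j, Tendsto (fun n => z (σ n) s j) atTop (𝓝 (y s j)) := by
    intro s hs j
    rw [Metric.tendsto_nhds]
    intro ε hε
    filter_upwards [hunif (ε / 2) (by positivity)] with n hn
    rw [Real.dist_eq]
    linarith [hn s hs j]
  refine IsPath.of_coord hP (v := fun j => deriv fun s => y s j) (fun j => ?_) (fun s hs => ?_)
  · refine exists_isW_of_tendsto hp hab (c := fun n s => z (σ n) s j)
      (v := fun n s => deriv (z (σ n)) s j) (fun n => (hz _).coord j) (fun n => hK _ j)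
      (fun ε hε => ?_)
    filter_upwards [hunif ε hε] with n hn s hs using hn s hs j
  · rw [mem_junction_iff]
    refine ⟨fun j => ?_, fun j k hjk => ?_⟩
    · exact ge_of_tendsto' (hpt s hs j) fun n => nonneg_of_mem_junction ((hz _).mem s hs) j
    · refine tendsto_nhds_unique ((hpt s hs j).mul (hpt s hs k)) ?_
      refine tendsto_const_nhds.congr fun n => ?_
      exact ((mem_junction_iff.1 ((hz (σ n)).mem s hs)).2 j k hjk).symm

/-- The slope `∂_a ℓ_j` at `(x, v)` on the edges that meet `x`, and `0` on the other edges. -/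
def slope (P : Problem N) (x v : EuclideanSpace ℝ (Fin N)) (s : ℝ) (j : Fin N) : ℝ :=
  open Classical in if 0 < x j ∨ x = 0 then P.partialA j (x j) (v j) s else 0

/-- The running cost is bounded below by its linearisation in the velocity. -/
lemma runningCost_linear_le (hP : P.Regular) (h4 : P.H4) {R c : ℝ} (hc0 : 0 ≤ c)
    (hc : ∀ i, ∀ y₁ ∈ Icc 0 R, ∀ y₂ ∈ Icc 0 R, ∀ a : ℝ, ∀ s ∈ Icc 0 P.T,
      |P.ℓ i y₁ a s - P.ℓ i y₂ a s| ≤ c * (|a| ^ P.p + 1) * |y₁ - y₂|)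
    {s : ℝ} (hs : s ∈ Icc 0 P.T) {x x' v v' : EuclideanSpace ℝ (Fin N)}
    (hx : x ∈ junction N) (hx' : x' ∈ junction N) (hv : ∀ j, x j = 0 → v j = 0)
    (hv' : ∀ j, x' j = 0 → v' j = 0) (hxR : ∀ j, x j ≤ R) (hxR' : ∀ j, x' j ≤ R)
    {δ : ℝ} (hδ0 : 0 ≤ δ) (hδ : ∀ j, |x' j - x j| ≤ δ) (hfar : x = 0 ∨ ∃ i, δ < x i) :
    P.runningCost x v s + ∑ j, P.slope x v s j * (v' j - v j)
      - δ * (c * ∑ j, (|v' j| ^ P.p + 1)) ≤ P.runningCost x' v' s := by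
  have hsum : ∀ i, |v' i| ^ P.p + 1 ≤ ∑ j, (|v' j| ^ P.p + 1) := fun i =>
    Finset.single_le_sum (f := fun j => |v' j| ^ P.p + 1) (fun j _ => by positivity)
      (Finset.mem_univ i)
  have hsum0 : 0 ≤ ∑ j, (|v' j| ^ P.p + 1) := Finset.sum_nonneg fun j _ => by positivity
  have hcmp : ∀ i, P.ℓ i (x i) (v' i) s - δ * (c * ∑ j, (|v' j| ^ P.p + 1)) ≤
      P.ℓ i (x' i) (v' i) s := by
    intro i
    have h1 := hc i (x i) ⟨nonneg_of_mem_junction hx i, hxR i⟩ (x' i)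
      ⟨nonneg_of_mem_junction hx' i, hxR' i⟩ (v' i) s hs
    have h2 : c * (|v' i| ^ P.p + 1) * |x i - x' i| ≤ (c * ∑ j, (|v' j| ^ P.p + 1)) * δ := by
      rw [abs_sub_comm]
      exact mul_le_mul (mul_le_mul_of_nonneg_left (hsum i) hc0) (hδ i) (abs_nonneg _)
        (by positivity)
    have := le_abs_self (P.ℓ i (x i) (v' i) s - P.ℓ i (x' i) (v' i) s)
    linarith
  -- Off the vertex, the margin `δ < x i` keeps `x'` on the same edge. At the vertex, `x'` may lie
  -- on any edge; the jump of the cost has the right sign, since `vertexCost` is at most `ℓ_i(0, 0,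
  -- s)`, and the tangent is taken at zero velocity.
  rcases exists_pos_or_eq_zero hx with ⟨i, hi⟩ | rfl
  · have hx0 : x ≠ 0 := by rintro rfl; exact lt_irrefl _ hi
    have hother : ∀ j, j ≠ i → x j = 0 := fun j hj => by
      rw [eq_point_of_pos hx hi, point_apply, if_neg hj]
    have hxi : δ < x i := by
      obtain ⟨k, hk⟩ := hfar.resolve_left hx0
      by_cases hki : k = i
      · rwa [hki] at hk
      · rw [hother k hki] at hk
        exact absurd hk (not_lt.2 hδ0)
    have hx'i : 0 < x' i := by
      have := (abs_le.1 (hδ i)).1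
      linarith
    have hsl : ∑ j, P.slope x v s j * (v' j - v j) = P.partialA i (x i) (v i) s * (v' i - v i) := by
      rw [Finset.sum_eq_single i]
      · rw [slope, if_pos (Or.inl hi)]
      · intro j _ hj
        rw [slope, if_neg, zero_mul]
        rintro (h | h)
        · rw [hother j hj] at h; exact lt_irrefl _ h
        · exact hx0 h
      · simp
    rw [hsl, runningCost_of_pos hx hi, runningCost_of_pos hx' hx'i]
    have h1 := hP.convex_le h4 i hi.le hs (v i) (v' i)
    have h2 := hcmp i
    linarith
  · have hv0 : ∀ j, v j = 0 := fun j => hv j rfl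
    have hpos : 0 ≤ δ * (c * ∑ j, (|v' j| ^ P.p + 1)) := by positivity
    rw [runningCost_zero]
    rcases exists_pos_or_eq_zero hx' with ⟨i, hi⟩ | rfl
    · have hsl : ∑ j, P.slope 0 v s j * (v' j - v j) = P.partialA i 0 0 s * v' i := by
        rw [Finset.sum_eq_single i]
        · rw [slope, if_pos (Or.inr rfl), hv0 i, sub_zero]; rfl
        · intro j _ hj
          have : v' j = 0 := hv' j (by rw [eq_point_of_pos hx' hi, point_apply, if_neg hj])
          rw [this, hv0 j, sub_zero, mul_zero]
        · simp
      rw [hsl, runningCost_of_pos hx' hi]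
      have h1 := hP.convex_le h4 i le_rfl hs 0 (v' i)
      have h2 : P.ℓ i 0 (v' i) s - δ * (c * ∑ j, (|v' j| ^ P.p + 1)) ≤
        P.ℓ i (x' i) (v' i) s := hcmp i
      have h3 := P.vertexCost_le s i
      rw [sub_zero] at h1
      linarith
    · have hsl : ∑ j, P.slope 0 v s j * (v' j - v j) = 0 :=
        Finset.sum_eq_zero fun j _ => by rw [hv0 j, hv' j rfl, sub_zero, mul_zero]
      rw [hsl, runningCost_zero]
      linarith

/-- The terminal cost is lower semicontinuous. -/
lemma terminalCost_lsc [Nonempty (Fin N)] (hP : P.Regular) {x : EuclideanSpace ℝ (Fin N)}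
    (hx : x ∈ junction N) {x' : ℕ → EuclideanSpace ℝ (Fin N)} (hx' : ∀ n, x' n ∈ junction N)
    (hlim : ∀ j, Tendsto (fun n => x' n j) atTop (𝓝 (x j))) {ε : ℝ} (hε : 0 < ε) :
    ∀ᶠ n in atTop, P.terminalCost x ≤ P.terminalCost (x' n) + ε := by
  have hg : ∀ j, ∀ᶠ n in atTop, P.g j (x j) ≤ P.g j (x' n j) + ε := by
    intro j
    have h1 : Tendsto (fun n => x' n j) atTop (𝓝[Ici 0] (x j)) :=
      tendsto_nhdsWithin_iff.2 ⟨hlim j, Eventually.of_forall fun n =>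
        nonneg_of_mem_junction (hx' n) j⟩
    have h2 := (hP.g_continuous j (x j) (nonneg_of_mem_junction hx j)).tendsto.comp h1
    filter_upwards [h2.eventually_const_lt (show P.g j (x j) - ε < P.g j (x j) by linarith)]
      with n hn
    have : P.g j (x j) - ε < P.g j (x' n j) := hn
    linarith
  rcases exists_pos_or_eq_zero hx with ⟨i, hi⟩ | rfl
  · filter_upwards [hg i, (hlim i).eventually_const_lt hi] with n hn hpos
    rwa [terminalCost_of_pos hx hi, terminalCost_of_pos (hx' n) hpos]
  · filter_upwards [eventually_all.2 hg] with n hn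
    rw [terminalCost_zero]
    rcases exists_pos_or_eq_zero (hx' n) with ⟨i, hi⟩ | h0
    · rw [terminalCost_of_pos (hx' n) hi]
      exact (min_le_right _ _).trans
        ((ciInf_le (finite_range fun j => P.g j 0).bddBelow i).trans (hn i))
    · rw [h0, terminalCost_zero]
      linarith

/-- Lower semicontinuity of the running cost along trajectories with bounded energy. -/
lemma integral_runningCost_lsc [Nonempty (Fin N)] (hP : P.Regular) (h1 : P.H1) (h3 : P.H3)
    (h4 : P.H4) {a b : ℝ} (ha : 0 ≤ a) (hab : a ≤ b) (hb : b ≤ P.T)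
    {z : ℕ → ℝ → EuclideanSpace ℝ (Fin N)} (hz : ∀ n, P.IsPath a b (z n)) {K : ℝ}
    (hK : ∀ n j, ∫ s in Icc a b, |deriv (z n) s j| ^ P.p ≤ K)
    {y : ℝ → EuclideanSpace ℝ (Fin N)} (hy : P.IsPath a b y)
    (hlim : ∀ ε > 0, ∀ᶠ n in atTop, ∀ s ∈ Icc a b, ∀ j, |z n s j - y s j| ≤ ε)
    {ε : ℝ} (hε : 0 < ε) :
    ∀ᶠ n in atTop, ∫ s in a..b, P.runningCost (y s) (deriv y s) s ≤
      (∫ s in a..b, P.runningCost (z n s) (deriv (z n) s) s) + ε := by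
  have hp := hP.one_lt_p
  have hS : Icc a b ⊆ Icc 0 P.T := Icc_subset_Icc ha hb
  set S := Ioc a b with hSdef
  have hSI : S ⊆ Icc a b := Ioc_subset_Icc_self
  have hSm : MeasurableSet S := measurableSet_Ioc
  have hSfin : volume S ≠ ⊤ := measure_Ioc_lt_top.ne
  have hK0 : 0 ≤ K := by
    obtain ⟨j⟩ := ‹Nonempty (Fin N)›
    exact (integral_nonneg fun s => by positivity).trans (hK 0 j)
  set V := deriv y with hV
  have hVm : ∀ j, Measurable fun s => V s j := fun j => IsPath.measurable_deriv_apply y j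
  have hyj : ∀ j, ContinuousOn (fun s => y s j) (Icc a b) := fun j => hy.continuousOn_coord hP j
  obtain ⟨R, hR, hyR⟩ := hy.exists_bound hP
  obtain ⟨c, hc0, hc⟩ := h3.lipschitz_y hP (r := R + 1) (by positivity)
  obtain ⟨cA, hcA0, hcA⟩ := h3 R hR
  obtain ⟨C₀, c₀, -, hlow, -⟩ := IsPath.coercive (P := P) hP h1
  have hLy : IntegrableOn (fun s => P.runningCost (y s) (V s) s) S :=
    (hy.integrableOn_runningCost hP h3 ha hb).mono_set hSI
  have hLz : ∀ n, IntegrableOn (fun s => P.runningCost (z n s) (deriv (z n) s) s) S := fun n =>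
    ((hz n).integrableOn_runningCost hP h3 ha hb).mono_set hSI
  -- a continuous extension of the distance of `y` to the vertex
  set D : ℝ → ℝ := IccExtend hab ((Icc a b).domRestrict fun s => ∑ j, y s j) with hD
  have hDc : Continuous D := continuous_IccExtend_iff.2
    (continuousOn_finsetSum _ fun j _ => hyj j).domRestrict
  have hDy : ∀ s ∈ Icc a b, D s = ∑ j, y s j := fun s hs => IccExtend_of_mem hab _ hs
  set W : ℝ → ℝ := fun s => ∑ j, |V s j| with hW
  have hWm : Measurable W := Finset.measurable_fun_sum _ fun j _ => (hVm j).abs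
  -- Good times: `y` is at the vertex or well away from it, and its speed is bounded. There the cost
  -- is linearised with bounded slopes; elsewhere only the constant lower bound `c₀` is used, at a
  -- loss `H`. Each time is good for large `k`, so the loss becomes small.
  set G : ℕ → Set ℝ := fun k => {s | (D s = 0 ∨ 1 / ((k : ℝ) + 1) ≤ D s) ∧ W s ≤ k} with hG
  have hGm : ∀ k, MeasurableSet (G k) := fun k =>
    ((isClosed_eq hDc continuous_const).measurableSet.union
      (isClosed_le continuous_const hDc).measurableSet).inter (measurableSet_le hWm measurable_const)
  set H : ℝ → ℝ := fun s => |P.runningCost (y s) (V s) s| + |c₀| with hH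
  have hHi : IntegrableOn H S := hLy.abs.add (integrableOn_const hSfin)
  have hDnn : ∀ s ∈ Icc a b, 0 ≤ D s := fun s hs => by
    rw [hDy s hs]; exact Finset.sum_nonneg fun j _ => nonneg_of_mem_junction (hy.mem s hs) j
  have hbad : Tendsto (fun k => ∫ s in S, (G k)ᶜ.indicator H s) atTop (𝓝 (∫ s in S, (0 : ℝ))) := by
    refine tendsto_integral_of_dominated_convergence H
      (fun k => hHi.aestronglyMeasurable.indicator (hGm k).compl) hHi (fun k => ae_of_all _ fun s => ?_) ?_
    · have h0 : 0 ≤ H s := by positivity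
      rw [indicator]
      split_ifs
      · rw [Real.norm_eq_abs, abs_of_nonneg h0]
      · simpa using h0
    · filter_upwards [ae_restrict_mem hSm] with s hs
      refine tendsto_const_nhds.congr' ?_
      have e1 : ∀ᶠ k : ℕ in atTop, D s = 0 ∨ 1 / ((k : ℝ) + 1) ≤ D s := by
        rcases (hDnn s (hSI hs)).eq_or_lt with h | h
        · exact Eventually.of_forall fun k => Or.inl h.symm
        · filter_upwards [tendsto_one_div_add_atTop_nhds_zero_nat.eventually_le_const h] with k hk
          exact Or.inr hk
      have e2 : ∀ᶠ k : ℕ in atTop, W s ≤ k := by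
        obtain ⟨m, hm⟩ := exists_nat_ge (W s)
        filter_upwards [eventually_ge_atTop m] with k hk
        exact hm.trans (by exact_mod_cast hk)
      filter_upwards [e1, e2] with k hk1 hk2
      rw [indicator_of_notMem]
      exact fun hmem => hmem ⟨hk1, hk2⟩
  rw [integral_zero] at hbad
  obtain ⟨k, hk⟩ := (hbad.eventually_le_const (show 0 < ε / 3 by positivity)).exists
  set β : Fin N → ℝ → ℝ := fun j => (G k).indicator fun s => P.slope (y s) (V s) s j with hβ
  have hslopeB : ∀ j, ∀ s ∈ S, |β j s| ≤ cA * ((k : ℝ) ^ P.p + 2) := by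
    intro j s hs
    rw [hβ]
    simp only [indicator]
    split_ifs with hsG
    · rw [slope]
      split_ifs
      · refine ((hcA j _ (hyR s (hSI hs) j) (V s j) s (hS (hSI hs))).2).trans ?_
        refine mul_le_mul_of_nonneg_left ?_ hcA0
        have h5 : |V s j| ≤ k :=
          (Finset.single_le_sum (f := fun j => |V s j|) (fun j _ => abs_nonneg _)
            (Finset.mem_univ j)).trans hsG.2
        have h6 := rpow_sub_one_le hp (abs_nonneg (V s j))
        have h7 : |V s j| ^ P.p ≤ (k : ℝ) ^ P.p :=
          Real.rpow_le_rpow (abs_nonneg _) h5 (by linarith)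
        linarith
      · rw [abs_zero]; positivity
    · rw [abs_zero]; positivity
  have hβm : ∀ j, AEStronglyMeasurable (β j) (volume.restrict S) := by
    intro j
    set Dj : ℝ → ℝ := IccExtend hab ((Icc a b).domRestrict fun s => y s j) with hDj
    have hDjc : Continuous Dj := continuous_IccExtend_iff.2 (hyj j).domRestrict
    have hDjy : ∀ s ∈ Icc a b, Dj s = y s j := fun s hs => IccExtend_of_mem hab _ hs
    have hset : MeasurableSet ({s | 0 < Dj s} ∪ {s | D s = 0}) :=
      (isOpen_lt continuous_const hDjc).measurableSet.union
        (isClosed_eq hDc continuous_const).measurableSet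
    have hmeas := aestronglyMeasurable_superposition hP.T_pos.le (hP.partialA_continuous j) hSm
      (hSI.trans hS) (((hyj j).mono hSI).aemeasurable hSm) (hVm j).aemeasurable
      (fun s hs => nonneg_of_mem_junction (hy.mem s (hSI hs)) j)
    refine ((hmeas.indicator hset).indicator (hGm k)).congr ?_
    filter_upwards [ae_restrict_mem hSm] with s hs
    have hD0 : D s = 0 ↔ y s = 0 := by
      rw [hDy s (hSI hs), Finset.sum_eq_zero_iff_of_nonneg fun j _ =>
        nonneg_of_mem_junction (hy.mem s (hSI hs)) j]
      constructor
      · intro h; ext j; exact h j (Finset.mem_univ j)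
      · intro h j _; rw [h]; rfl
    have hiff : s ∈ ({s | 0 < Dj s} ∪ {s | D s = 0}) ↔ 0 < y s j ∨ y s = 0 := by
      rw [mem_union, mem_ofPred_eq, mem_ofPred_eq, hDjy s (hSI hs), hD0]
    simp only [hβ, indicator, slope]
    split_ifs <;> first | rfl | tauto
  have hVI : ∀ j, IntegrableOn (fun s => V s j) S := fun j =>
    ((hy.coord j).integrableOn hp).mono_set hSI
  have hzI : ∀ n j, IntegrableOn (fun s => deriv (z n) s j) S := fun n j =>
    (((hz n).coord j).integrableOn hp).mono_set hSI
  have hzp : ∀ n j, IntegrableOn (fun s => |deriv (z n) s j| ^ P.p) S := fun n j =>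
    ((hz n).coord j).pow.mono_set hSI
  have hzK : ∀ n j, ∫ s in S, |deriv (z n) s j| ^ P.p ≤ K := fun n j => by
    rw [← integral_Icc_eq_integral_Ioc]; exact hK n j
  have hweak : ∀ j, Tendsto (fun n => ∫ s in S, β j s * (deriv (z n) s j - V s j)) atTop (𝓝 0) := by
    intro j
    refine tendsto_integral_mul_of_rpow_bound hp hab (fun n => hzI n j) (hVI j)
      (fun n => hzp n j) (fun n => hzK n j) (fun η hη => ?_) (hβm j) (hslopeB j)
    filter_upwards [hlim (η / 2) (by positivity)] with n hn s hs
    rw [intervalIntegral.integral_sub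
      (((hz n).coord j).intervalIntegrable hp (left_mem_Icc.2 hab) hs)
      ((hy.coord j).intervalIntegrable hp (left_mem_Icc.2 hab) hs),
      ← ((hz n).coord j).sub_eq hp (left_mem_Icc.2 hab) hs,
      ← (hy.coord j).sub_eq hp (left_mem_Icc.2 hab) hs]
    have g1 := hn s hs j
    have g2 := hn a (left_mem_Icc.2 hab) j
    calc |z n s j - z n a j - (y s j - y a j)| = |(z n s j - y s j) - (z n a j - y a j)| := by
          ring_nf
      _ ≤ |z n s j - y s j| + |z n a j - y a j| := abs_sub _ _
      _ ≤ η := by linarith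
  have hweak' : Tendsto (fun n => ∑ j, ∫ s in S, β j s * (deriv (z n) s j - V s j)) atTop (𝓝 0) := by
    simpa using tendsto_finsetSum Finset.univ fun j _ => hweak j
  set M : ℝ := c * ∑ _j : Fin N, (K + (b - a)) with hM
  have hM0 : 0 ≤ M := by
    have := sub_nonneg.2 hab
    exact mul_nonneg hc0 (Finset.sum_nonneg fun j _ => by positivity)
  -- The three terms keep `z n` on the edge of `y` at good times, keep it in the range `R + 1` of
  -- the Lipschitz constant, and make the Lipschitz error at most `ε / 3`.
  set δ : ℝ := min (1 / (2 * ((k : ℝ) + 1))) (min 1 (ε / (3 * (M + 1)))) with hδ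
  have hδ0 : 0 < δ := lt_min (by positivity) (lt_min one_pos (by positivity))
  have hδk : δ < 1 / ((k : ℝ) + 1) := by
    refine (min_le_left _ _).trans_lt ?_
    rw [one_div_lt_one_div (by positivity) (by positivity)]
    have : (0 : ℝ) < (k : ℝ) + 1 := by positivity
    linarith
  have hδ1 : δ ≤ 1 := (min_le_right _ _).trans (min_le_left _ _)
  have hδM : δ * M ≤ ε / 3 := by
    calc δ * M ≤ ε / (3 * (M + 1)) * (M + 1) :=
          mul_le_mul ((min_le_right _ _).trans (min_le_right _ _)) (by linarith) hM0 (by positivity)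
      _ = ε / 3 := by field_simp
  filter_upwards [hlim δ hδ0, hweak'.eventually_const_lt (show -(ε / 3) < 0 by linarith)] with n hn hnw
  rw [intervalIntegral.integral_of_le hab, intervalIntegral.integral_of_le hab]
  have hpt : ∀ᵐ s ∂(volume.restrict S), P.runningCost (y s) (V s) s - (G k)ᶜ.indicator H s
      + ∑ j, β j s * (deriv (z n) s j - V s j)
      - δ * (c * ∑ j, (|deriv (z n) s j| ^ P.p + 1)) ≤
      P.runningCost (z n s) (deriv (z n) s) s := by
    have hμ : volume.restrict S ≤ volume.restrict (Icc a b) := Measure.restrict_mono hSI le_rfl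
    filter_upwards [ae_restrict_mem hSm, ae_mono hμ (hy.ae_deriv hP),
      ae_mono hμ ((hz n).ae_deriv hP)] with s hs hys hzs
    have hsI := hSI hs
    by_cases hsG : s ∈ G k
    · rw [indicator_of_notMem (by simpa using hsG), sub_zero]
      simp only [hβ, indicator_of_mem hsG]
      refine runningCost_linear_le hP h4 hc0 hc (hS hsI) (hy.mem s hsI) ((hz n).mem s hsI)
        (fun j => (hys j).2) (fun j => (hzs j).2)
        (fun j => (hyR s hsI j).2.trans (by linarith)) (fun j => ?_) hδ0.le (hn s hsI) ?_
      · have := (abs_le.1 (hn s hsI j)).2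
        have := (hyR s hsI j).2
        linarith
      · rcases exists_pos_or_eq_zero (hy.mem s hsI) with ⟨i, hi⟩ | h0
        · right
          refine ⟨i, ?_⟩
          have hDi : D s = y s i := by
            rw [hDy s hsI, Finset.sum_eq_single i]
            · intro j _ hj
              rw [eq_point_of_pos (hy.mem s hsI) hi, point_apply, if_neg hj]
            · simp
          rw [← hDi] at hi ⊢
          exact hδk.trans_le (hsG.1.resolve_left hi.ne')
        · exact Or.inl h0
    · rw [indicator_of_mem (by simpa using hsG)]
      simp only [hβ, indicator_of_notMem hsG, zero_mul, Finset.sum_const_zero]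
      have g1 := hlow s (hS hsI) _ ((hz n).mem s hsI) (deriv (z n) s)
      have g2 := le_abs_self (P.runningCost (y s) (V s) s)
      have g3 := neg_abs_le c₀
      have g4 : 0 ≤ δ * (c * ∑ j, (|deriv (z n) s j| ^ P.p + 1)) :=
        mul_nonneg hδ0.le (mul_nonneg hc0 (Finset.sum_nonneg fun j _ => by positivity))
      simp only [hH]
      linarith
  have i1 : IntegrableOn (fun s => (G k)ᶜ.indicator H s) S := hHi.indicator (hGm k).compl
  have i2 : ∀ j, IntegrableOn (fun s => β j s * (deriv (z n) s j - V s j)) S := fun j => by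
    refine ((hzI n j).sub (hVI j)).bdd_mul (c := cA * ((k : ℝ) ^ P.p + 2)) (hβm j) ?_
    filter_upwards [ae_restrict_mem hSm] with s hs using hslopeB j s hs
  have i2' : IntegrableOn (fun s => ∑ j, β j s * (deriv (z n) s j - V s j)) S :=
    integrable_finsetSum _ fun j _ => i2 j
  have i3 : ∀ j, IntegrableOn (fun s => |deriv (z n) s j| ^ P.p + 1) S := fun j =>
    (hzp n j).add (integrableOn_const hSfin)
  have i3' : IntegrableOn (fun s => δ * (c * ∑ j, (|deriv (z n) s j| ^ P.p + 1))) S :=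
    ((integrable_finsetSum _ fun j _ => i3 j).const_mul c).const_mul δ
  have i4 : IntegrableOn (fun s => P.runningCost (y s) (V s) s - (G k)ᶜ.indicator H s) S :=
    hLy.sub i1
  have i5 : IntegrableOn (fun s => P.runningCost (y s) (V s) s - (G k)ᶜ.indicator H s
      + ∑ j, β j s * (deriv (z n) s j - V s j)) S := i4.add i2'
  have hfinal := integral_mono_ae (i5.sub i3') (hLz n) hpt
  have e3 : ∫ s in S, δ * (c * ∑ j, (|deriv (z n) s j| ^ P.p + 1)) ≤ δ * M := by
    rw [integral_const_mul, integral_const_mul, integral_finsetSum _ fun j _ => i3 j]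
    refine mul_le_mul_of_nonneg_left (mul_le_mul_of_nonneg_left
      (Finset.sum_le_sum fun j _ => ?_) hc0) hδ0.le
    rw [integral_add (hzp n j) (integrableOn_const hSfin)]
    have : ∫ _ in S, (1 : ℝ) = b - a := by simp [hSdef, hab]
    rw [this]
    linarith [hzK n j]
  have e0 : ∫ s in S, ((fun s => P.runningCost (y s) (V s) s - (G k)ᶜ.indicator H s
      + ∑ j, β j s * (deriv (z n) s j - V s j))
      - fun s => δ * (c * ∑ j, (|deriv (z n) s j| ^ P.p + 1))) s =
      (∫ s in S, P.runningCost (y s) (V s) s) - (∫ s in S, (G k)ᶜ.indicator H s)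
      + (∑ j, ∫ s in S, β j s * (deriv (z n) s j - V s j))
      - ∫ s in S, δ * (c * ∑ j, (|deriv (z n) s j| ^ P.p + 1)) := by
    rw [integral_sub' i5 i3', integral_add i4 i2', integral_sub hLy i1,
      integral_finsetSum _ fun j _ => i2 j]
  have hfinal' : (∫ s in S, P.runningCost (y s) (V s) s) - (∫ s in S, (G k)ᶜ.indicator H s)
      + (∑ j, ∫ s in S, β j s * (deriv (z n) s j - V s j))
      - ∫ s in S, δ * (c * ∑ j, (|deriv (z n) s j| ^ P.p + 1)) ≤
      ∫ s in S, P.runningCost (z n s) (deriv (z n) s) s := e0 ▸ hfinal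
  linarith

/-- Lower semicontinuity of the cost along trajectories with bounded energy. -/
lemma cost_lsc [Nonempty (Fin N)] (hP : P.Regular) (h1 : P.H1) (h3 : P.H3)
    (h4 : P.H4) {t : ℝ} (ht : t ∈ Icc 0 P.T)
    {z : ℕ → ℝ → EuclideanSpace ℝ (Fin N)} (hz : ∀ n, P.IsPath t P.T (z n)) {K : ℝ}
    (hK : ∀ n j, ∫ s in Icc t P.T, |deriv (z n) s j| ^ P.p ≤ K)
    {y : ℝ → EuclideanSpace ℝ (Fin N)} (hy : P.IsPath t P.T y)
    (hlim : ∀ ε > 0, ∀ᶠ n in atTop, ∀ s ∈ Icc t P.T, ∀ j, |z n s j - y s j| ≤ ε)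
    {ε : ℝ} (hε : 0 < ε) :
    ∀ᶠ n in atTop, P.cost t y ≤ P.cost t (z n) + ε := by
  have hTm : P.T ∈ Icc t P.T := ⟨ht.2, le_rfl⟩
  have hT := terminalCost_lsc hP (hy.mem _ hTm) (fun n => (hz n).mem _ hTm) (fun j => by
    rw [Metric.tendsto_nhds]
    intro η hη
    filter_upwards [hlim (η / 2) (by positivity)] with n hn
    rw [Real.dist_eq]
    linarith [hn _ hTm j]) (half_pos hε)
  filter_upwards [hT, integral_runningCost_lsc hP h1 h3 h4 ht.1 ht.2 le_rfl hz hK hy hlim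
    (half_pos hε)] with n h5 h6
  unfold cost
  linarith

end Problem

/-- Nonnegative functions whose integrals tend to `0` have a dominated subsequence that tends to
`0` almost everywhere. -/
lemma exists_subseq_ae_tendsto_zero {S : Set ℝ} {γ : ℕ → ℝ → ℝ} (hγ : ∀ n, IntegrableOn (γ n) S)
    (h0 : ∀ n, ∀ᵐ s ∂(volume.restrict S), 0 ≤ γ n s)
    (hlim : Tendsto (fun n => ∫ s in S, γ n s) atTop (𝓝 0)) :
    ∃ (σ : ℕ → ℕ) (B : ℝ → ℝ), StrictMono σ ∧ IntegrableOn B S ∧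
      ∀ᵐ s ∂(volume.restrict S), Tendsto (fun n => γ (σ n) s) atTop (𝓝 0) ∧
        ∀ n, γ (σ n) s ≤ B s := by
  -- Integrals below `2 ^ (-n)` make the sum of the subsequence integrable. The sum dominates every
  -- term, and its finiteness a.e. forces the terms to `0`.
  obtain ⟨σ, hσ, hσ'⟩ := extraction_forall_of_eventually
    (P := fun n k => ∫ s in S, γ k s ≤ (1 / 2 : ℝ) ^ n)
    fun n => hlim.eventually_le_const (show (0 : ℝ) < (1 / 2) ^ n by positivity)
  have hm : ∀ n, AEMeasurable (fun s => ENNReal.ofReal (γ (σ n) s)) (volume.restrict S) :=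
    fun n => (hγ (σ n)).aemeasurable.ennreal_ofReal
  set g : ℝ → ENNReal := fun s => ∑' n, ENNReal.ofReal (γ (σ n) s) with hg
  have hgm : AEMeasurable g (volume.restrict S) := AEMeasurable.tsum hm
  have hgfin : ∫⁻ s in S, g s ≠ ⊤ := by
    rw [lintegral_tsum hm]
    refine ne_top_of_le_ne_top ENNReal.ofReal_ne_top (b := ENNReal.ofReal (∑' n : ℕ, (1 / 2 : ℝ) ^ n)) ?_
    rw [ENNReal.ofReal_tsum_of_nonneg (fun n => by positivity) summable_geometric_two]
    refine ENNReal.tsum_le_tsum fun n => ?_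
    rw [← ofReal_integral_eq_lintegral_ofReal (hγ _) (h0 _)]
    exact ENNReal.ofReal_le_ofReal (hσ' n)
  refine ⟨σ, fun s => (g s).toReal, hσ, integrable_toReal_of_lintegral_ne_top hgm hgfin, ?_⟩
  filter_upwards [ae_lt_top' hgm hgfin, ae_all_iff.2 h0] with s hs hs0
  constructor
  · have h1 := ENNReal.tendsto_atTop_zero_of_tsum_ne_top hs.ne
    have h2 := (ENNReal.tendsto_toReal ENNReal.zero_ne_top).comp h1
    refine h2.congr fun n => ?_
    exact ENNReal.toReal_ofReal (hs0 _)
  · intro n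
    exact (ENNReal.ofReal_le_iff_le_toReal hs.ne).1 (ENNReal.le_tsum n)

/-! ### Strong convergence of velocities and differentiability of the value function -/

namespace Problem
variable {N : ℕ} {P : Problem N}

/-- Convergence of the costs of curves implies strong convergence of their velocities. -/
lemma exists_subseq_velocity (hP : P.Regular) (h1 : P.H1) (h3 : P.H3) (h4 : P.H4)
    {a b : ℝ} (ha : 0 ≤ a) (hab : a ≤ b) (hb : b ≤ P.T) (i : Fin N) {R K : ℝ} (hR : 0 < R)
    {c v : ℕ → ℝ → ℝ} (hcv : ∀ n, IsW P.p a b (c n) (v n)) (hcR : ∀ n, ∀ s ∈ Icc a b, c n s ∈ Icc 0 R)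
    (hK : ∀ n, ∫ s in Icc a b, |v n s| ^ P.p ≤ K) {c₁ w : ℝ → ℝ} (hcw : IsW P.p a b c₁ w)
    (hw : ContinuousOn w (Icc a b)) (hc₁R : ∀ s ∈ Icc a b, c₁ s ∈ Icc 0 R)
    (hlim : ∀ ε > 0, ∀ᶠ n in atTop, ∀ s ∈ Icc a b, |c n s - c₁ s| ≤ ε)
    (hcost : ∀ ε > 0, ∀ᶠ n in atTop, ∫ s in a..b, P.ℓ i (c n s) (v n s) s ≤
      (∫ s in a..b, P.ℓ i (c₁ s) (w s) s) + ε) :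
    ∃ (σ : ℕ → ℕ) (B : ℝ → ℝ), StrictMono σ ∧ IntegrableOn B (Ioc a b) ∧
      ∀ᵐ s ∂(volume.restrict (Ioc a b)), Tendsto (fun n => v (σ n) s) atTop (𝓝 (w s)) ∧
        ∀ n, |v (σ n) s| ^ P.p ≤ B s := by
  have hp := hP.one_lt_p
  have hSI : Ioc a b ⊆ Icc a b := Ioc_subset_Icc_self
  have hS : Icc a b ⊆ Icc 0 P.T := Icc_subset_Icc ha hb
  have hST : Ioc a b ⊆ Icc 0 P.T := hSI.trans hS
  have hSm : MeasurableSet (Ioc a b) := measurableSet_Ioc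
  have hc₁ : ContinuousOn c₁ (Icc a b) := hcw.continuousOn hp
  have hmaps : MapsTo (fun s : ℝ => (c₁ s, w s, s)) (Icc a b) (Ici 0 ×ˢ univ ×ˢ Icc 0 P.T) :=
    fun s hs => ⟨(hc₁R s hs).1, mem_univ _, hS hs⟩
  have hAc : ContinuousOn (fun s => P.partialA i (c₁ s) (w s) s) (Icc a b) :=
    (hP.partialA_continuous i).comp (f := fun s : ℝ => (c₁ s, w s, s)) (by fun_prop) hmaps
  have hEc : ContinuousOn (fun s => P.ℓ i (c₁ s) (w s) s) (Icc a b) :=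
    (hP.ℓ_continuous i).comp (f := fun s : ℝ => (c₁ s, w s, s)) (by fun_prop) hmaps
  obtain ⟨M, hM⟩ := isCompact_Icc.exists_bound_of_continuousOn hAc
  obtain ⟨E, hE⟩ := isCompact_Icc.exists_bound_of_continuousOn hEc
  obtain ⟨W, hW⟩ := isCompact_Icc.exists_bound_of_continuousOn hw
  simp only [Real.norm_eq_abs] at hM hE hW
  have ham : a ∈ Icc a b := left_mem_Icc.2 hab
  have hM0 : 0 ≤ M := (abs_nonneg _).trans (hM a ham)
  have hW0 : 0 ≤ W := (abs_nonneg _).trans (hW a ham)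
  have hvI : ∀ n, IntegrableOn (v n) (Ioc a b) := fun n =>
    ((hcv n).integrableOn hp).mono_set hSI
  have hwI : IntegrableOn w (Ioc a b) := (hcw.integrableOn hp).mono_set hSI
  have hvp : ∀ n, IntegrableOn (fun s => |v n s| ^ P.p) (Ioc a b) := fun n =>
    (hcv n).pow.mono_set hSI
  have hwp : IntegrableOn (fun s => |w s| ^ P.p) (Ioc a b) := hcw.pow.mono_set hSI
  have hcm : ∀ n, AEMeasurable (c n) (volume.restrict (Ioc a b)) := fun n =>
    (((hcv n).continuousOn hp).mono hSI).aemeasurable hSm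
  have hc₁m : AEMeasurable c₁ (volume.restrict (Ioc a b)) := (hc₁.mono hSI).aemeasurable hSm
  have hvK : ∀ n, ∫ s in Ioc a b, |v n s| ^ P.p ≤ K := fun n => by
    rw [← integral_Icc_eq_integral_Ioc]; exact hK n
  have hAm : AEStronglyMeasurable (fun s => P.partialA i (c₁ s) (w s) s)
      (volume.restrict (Ioc a b)) := (hAc.mono hSI).aestronglyMeasurable hSm
  have i1 : ∀ n, IntegrableOn (fun s => P.ℓ i (c₁ s) (v n s) s) (Ioc a b) := fun n =>
    hP.integrableOn_cost h3 i hSm hST hc₁m (hvI n).aemeasurable (fun s hs => hc₁R s (hSI hs)) (hvp n)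
  have i2 : IntegrableOn (fun s => P.ℓ i (c₁ s) (w s) s) (Ioc a b) :=
    hP.integrableOn_cost h3 i hSm hST hc₁m hwI.aemeasurable (fun s hs => hc₁R s (hSI hs)) hwp
  have i3 : ∀ n, IntegrableOn (fun s => P.ℓ i (c n s) (v n s) s) (Ioc a b) := fun n =>
    hP.integrableOn_cost h3 i hSm hST (hcm n) (hvI n).aemeasurable
      (fun s hs => hcR n s (hSI hs)) (hvp n)
  have i4 : ∀ n, IntegrableOn (fun s => P.partialA i (c₁ s) (w s) s * (v n s - w s)) (Ioc a b) :=
    fun n => ((hvI n).sub hwI).bdd_mul (c := M) hAm (by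
      filter_upwards [ae_restrict_mem hSm] with s hs using hM s (hSI hs))
  have i12 : ∀ n, IntegrableOn (fun s => P.ℓ i (c₁ s) (v n s) s - P.ℓ i (c₁ s) (w s) s) (Ioc a b) :=
    fun n => (i1 n).sub i2
  have iγ : ∀ n, IntegrableOn (fun s => P.gap i (c₁ s) (w s) (v n s) s) (Ioc a b) := fun n =>
    (i12 n).sub (i4 n)
  have eγ : ∀ n, ∫ s in Ioc a b, P.gap i (c₁ s) (w s) (v n s) s =
      (∫ s in Ioc a b, P.ℓ i (c₁ s) (v n s) s) - (∫ s in Ioc a b, P.ℓ i (c₁ s) (w s) s)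
      - ∫ s in Ioc a b, P.partialA i (c₁ s) (w s) s * (v n s - w s) := fun n => by
    rw [← integral_sub (i1 n) i2, ← integral_sub (i12 n) (i4 n)]
    rfl
  have hγ0 : ∀ n, ∀ s ∈ Ioc a b, 0 ≤ P.gap i (c₁ s) (w s) (v n s) s := fun n s hs =>
    hP.gap_nonneg h4 i (hc₁R s (hSI hs)).1 (hST hs) _ _
  have hweak := tendsto_integral_mul_of_rpow_bound hp hab hvI hwI hvp hvK (fun η hη => by
    filter_upwards [hlim (η / 2) (by positivity)] with n hn s hs
    rw [intervalIntegral.integral_sub ((hcv n).intervalIntegrable hp ham hs)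
      (hcw.intervalIntegrable hp ham hs), ← (hcv n).sub_eq hp ham hs, ← hcw.sub_eq hp ham hs]
    have g1 := hn s hs
    have g2 := hn a ham
    calc |c n s - c n a - (c₁ s - c₁ a)| = |(c n s - c₁ s) - (c n a - c₁ a)| := by ring_nf
      _ ≤ |c n s - c₁ s| + |c n a - c₁ a| := abs_sub _ _
      _ ≤ η := by linarith) hAm (fun s hs => hM s (hSI hs))
  obtain ⟨κ, hκ0, hκ⟩ := h3.lipschitz_y hP hR
  -- The integrated gap is a difference of costs, small by `hcost` once `c n` is replaced by `c₁`
  -- with the Lipschitz bound, minus a linear term that vanishes by weak convergence.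
  have hγlim : Tendsto (fun n => ∫ s in Ioc a b, P.gap i (c₁ s) (w s) (v n s) s) atTop (𝓝 0) := by
    rw [Metric.tendsto_nhds]
    intro ε hε
    have hK0 : 0 ≤ K := (integral_nonneg fun s => by positivity).trans (hK 0)
    set Q : ℝ := κ * (K + (b - a)) with hQ
    have hQ0 : 0 ≤ Q := mul_nonneg hκ0 (by linarith)
    have hδ : 0 < ε / (4 * (Q + 1)) := by positivity
    filter_upwards [hlim _ hδ, hcost (ε / 4) (by positivity),
      hweak.eventually_const_lt (show -(ε / 4) < 0 by linarith)] with n hn1 hn2 hn3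
    rw [intervalIntegral.integral_of_le hab, intervalIntegral.integral_of_le hab] at hn2
    have i5 : IntegrableOn (fun s => κ * (|v n s| ^ P.p + 1) * (ε / (4 * (Q + 1)))) (Ioc a b) :=
      (((hvp n).add (integrableOn_const measure_Ioc_lt_top.ne)).const_mul κ).mul_const _
    have e1 : ∫ s in Ioc a b, P.ℓ i (c₁ s) (v n s) s ≤ (∫ s in Ioc a b, P.ℓ i (c n s) (v n s) s)
        + ∫ s in Ioc a b, κ * (|v n s| ^ P.p + 1) * (ε / (4 * (Q + 1))) := by
      rw [← integral_add (i3 n) i5]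
      refine setIntegral_mono_on (i1 n) ((i3 n).add i5) hSm fun s hs => ?_
      have g1 := hκ i _ (hc₁R s (hSI hs)) _ (hcR n s (hSI hs)) (v n s) s (hST hs)
      have g2 := (le_abs_self _).trans g1
      have g3 : κ * (|v n s| ^ P.p + 1) * |c₁ s - c n s| ≤
          κ * (|v n s| ^ P.p + 1) * (ε / (4 * (Q + 1))) := by
        rw [abs_sub_comm]
        exact mul_le_mul_of_nonneg_left (hn1 s (hSI hs)) (by positivity)
      linarith
    have e2 : ∫ s in Ioc a b, κ * (|v n s| ^ P.p + 1) * (ε / (4 * (Q + 1))) ≤ ε / 4 := by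
      rw [integral_mul_const, integral_const_mul,
        integral_add (hvp n) (integrableOn_const measure_Ioc_lt_top.ne)]
      have e3 : ∫ _ in Ioc a b, (1 : ℝ) = b - a := by simp [hab]
      rw [e3]
      calc κ * ((∫ s in Ioc a b, |v n s| ^ P.p) + (b - a)) * (ε / (4 * (Q + 1)))
          ≤ (Q + 1) * (ε / (4 * (Q + 1))) := by
            refine mul_le_mul_of_nonneg_right ?_ hδ.le
            have := mul_le_mul_of_nonneg_left (hvK n) hκ0
            rw [hQ]; nlinarith
        _ = ε / 4 := by field_simp
    rw [Real.dist_eq, sub_zero, abs_of_nonneg (setIntegral_nonneg hSm (hγ0 n)), eγ n]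
    linarith
  obtain ⟨σ, B, hσ, hB, hσB⟩ := exists_subseq_ae_tendsto_zero iγ
    (fun n => by filter_upwards [ae_restrict_mem hSm] with s hs using hγ0 n s hs) hγlim
  obtain ⟨C₀, c₀, hC₀, hℓ, -⟩ := h1
  obtain ⟨C, hC0, hC⟩ := exists_le_mul_rpow_add hp (lam := C₀ / (2 * (M + 1))) (by positivity)
  -- The gap is at most `B`, and half of the coercive term `C₀ * |u| ^ p` absorbs the linear term `M
  -- * |u|`; the other half explains the factor `2 / C₀`.
  refine ⟨σ, fun s => 2 / C₀ * (B s + (E + (M + 1) * C + M * W + |c₀|)), hσ,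
    (hB.add (integrableOn_const measure_Ioc_lt_top.ne)).const_mul _, ?_⟩
  filter_upwards [hσB, ae_restrict_mem hSm] with s hs hsS
  have hsI := hSI hsS
  refine ⟨hP.tendsto_of_gap h4 i (hc₁R s hsI).1 (hST hsS) (w s) hs.1, fun n => ?_⟩
  set u := v (σ n) s
  have g1 := hℓ i (c₁ s) (hc₁R s hsI).1 u s (hST hsS)
  have g2 : P.gap i (c₁ s) (w s) u s ≤ B s := hs.2 n
  unfold gap at g2
  have g3 : P.partialA i (c₁ s) (w s) s * (u - w s) ≤ M * (|u| + W) := by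
    refine (le_abs_self _).trans ?_
    rw [abs_mul]
    exact mul_le_mul (hM s hsI) ((abs_sub _ _).trans (by linarith [hW s hsI])) (abs_nonneg _) hM0
  have g4 : M * |u| ≤ C₀ / 2 * |u| ^ P.p + (M + 1) * C := by
    calc M * |u| ≤ (M + 1) * |u| := by have := abs_nonneg u; nlinarith
      _ ≤ (M + 1) * (C₀ / (2 * (M + 1)) * |u| ^ P.p + C) :=
          mul_le_mul_of_nonneg_left (hC u) (by linarith)
      _ = _ := by field_simp
  have g5 := (le_abs_self _).trans (hE s hsI)
  have g6 := neg_abs_le c₀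
  rw [div_mul_eq_mul_div, le_div_iff₀ hC₀]
  linarith

/-- Minimising sequences of trajectories have subsequences that converge to optimal ones. -/
lemma exists_subseq_optimal [Nonempty (Fin N)] (hP : P.Regular) (h1 : P.H1) (h3 : P.H3)
    (h4 : P.H4) {t : ℝ} (ht : t ∈ Icc 0 P.T) {i : Fin N} {r : ℝ} {x δ : ℕ → ℝ}
    (hx : Tendsto x atTop (𝓝 r)) (hδ : Tendsto δ atTop (𝓝 0))
    {z : ℕ → ℝ → EuclideanSpace ℝ (Fin N)} (hz : ∀ n, P.IsPath t P.T (z n))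
    (hzt : ∀ n, z n t = point i (x n))
    (hcost : ∀ n, P.cost t (z n) ≤ P.value (point i r) t + δ n) :
    ∃ (σ : ℕ → ℕ) (y : ℝ → EuclideanSpace ℝ (Fin N)) (K : ℝ), StrictMono σ ∧
      y ∈ P.optimal t (point i r) ∧ (∀ n j, ∫ s in Icc t P.T, |deriv (z n) s j| ^ P.p ≤ K) ∧
      ∀ ε > 0, ∀ᶠ n in atTop, ∀ s ∈ Icc t P.T, ∀ j, |z (σ n) s j - y s j| ≤ ε := by
  have hTm : P.T ∈ Icc t P.T := ⟨ht.2, le_rfl⟩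
  have htm : t ∈ Icc t P.T := ⟨le_rfl, ht.2⟩
  obtain ⟨Δ, hΔ⟩ := (Metric.isBounded_range_of_tendsto δ hδ).exists_norm_le
  obtain ⟨X, hX⟩ := (Metric.isBounded_range_of_tendsto x hx).exists_norm_le
  obtain ⟨C₀, c₀, hC₀, -, hcoer⟩ := IsPath.coercive (P := P) hP h1
  obtain ⟨G, hG⟩ := hP.terminalCost_lower
  -- The energy left by coercivity when the cost is at most the value plus `Δ` and the terminal cost
  -- is at least `G`.
  set K := (P.value (point i r) t + Δ - G - c₀ * (P.T - t)) / C₀ with hKdef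
  have hK : ∀ n j, ∫ s in Icc t P.T, |deriv (z n) s j| ^ P.p ≤ K := by
    intro n j
    have i1 : IntegrableOn (fun s => |deriv (z n) s j| ^ P.p) (Icc t P.T) := ((hz n).coord j).pow
    have h5 := integral_mono_ae ((i1.const_mul C₀).add (integrableOn_const (C := c₀) volume_Icc_ne_top))
      ((hz n).integrableOn_runningCost hP h3 ht.1 le_rfl)
      (by filter_upwards [hcoer t P.T (z n) ht.1 le_rfl (hz n)] with s hs using hs j)
    have h6 : ∫ s in Icc t P.T, (C₀ * |deriv (z n) s j| ^ P.p + c₀) =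
        C₀ * (∫ s in Icc t P.T, |deriv (z n) s j| ^ P.p) + c₀ * (P.T - t) := by
      rw [integral_add (i1.const_mul C₀) (integrableOn_const volume_Icc_ne_top), integral_const_mul]
      simp [ht.2, mul_comm]
    have h7 := hcost n
    have h8 := hG _ ((hz n).mem _ hTm)
    have h9 := (le_abs_self _).trans (hΔ _ (mem_range_self n))
    unfold cost at h7
    rw [intervalIntegral.integral_of_le ht.2, ← integral_Icc_eq_integral_Ioc] at h7
    rw [hKdef, le_div_iff₀ hC₀]
    have h10 := h6.symm.trans_le h5
    linarith
  obtain ⟨σ, y, hσ, hy, hlim⟩ := exists_tendsto_subseq hP ht.2 hz (R := X) (fun n j => by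
    rw [hzt, point_apply]
    have := hX _ (mem_range_self n)
    split_ifs
    · exact this
    · rw [abs_zero]; exact (norm_nonneg _).trans this) hK
  have hyt : y t = point i r := by
    ext j
    have l1 : Tendsto (fun n => z (σ n) t j) atTop (𝓝 (y t j)) := by
      rw [Metric.tendsto_nhds]
      intro η hη
      filter_upwards [hlim (η / 2) (by positivity)] with n hn
      rw [Real.dist_eq]
      linarith [hn _ htm j]
    refine tendsto_nhds_unique l1 ?_
    simp only [hzt, point_apply]
    split_ifs
    · exact hx.comp hσ.tendsto_atTop
    · exact tendsto_const_nhds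
  refine ⟨σ, y, K, hσ, ?_, hK, hlim⟩
  rw [← hyt]
  refine hy.mem_optimal hP (le_antisymm ?_ (value_le_cost hP h1 h3 ht hy))
  refine le_of_forall_pos_le_add fun ε hε => ?_
  obtain ⟨n, hn1, hn2⟩ := ((cost_lsc hP h1 h3 h4 ht (fun n => hz (σ n)) (fun n => hK (σ n)) hy hlim
    (half_pos hε)).and ((hδ.comp hσ.tendsto_atTop).eventually_le_const (half_pos hε))).exists
  have := hcost (σ n)
  simp only [Function.comp] at hn2
  rw [hyt]
  linarith

/-- If there is only one optimal initial velocity, then along nearly optimal trajectories starting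
from nearby points, the cost can be differentiated in the direction of the initial point. -/
lemma exists_subseq_shift [Nonempty (Fin N)] (hP : P.Regular) (h1 : P.H1) (h3 : P.H3)
    (h4 : P.H4) {t : ℝ} (ht : t ∈ Ico 0 P.T) {i : Fin N} {x a : ℝ} (hx : 0 < x)
    (hA : P.initialVelocities i (point i x) t = {a}) {h δ : ℕ → ℝ} (hh0 : ∀ n, h n ≠ 0)
    (hh : Tendsto h atTop (𝓝 0)) (hδ : Tendsto δ atTop (𝓝 0))
    {z : ℕ → ℝ → EuclideanSpace ℝ (Fin N)} (hz : ∀ n, P.IsPath t P.T (z n))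
    (hzt : ∀ n, z n t = point i (x + h n))
    (hcost : ∀ n, P.cost t (z n) ≤ P.value (point i x) t + δ n) :
    ∃ (σ : ℕ → ℕ) (q : ℕ → ℝ), StrictMono σ ∧ Tendsto q atTop (𝓝 (-P.partialA i x a t)) ∧
      ∀ n, P.value (point i x) t ≤ P.cost t (z (σ n)) - h (σ n) * q n := by
  have hp := hP.one_lt_p
  have htT : t ∈ Icc 0 P.T := Ico_subset_Icc_self ht
  obtain ⟨σ₁, y, K, hσ₁, hy, hK, hlim⟩ := exists_subseq_optimal hP h1 h3 h4 htT
    (by simpa using hh.const_add x) hδ hz hzt hcost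
  have hyp := optimal_isPath hP hy
  have hyt : y t i = x := by rw [hy.1.2.2, point_apply_self]
  obtain ⟨b, htb, hbT, hpos⟩ := hyp.exists_pos hP ht.2 (i := i) (by rwa [hyt])
  obtain ⟨w, hwc, hwae, hwd, hwA, hwW, hval⟩ :=
    exists_deriv_of_optimal_trajectory hP h1 h3 h4 ht.1 htb hbT hy hpos
  have htm : t ∈ Icc t b := left_mem_Icc.2 htb.le
  have hbm : b ∈ Icc t b := right_mem_Icc.2 htb.le
  have htm' : t ∈ Icc t P.T := ⟨le_rfl, ht.2.le⟩
  have hbm' : b ∈ Icc t P.T := ⟨htb.le, hbT⟩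
  have hTm' : P.T ∈ Icc t P.T := ⟨ht.2.le, le_rfl⟩
  -- The only use of `hA`: whichever optimal trajectory arises as the limit, its initial velocity is
  -- `a`.
  have hwt : w t = a := by
    have hmem : w t ∈ P.initialVelocities i (point i x) t :=
      ⟨y, hy, hasDerivWithinAt_Icc_right htb hbT (hwd t htm)⟩
    rwa [hA] at hmem
  have hsub : Icc t b ⊆ Icc t P.T := Icc_subset_Icc_right hbT
  have hyc : ContinuousOn (fun s => y s i) (Icc t b) := hwW.continuousOn hp
  obtain ⟨m, hm, hmy⟩ : ∃ m, 0 < m ∧ ∀ s ∈ Icc t b, m ≤ y s i := by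
    obtain ⟨s₀, hs₀, hmin⟩ := isCompact_Icc.exists_isMinOn ⟨t, htm⟩ hyc
    exact ⟨_, hpos s₀ hs₀, fun s hs => hmin hs⟩
  obtain ⟨R, hR, hyR⟩ := hyp.exists_bound hP
  -- Dropping the first terms keeps the curves within `m / 4` of `y` and the shifts below `m / 4`,
  -- so the shifted curves stay above `m / 2`.
  obtain ⟨n₀, hn₀⟩ := eventually_atTop.1 ((hlim (m / 4) (by positivity)).and
    ((hh.comp hσ₁.tendsto_atTop).abs.eventually_le_const
      (show |(0 : ℝ)| < m / 4 by rw [abs_zero]; positivity)))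
  set τ : ℕ → ℕ := fun n => σ₁ (n + n₀) with hτ
  have hτm : StrictMono τ := hσ₁.comp (strictMono_id.add_const n₀)
  have hτz : ∀ n, ∀ s ∈ Icc t b, |z (τ n) s i - y s i| ≤ m / 4 := fun n s hs =>
    (hn₀ (n + n₀) (by simp)).1 s (hsub hs) i
  have hτh : ∀ n, |h (τ n)| ≤ m / 4 := fun n => (hn₀ (n + n₀) (by simp)).2
  have hτlim : ∀ ε > 0, ∀ᶠ n in atTop, ∀ s ∈ Icc t P.T, ∀ j, |z (τ n) s j - y s j| ≤ ε :=
    fun ε hε => (tendsto_add_atTop_nat n₀).eventually (hlim ε hε)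
  have hzr : ∀ n, ∀ s ∈ Icc t b, z (τ n) s i ∈ Icc (3 * m / 4) (R + m / 4) := fun n s hs => by
    have g1 := abs_le.1 (hτz n s hs)
    have g2 := hmy s hs
    have g3 := (hyR s (hsub hs) i).2
    constructor <;> linarith [g1.1, g1.2]
  have hzpos : ∀ n, ∀ s ∈ Icc t b, 0 < z (τ n) s i := fun n s hs =>
    lt_of_lt_of_le (by positivity) (hzr n s hs).1
  have hztb : ∀ n, P.IsPath t b (z (τ n)) := fun n => (hz _).restrict hP htm' hbm'
  have hcv : ∀ n, IsW P.p t b (fun s => z (τ n) s i) (fun s => deriv (z (τ n)) s i) := fun n =>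
    (hztb n).coord i
  have hKle : ∀ {α β : ℝ}, Icc α β ⊆ Icc t P.T → ∀ n j,
      ∫ s in Icc α β, |deriv (z (τ n)) s j| ^ P.p ≤ K := fun hαβ n j =>
    (setIntegral_mono_set ((hz _).coord j).pow (ae_of_all _ fun s => by positivity)
      hαβ.eventuallyLE).trans (hK _ j)
  have hcostz : ∀ n, P.cost t (z (τ n)) =
      (∫ s in t..b, P.ℓ i (z (τ n) s i) (deriv (z (τ n)) s i) s) + P.cost b (z (τ n)) := fun n => by
    rw [cost_split hP h3 ht.1 htb.le hbT (hz _), (hztb n).integral_runningCost_eq htb.le (hzpos n)]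
  have hcosty : P.value (point i x) t = (∫ s in t..b, P.ℓ i (y s i) (w s) s) + P.cost b y := by
    rw [← hy.2, cost_split hP h3 ht.1 htb.le hbT hyp,
      (hyp.restrict hP htm' hbm').integral_runningCost_eq htb.le hpos]
    congr 1
    refine intervalIntegral.integral_congr_ae ?_
    filter_upwards [(ae_restrict_iff' measurableSet_Icc).1 hwae] with s hs hs'
    rw [uIoc_of_le htb.le] at hs'
    rw [hs (Ioc_subset_Icc_self hs')]
  -- By lower semicontinuity the costs after `b` cannot drop below that of `y` in the limit. The
  -- total cost being nearly optimal, the cost on `[t, b]` cannot exceed that of `y` in the limit.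
  have hcostb : ∀ ε > 0, ∀ᶠ n in atTop, ∫ s in t..b, P.ℓ i (z (τ n) s i) (deriv (z (τ n)) s i) s ≤
      (∫ s in t..b, P.ℓ i (y s i) (w s) s) + ε := by
    intro ε hε
    filter_upwards [cost_lsc hP h1 h3 h4 (t := b) ⟨ht.1.trans htb.le, hbT⟩
      (fun n => (hz (τ n)).restrict hP hbm' hTm') (hKle (Icc_subset_Icc_left htb.le))
      (hyp.restrict hP hbm' hTm') (fun ε hε => (hτlim ε hε).mono fun n hn s hs j =>
        hn s ⟨htb.le.trans hs.1, hs.2⟩ j) (half_pos hε),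
      (hδ.comp hτm.tendsto_atTop).eventually_le_const (half_pos hε)] with n g1 g2
    have g3 := hcost (τ n)
    rw [hcosty, hcostz n] at g3
    simp only [Function.comp] at g2
    linarith
  obtain ⟨σ₂, B, hσ₂, hB, hσB⟩ := exists_subseq_velocity hP h1 h3 h4 ht.1 htb.le hbT i
    (R := R + m / 4) (by positivity) hcv
    (fun n s hs => ⟨(hzpos n s hs).le, (hzr n s hs).2⟩) (fun n => hKle hsub n i) hwW hwc
    (fun s hs => ⟨(hpos s hs).le, (hyR s (hsub hs) i).2.trans (by linarith)⟩)
    (fun ε hε => (hτlim ε hε).mono fun n hn s hs => hn s (hsub hs) i) hcostb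
  have hSI : Ioc t b ⊆ Icc t b := Ioc_subset_Icc_self
  have hST : Ioc t b ⊆ Icc 0 P.T := hSI.trans (Icc_subset_Icc ht.1 hbT)
  have hbt : 0 < b - t := sub_pos.2 htb
  -- The weight `φ` is `1` at `t` and `0` at `b`; with amplitude `-h` it brings the start `x + h`
  -- back to `x` and keeps the point at time `b`.
  set β : ℝ := -(b - t)⁻¹ with hβ
  set φ : ℝ → ℝ := fun s => 1 + β * (s - t) with hφ
  have hφc : Continuous φ := by fun_prop
  have hφ1 : ∀ s ∈ Icc t b, |φ s| ≤ 1 := fun s hs => by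
    have e : (b - t)⁻¹ * (s - t) ≤ 1 := by
      rw [inv_mul_le_iff₀ hbt]; linarith [hs.2]
    have e' : 0 ≤ (b - t)⁻¹ * (s - t) := mul_nonneg (inv_nonneg.2 hbt.le) (sub_nonneg.2 hs.1)
    simp only [hφ, hβ]
    rw [abs_le]
    constructor <;> linarith
  have hpert : ∀ n, ∀ s ∈ Icc t b,
      z (τ n) s i + -h (τ n) * φ s ∈ Icc (m / 2) (R + m / 2) := fun n s hs => by
    have g : |-h (τ n) * φ s| ≤ m / 4 := by
      rw [abs_mul, abs_neg]
      calc |h (τ n)| * |φ s| ≤ m / 4 * 1 :=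
            mul_le_mul (hτh n) (hφ1 s hs) (abs_nonneg _) (by positivity)
        _ = m / 4 := mul_one _
    have g1 := abs_le.1 g
    have g2 := hzr n s hs
    constructor <;> linarith [g1.1, g1.2, g2.1, g2.2]
  have hconv : ∀ s ∈ Icc t b, Tendsto (fun n => z (τ (σ₂ n)) s i) atTop (𝓝 (y s i)) := by
    intro s hs
    rw [Metric.tendsto_nhds]
    intro η hη
    filter_upwards [hσ₂.tendsto_atTop.eventually (hτlim (η / 2) (by positivity))] with n hn
    rw [Real.dist_eq]
    linarith [hn _ (hsub hs) i]
  have key := hP.tendsto_integral_quotient h3 i measurableSet_Ioc hST (half_pos hm)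
    (R := R + m / 2) (K := 1 + |β|) (Y := fun n s => z (τ (σ₂ n)) s i)
    (V := fun n s => deriv (z (τ (σ₂ n))) s i) (Y₀ := fun s => y s i) (V₀ := w) (φ := φ)
    (ψ := fun _ => β) (B := B) (h := fun n => -h (τ (σ₂ n)))
    (fun n => neg_ne_zero.2 (hh0 _))
    (by simpa using (hh.comp (hτm.comp hσ₂).tendsto_atTop).neg)
    (fun s hs => (hφ1 s (hSI hs)).trans (by linarith [abs_nonneg β]))
    (fun s _ => by linarith) hφc.aemeasurable aemeasurable_const
    (fun n => (((hcv _).continuousOn hp).mono hSI).aemeasurable measurableSet_Ioc)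
    (fun n => (IsPath.measurable_deriv_apply _ i).aemeasurable)
    (fun n s hs => by
      have := hzr (σ₂ n) s (hSI hs)
      constructor <;> linarith [this.1, this.2])
    (fun n s hs => hpert (σ₂ n) s (hSI hs))
    (by filter_upwards [ae_restrict_mem measurableSet_Ioc] with s hs using hconv s (hSI hs))
    (hσB.mono fun s hs => hs.1) hB (hσB.mono fun s hs => hs.2)
  have hlimit : ∫ s in Ioc t b, (P.partialY i (y s i) (w s) s * φ s +
      P.partialA i (y s i) (w s) s * β) = -P.partialA i x a t := by
    rw [← intervalIntegral.integral_of_le htb.le, integral_affine_of_hasDerivWithinAt htb.le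
      (continuousOn_partialY_comp hP ht.1 hbT i hyc hwc hpos) hwA 1 β, hwt, hyt, hβ]
    field_simp
    ring
  rw [hlimit] at key
  refine ⟨fun n => τ (σ₂ n), _, hτm.comp hσ₂, key, fun n => ?_⟩
  set k := τ (σ₂ n) with hk
  have hWp : IsW P.p t b (fun s => z k s i + -h k * φ s) (fun s => deriv (z k) s i + -h k * β) :=
    (hcv (σ₂ n)).add_mul hp measurable_const (fun _ => le_rfl) (fun s _ => by
      simp [hφ]; ring) (-h k)
  have hle := value_point_le hP h1 h3 ht.1 htb.le hbT i hWp
    (fun s hs => lt_of_lt_of_le (by positivity) (hpert (σ₂ n) s hs).1)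
  have et : z k t i + -h k * φ t = x := by
    rw [hzt, point_apply_self]; simp [hφ]
  have eb : z k b i + -h k * φ b = z k b i := by
    have : φ b = 0 := by simp only [hφ, hβ]; field_simp; ring
    rw [this, mul_zero, add_zero]
  have hzb : point i (z k b i) = z k b :=
    (eq_point_of_pos ((hz k).mem b hbm') (hzpos (σ₂ n) b hbm)).symm
  rw [et, eb, hzb] at hle
  have hvb := value_le_cost hP h1 h3 ⟨ht.1.trans htb.le, hbT⟩ ((hz k).restrict hP hbm' hTm')
  have hSm : MeasurableSet (Ioc t b) := measurableSet_Ioc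
  have j1 : IntegrableOn (fun s => P.ℓ i (z k s i) (deriv (z k) s i) s) (Ioc t b) :=
    hP.integrableOn_cost h3 i hSm hST ((((hcv (σ₂ n)).continuousOn hp).mono hSI).aemeasurable hSm)
      (IsPath.measurable_deriv_apply _ i).aemeasurable
      (fun s hs => ⟨(hzpos (σ₂ n) s (hSI hs)).le, (hzr (σ₂ n) s (hSI hs)).2⟩)
      ((hcv (σ₂ n)).pow.mono_set hSI)
  have j2 : IntegrableOn (fun s => P.ℓ i (z k s i + -h k * φ s) (deriv (z k) s i + -h k * β) s)
      (Ioc t b) :=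
    hP.integrableOn_cost h3 i hSm hST (((hWp.continuousOn hp).mono hSI).aemeasurable hSm)
      ((hWp.integrableOn hp).mono_set hSI).aemeasurable
      (fun s hs => ⟨le_trans (by positivity) (hpert (σ₂ n) s (hSI hs)).1,
        (hpert (σ₂ n) s (hSI hs)).2⟩)
      (hWp.pow.mono_set hSI)
  have hck := hcostz (σ₂ n)
  rw [← hk, intervalIntegral.integral_of_le htb.le] at hck
  rw [intervalIntegral.integral_of_le htb.le] at hle
  have hq : h k * ∫ s in Ioc t b, (P.ℓ i (z k s i + -h k * φ s) (deriv (z k) s i + -h k * β) s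
      - P.ℓ i (z k s i) (deriv (z k) s i) s) / -h k =
      (∫ s in Ioc t b, P.ℓ i (z k s i) (deriv (z k) s i) s)
      - ∫ s in Ioc t b, P.ℓ i (z k s i + -h k * φ s) (deriv (z k) s i + -h k * β) s := by
    rw [integral_div, integral_sub j2 j1]
    have := hh0 k
    field_simp
    ring
  rw [hq, hck]
  linarith

/-- If there is only one optimal initial velocity, the value function is differentiable. -/
lemma hasDerivAt_value_of_singleton [Nonempty (Fin N)] (hP : P.Regular) (h1 : P.H1) (h3 : P.H3)
    (h4 : P.H4) {t : ℝ} (ht : t ∈ Ico 0 P.T) {i : Fin N} {x a : ℝ} (hx : 0 < x)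
    (hA : P.initialVelocities i (point i x) t = {a}) :
    HasDerivAt (fun r => P.value (point i r) t) (-P.partialA i x a t) x := by
  obtain ⟨z₀, hz₀, hz₀a⟩ : a ∈ P.initialVelocities i (point i x) t := by rw [hA]; rfl
  obtain ⟨v, U, hv, hU0, hUd, hU⟩ := exists_initialVelocity hP h1 h3 h4 ht hx hz₀
  obtain rfl := unique_right_deriv ht.2 hz₀a hv
  set D := -P.partialA i x a t with hD
  have hlow : ∀ ε > 0, ∀ᶠ r in 𝓝 x,
      P.value (point i x) t + D * (r - x) - ε * |r - x| ≤ P.value (point i r) t := by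
    intro ε hε
    by_contra hcon
    -- If the expansion from below fails frequently, it fails along a sequence of positive points;
    -- these differ from `x`, where the expansion is an equality.
    obtain ⟨ρ, hρ, hρ'⟩ := exists_seq_forall_of_frequently
      ((not_eventually.1 hcon).and_eventually (lt_mem_nhds hx))
    set h : ℕ → ℝ := fun n => ρ n - x with hh
    have hlim : Tendsto h atTop (𝓝 0) := by simpa using hρ.sub_const x
    have hh0 : ∀ n, h n ≠ 0 := by
      intro n hn
      refine (hρ' n).1 ?_
      have : ρ n = x := sub_eq_zero.1 hn
      simp [this]
    -- Near-optimality up to `h ^ 2` is negligible against the defect `ε * |h|`.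
    choose z hz hzt hzc using fun n => exists_cost_lt hP (t := t)
      (point_mem_junction i (hρ' n).2.le) (ε := h n ^ 2) (by have := hh0 n; positivity)
    have hbound : ∀ n, P.cost t (z n) ≤
        P.value (point i x) t + (D * h n - ε * |h n| + h n ^ 2) := fun n => by
      have := not_le.1 (hρ' n).1
      linarith [hzc n]
    obtain ⟨σ, q, hσ, hq, hle⟩ := exists_subseq_shift hP h1 h3 h4 ht hx hA hh0 hlim
      (δ := fun n => D * h n - ε * |h n| + h n ^ 2)
      (by simpa using ((hlim.const_mul D).sub (hlim.abs.const_mul ε)).add (hlim.pow 2)) hz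
      (fun n => by rw [hzt]; simp [hh]) hbound
    rw [← hD] at hq
    have hσh : Tendsto (fun n => |q n - D| + |h (σ n)|) atTop (𝓝 0) := by
      simpa using (hq.sub_const D).abs.add (hlim.comp hσ.tendsto_atTop).abs
    obtain ⟨n, hn⟩ := (hσh.eventually_lt_const hε).exists
    -- Together the two bounds give `ε * |k| ≤ |k| * (|q n - D| + |k|)`, against the choice of `n`.
    have g1 := hle n
    have g2 := hbound (σ n)
    set k := h (σ n)
    have hk : 0 < |k| := abs_pos.2 (hh0 _)
    have g3 : -(k * (q n - D)) ≤ |k| * |q n - D| := by rw [← abs_mul]; exact neg_le_abs _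
    have g4 : k ^ 2 = |k| * |k| := by rw [abs_mul_abs_self, sq]
    have g5 : |k| * (|q n - D| + |k|) < |k| * ε := mul_lt_mul_of_pos_left hn hk
    nlinarith
  rw [hasDerivAt_iff_isLittleO, Asymptotics.isLittleO_iff]
  intro ε hε
  have hUo := (Asymptotics.isLittleO_iff.1 (hasDerivAt_iff_isLittleO.1 hUd)) hε
  filter_upwards [hlow ε hε, hU, hUo] with r g1 g2 g3
  simp only [Real.norm_eq_abs, smul_eq_mul] at g3 ⊢
  rw [hU0] at g3
  have g4 := (le_abs_self _).trans g3
  rw [abs_le]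
  constructor <;> linarith

/-- Before the hitting time of the vertex, a trajectory stays in the interior of its edge. -/
lemma IsPath.pos_of_lt_hittingTime (hP : P.Regular) {t : ℝ} (ht : t < P.T) {i : Fin N}
    {y : ℝ → EuclideanSpace ℝ (Fin N)} (h : P.IsPath t P.T y) (hyt : 0 < y t i) {s : ℝ}
    (hs : s ∈ Ico t (P.hittingTime t y)) : s < P.T ∧ ∀ τ ∈ Icc t s, 0 < y τ i := by
  have hsT := (ne_zero_of_lt_hittingTime ht.le hs).2
  refine ⟨hsT, ?_⟩
  refine IsPath.pos_of_ne_zero hP (h.restrict hP ⟨le_rfl, ht.le⟩ ⟨hs.1, hsT.le⟩) hyt fun τ hτ => ?_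
  exact (ne_zero_of_lt_hittingTime ht.le ⟨hτ.1, hτ.2.trans_lt hs.2⟩).1

end Problem
end JunctionControl
end

theorem mainTheorem8 {N : ℕ} (hN : 1 < N) (P : JunctionControl.Problem N) (hP : P.Regular)
    (h1 : P.H1) (h2 : P.H2) (h3 : P.H3) (h4 : P.H4) (h5 : P.H5)
    (t : ℝ) (ht : t ∈ Ico 0 P.T) (i : Fin N) (xbar : ℝ) (hx : 0 < xbar)
    (y : ℝ → EuclideanSpace ℝ (Fin N))
    (hy : y ∈ P.optimal t (JunctionControl.point i xbar)) :
    -- before `t_*` the trajectory stays in `J_i \ {0}`, and all optimal trajectories starting from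
    -- its points have an initial velocity
    (∀ s ∈ Ico t (P.hittingTime t y),
      0 < ‖y s‖ ∧ y s = JunctionControl.point i ‖y s‖ ∧
      ∀ z ∈ P.optimal s (y s),
        ∃ a : ℝ, HasDerivWithinAt (fun τ => z τ i) a (Icc s P.T) s) ∧
    -- uniqueness of the optimal initial velocity at later points
    (∀ s ∈ Ioo t (P.hittingTime t y), ∃ a : ℝ, P.initialVelocities i (y s) s = {a}) ∧
    -- differentiability of `u(·, t)` at `x` and uniqueness of the optimal initial velocity
    ((DifferentiableAt ℝ (fun r => P.value (JunctionControl.point i r) t) xbar ↔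
        ∃ a : ℝ, P.initialVelocities i (JunctionControl.point i xbar) t = {a}) ∧
      ∀ q : ℝ, HasDerivAt (fun r => P.value (JunctionControl.point i r) t) q xbar →
        P.initialVelocities i (JunctionControl.point i xbar) t
            = (fun a => P.partialA i xbar a t) ⁻¹' {-q} ∧
        ∃ d : ℝ, HasDerivAt (fun q' => P.hamiltonian i xbar q' t) d q ∧
          P.initialVelocities i (JunctionControl.point i xbar) t = {-d}) ∧
    -- differentiability of `u` in space along the trajectory
    (∀ s ∈ Ioo t (P.hittingTime t y),
      DifferentiableAt ℝ (fun τ => ‖y τ‖) s ∧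
      HasDerivAt (fun r => P.value (JunctionControl.point i r) s)
        (-P.partialA i ‖y s‖ (deriv (fun τ => ‖y τ‖) s) s) ‖y s‖) := by
  have : Nonempty (Fin N) := ⟨i⟩
  have hyp := JunctionControl.Problem.optimal_isPath hP hy
  have hyt : y t i = xbar := by rw [hy.1.2.2, JunctionControl.point_apply_self]
  have hpos := fun s hs => hyp.pos_of_lt_hittingTime hP ht.2 (i := i) (by rwa [hyt]) (s := s) hs
  have hnorm : ∀ s ∈ Ico t (P.hittingTime t y), ‖y s‖ = y s i := fun s hs =>
    JunctionControl.norm_eq_of_pos (hyp.mem s ⟨hs.1, (hpos s hs).1.le⟩)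
      ((hpos s hs).2 s ⟨hs.1, le_rfl⟩)
  have hpoint : ∀ s ∈ Ico t (P.hittingTime t y), y s = JunctionControl.point i (y s i) :=
    fun s hs => JunctionControl.eq_point_of_pos (hyp.mem s ⟨hs.1, (hpos s hs).1.le⟩)
      ((hpos s hs).2 s ⟨hs.1, le_rfl⟩)
  have hint : ∀ s ∈ Ioo t (P.hittingTime t y), ∃ a, P.initialVelocities i (y s) s = {a} ∧
      HasDerivAt (fun τ => y τ i) a s ∧
      HasDerivAt (fun r => P.value (JunctionControl.point i r) s)
        (-P.partialA i (y s i) a s) (y s i) := by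
    intro s hs
    -- Room to the right of `s` before the vertex, as needed for an interior time.
    obtain ⟨b, hsb, hb⟩ := exists_between hs.2
    obtain ⟨hbT, hbpos⟩ := hpos b ⟨(hs.1.trans hsb).le, hb⟩
    exact JunctionControl.Problem.interior_time hP h1 h3 h4 ht.1 hs.1 hsb hbT.le hy hbpos
  refine ⟨fun s hs => ?_, fun s hs => ?_, ⟨⟨fun hd => ?_, fun ⟨a, ha⟩ => ?_⟩, fun q hq => ?_⟩,
    fun s hs => ?_⟩
  · have hsi := (hpos s hs).2 s ⟨hs.1, le_rfl⟩
    rw [hnorm s hs]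
    refine ⟨hsi, hpoint s hs, fun z hz => ?_⟩
    rw [hpoint s hs] at hz
    obtain ⟨v, -, hv, -⟩ := JunctionControl.Problem.exists_initialVelocity hP h1 h3 h4
      ⟨ht.1.trans hs.1, (hpos s hs).1⟩ hsi hz
    exact ⟨v, hv⟩
  · obtain ⟨a, ha, -⟩ := hint s hs
    exact ⟨a, ha⟩
  · obtain ⟨a, ha, -⟩ := JunctionControl.Problem.initialVelocities_eq_preimage hP h1 h3 h4 ht hx hy
      hd.hasDerivAt
    exact ⟨a, ha⟩
  · exact (JunctionControl.Problem.hasDerivAt_value_of_singleton hP h1 h3 h4 ht hx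
      ha).differentiableAt
  · obtain ⟨a, ha, hpre, haq⟩ :=
      JunctionControl.Problem.initialVelocities_eq_preimage hP h1 h3 h4 ht hx hy hq
    exact ⟨hpre, -a, hP.hasDerivAt_hamiltonian h1 h4 i hx.le (Ico_subset_Icc_self ht) haq,
      by rw [neg_neg, ha]⟩
  · obtain ⟨a, -, hya, hu⟩ := hint s hs
    have hev : (fun τ => ‖y τ‖) =ᶠ[𝓝 s] fun τ => y τ i := by
      filter_upwards [Ioo_mem_nhds hs.1 hs.2] with τ hτ using hnorm τ (Ioo_subset_Ico_self hτ)
    have hd : HasDerivAt (fun τ => ‖y τ‖) a s := hya.congr_of_eventuallyEq hev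
    rw [hd.deriv, hnorm s (Ioo_subset_Ico_self hs)]
    exact ⟨hd.differentiableAt, hu⟩
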